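/- **Setting.** Let $\mathbb F_q$ be the field with $q$ elements ($q$ a prime power). An $[n,k,d]$ code is a $k$-dimensional subspace $C\subseteq\mathbb F_q^n$ with minimum Hamming distance exactly $d$. It is a locally recoverable code (LRC) with locality $r$ if for every coordinate $i$ there is a set $R_i\subseteq\{1,\dots,n\}\setminus\{i\}$ with $|R_i|=r$ such that any two codewords agree on $R_i\cup\{i\}$ if and only if they agree on $R_i$. An $[n,k,d]$ LRC with locality $r$ and $(r+1)\mid n$ is called optimal if $d=n-k-\lceil k/r\rceil+2$ (the Singleton-type bound); in the exceptional case $d-2\equiv r \pmod{r+1}$, in which a code of distance $d$ cannot attain this bound with equality, it is called optimal if $d=n-k-\lceil k/r\rceil+1$. Given sets $A_i=\{a_{i,1},\dots,a_{i,r+1}\}\subseteq\mathbb F_q$ of size $r+1$ $(1\le i\le m)$, the associated Vandermonde-type matrix is the $(m+d-2)\times m(r+1)$ matrix $H$ whose columns, ordered lexicographically in $(i,j)$, are $$\bigl(\mathbf e_i,\ a_{i,j},\ a_{i,j}^2,\ \dots,\ a_{i,j}^{d-2}\bigr)^{T},\qquad 1\le i\le m,\ 1\le j\le r+1,$$ where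 $\mathbf e_1,\dots,\mathbf e_m$ is the standard basis of $\mathbb F_q^m$. A parity-check matrix of $C$ is a matrix with linearly independent rows whose kernel is $C$. **Theorem.** Let $d\ge 5$ and $t=\lfloor (d-1)/2\rfloor$. For every $r\ge d-2$ there is $q_0=q_0(d,r)$ such that the following hold. 1. For every prime power $q\ge q_0$ there are $n$ with $(r+1)\mid n$ and $$n\ \ge\ \frac{q^{1+\frac1{t-1}}}{2t^2\,(r+1)^{1+\frac2{t-1}}},$$ an integer $k$, and an optimal $[n,k,d]$ LRC over $\mathbb F_q$ with locality $r$ that has a parity-check matrix of the Vandermonde type above, with $m=n/(r+1)$. 2. If $d$ is a constant, such a code can be constructed by a deterministic polynomial-time algorithm: for every $d\ge5$ there are a program for a deterministic random access machine (unit cost, with addition and truncated subtraction of natural numbers) and a polynomial $p_d$ such that for all $r\ge d-2$ and all prime powers $q\ge q_0(d,r)$, given $q$, $r$ and the addition and multiplication tables of $\mathbb F_q$ (for any numbering of its elements by $0,\dots,q-1$), the program halts after at most $p_d(q)$ steps and outputs a Vandermonde-type parity-check matrix of a code as in 1. -/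

import Mathlib

/-! ### Linear codes and locality -/

/-- `d` is the minimum Hamming distance of the code `C` (so `C` has at least two codewords). -/
def HasMinDist {F : Type*} [Field F] [DecidableEq F] {n : ℕ}
    (C : Submodule F (Fin n → F)) (d : ℕ) : Prop :=
  IsLeast {w : ℕ | ∃ u ∈ C, ∃ v ∈ C, u ≠ v ∧ hammingDist u v = w} d

/-- `C` has locality `r`: every coordinate `i` has a recovering set `R` of size `r`
not containing `i`, i.e. two codewords agree on `R ∪ {i}` if and only if they agree on `R`. -/
def HasLocality {F : Type*} [Field F] {n : ℕ}
    (C : Submodule F (Fin n → F)) (r : ℕ) : Prop :=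
  ∀ i : Fin n, ∃ R : Finset (Fin n), i ∉ R ∧ R.card = r ∧
    ∀ u ∈ C, ∀ v ∈ C, (∀ j ∈ insert i R, u j = v j) ↔ (∀ j ∈ R, u j = v j)

/-- `C` is an optimal `[n, k, d]` locally recoverable code with locality `r` (for lengths `n`
divisible by `r + 1`): it attains the Singleton-type bound `d = n - k - ⌈k / r⌉ + 2`. In the
exceptional case `d - 2 ≡ r (mod r + 1)`, where no such code of distance `d` attains this
bound, optimal means `d = n - k - ⌈k / r⌉ + 1`. -/
structure IsOptimalLRC {F : Type*} [Field F] [DecidableEq F] {n : ℕ}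
    (C : Submodule F (Fin n → F)) (k d r : ℕ) : Prop where
  finrank_eq : Module.finrank F C = k
  minDist : HasMinDist C d
  locality : HasLocality C r
  bound : (d : ℤ) = (n : ℤ) - k - ⌈(k : ℚ) / r⌉ +
    (if (d : ℤ) - 2 ≡ r [ZMOD (r + 1)] then 1 else 2)

/-- `H` is a parity-check matrix of `C`: its rows are linearly independent and `C` is its
(right) kernel. -/
def IsParityCheckMatrix {F : Type*} [Field F] {s n : ℕ}
    (H : Matrix (Fin s) (Fin n) F) (C : Submodule F (Fin n → F)) : Prop :=
  LinearIndependent F (fun i : Fin s => H i) ∧ ∀ c : Fin n → F, c ∈ C ↔ H.mulVec c = 0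

/-- The Vandermonde-type matrix of the blocks `A_b = {a b 0, …, a b r}`, `b < m`.
The column number `b (r + 1) + j` is `(e_b, a b j, (a b j) ^ 2, …, (a b j) ^ (d - 2))`, where
`e_b` is the `b`-th standard basis vector of length `m`. -/
def vandermondeTypeMatrix {F : Type*} [Field F] {m r : ℕ} (d : ℕ)
    (a : Fin m → Fin (r + 1) → F) : Matrix (Fin (m + (d - 2))) (Fin (m * (r + 1))) F :=
  Matrix.of fun i j =>
    Fin.addCases (fun b : Fin m => if j.divNat = b then (1 : F) else 0)
      (fun s : Fin (d - 2) => a j.divNat j.modNat ^ ((s : ℕ) + 1)) i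

/-- The lower bound `q ^ (1 + 1/(t-1)) / (2 t² (r+1) ^ (1 + 2/(t-1)))` on the length, with
`t = ⌊(d - 1) / 2⌋`. -/
noncomputable def lengthBound (q d r : ℕ) : ℝ :=
  let t : ℝ := (((d - 1) / 2 : ℕ) : ℝ)
  (q : ℝ) ^ (1 + 1 / (t - 1)) / (2 * t ^ 2 * ((r : ℝ) + 1) ^ (1 + 2 / (t - 1)))

/-- The blocks `a` give, through the Vandermonde-type parity-check matrix, an optimal
`[n, k, d]` locally recoverable code over `F` with locality `r`, length `n = m (r + 1)` and `n`
at least the lower bound. -/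
def GivesLongOptimalLRC {F : Type*} [Field F] [Fintype F] [DecidableEq F] {m r : ℕ} (d : ℕ)
    (a : Fin m → Fin (r + 1) → F) : Prop :=
  (∀ b, Function.Injective (a b)) ∧
  lengthBound (Fintype.card F) d r ≤ ((m * (r + 1) : ℕ) : ℝ) ∧
  ∃ (k : ℕ) (C : Submodule F (Fin (m * (r + 1)) → F)),
    IsOptimalLRC C k d r ∧ IsParityCheckMatrix (vandermondeTypeMatrix d a) C

/-! ### A random access machine with step count

Programs act on finitely many unbounded arrays of natural numbers (a program mentions only
finitely many array names; registers are cells with a constant index). The arithmetic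
operations are addition and truncated subtraction, so that numbers gain at most a constant
number of bits per step and unit cost agrees with Turing machine time up to a polynomial. -/

namespace RAM

/-- The memory: `σ k i` is the content of cell `i` of array `k`. -/
abbrev State := ℕ → ℕ → ℕ

/-- Expressions: constants, reading cell `e` of the array `k`, sum, truncated difference. -/
inductive Expr where
  | const (c : ℕ)
  | get (k : ℕ) (e : Expr)
  | add (e₁ e₂ : Expr)
  | sub (e₁ e₂ : Expr)

/-- The value of an expression. -/
def Expr.eval (σ : State) : Expr → ℕ
  | .const c => c
  | .get k e => σ k (e.eval σ)
  | .add e₁ e₂ => e₁.eval σ + e₂.eval σ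
  | .sub e₁ e₂ => e₁.eval σ - e₂.eval σ

/-- The number of elementary operations made in evaluating an expression. -/
def Expr.cost : Expr → ℕ
  | .const _ => 1
  | .get _ e => e.cost + 1
  | .add e₁ e₂ => e₁.cost + e₂.cost + 1
  | .sub e₁ e₂ => e₁.cost + e₂.cost + 1

/-- Programs. A condition holds when its expression is nonzero. -/
inductive Prog where
  | skip
  | set (k : ℕ) (i e : Expr)
  | seq (P Q : Prog)
  | ite (e : Expr) (P Q : Prog)
  | while (e : Expr) (P : Prog)

/-- `Exec P σ τ T`: started in the memory `σ`, the program `P` halts with the memory `τ`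
after exactly `T` elementary steps. -/
inductive Exec : Prog → State → State → ℕ → Prop where
  | skip (σ : State) : Exec .skip σ σ 1
  | set (k : ℕ) (i e : Expr) (σ : State) :
      Exec (.set k i e) σ
        (Function.update σ k (Function.update (σ k) (i.eval σ) (e.eval σ))) (i.cost + e.cost + 1)
  | seq {P Q : Prog} {σ τ ρ : State} {S T : ℕ} (hP : Exec P σ τ S) (hQ : Exec Q τ ρ T) :
      Exec (.seq P Q) σ ρ (S + T)
  | ite_true {e : Expr} {P Q : Prog} {σ τ : State} {T : ℕ} (h : e.eval σ ≠ 0)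
      (hP : Exec P σ τ T) : Exec (.ite e P Q) σ τ (e.cost + 1 + T)
  | ite_false {e : Expr} {P Q : Prog} {σ τ : State} {T : ℕ} (h : e.eval σ = 0)
      (hQ : Exec Q σ τ T) : Exec (.ite e P Q) σ τ (e.cost + 1 + T)
  | while_true {e : Expr} {P : Prog} {σ τ ρ : State} {S T : ℕ} (h : e.eval σ ≠ 0)
      (hP : Exec P σ τ S) (hW : Exec (.while e P) τ ρ T) :
      Exec (.while e P) σ ρ (e.cost + 1 + S + T)
  | while_false {e : Expr} {P : Prog} {σ : State} (h : e.eval σ = 0) :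
      Exec (.while e P) σ σ (e.cost + 1)

/-- The machine is deterministic: the final memory and the running time are determined by the
program and the initial memory. -/
theorem Exec.deterministic {P : Prog} {σ τ τ' : State} {T T' : ℕ} (h : Exec P σ τ T)
    (h' : Exec P σ τ' T') : τ = τ' ∧ T = T' := by
  induction h generalizing τ' T' with
  | skip => cases h'; exact ⟨rfl, rfl⟩
  | set => cases h'; exact ⟨rfl, rfl⟩
  | seq _ _ ihP ihQ =>
    cases h' with
    | seq hP hQ =>
      obtain ⟨rfl, rfl⟩ := ihP hP
      obtain ⟨rfl, rfl⟩ := ihQ hQ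
      exact ⟨rfl, rfl⟩
  | ite_true h _ ih =>
    cases h' with
    | ite_true _ hP => obtain ⟨rfl, rfl⟩ := ih hP; exact ⟨rfl, rfl⟩
    | ite_false h0 _ => exact absurd h0 h
  | ite_false h _ ih =>
    cases h' with
    | ite_true h0 _ => exact absurd h h0
    | ite_false _ hQ => obtain ⟨rfl, rfl⟩ := ih hQ; exact ⟨rfl, rfl⟩
  | while_true h _ _ ihP ihW =>
    cases h' with
    | while_true _ hP hW =>
      obtain ⟨rfl, rfl⟩ := ihP hP
      obtain ⟨rfl, rfl⟩ := ihW hW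
      exact ⟨rfl, rfl⟩
    | while_false h0 => exact absurd h0 h
  | while_false h =>
    cases h' with
    | while_true h0 _ _ => exact absurd h h0
    | while_false _ => exact ⟨rfl, rfl⟩

/-- The element of `F` with number `i < q` in the numbering `e`. -/
def elt {F : Type*} [Field F] {q : ℕ} (e : F ≃ Fin q) (i : ℕ) : F :=
  if h : i < q then e.symm ⟨i, h⟩ else 0

/-- The input `(F, r)`, for a field `F` with elements numbered `0, …, q - 1` by `e`: the number
`q` in cell `0` of array `0`, the number `r` in cell `0` of array `1`, the addition table of `F` in
array `2` and the multiplication table in array `3` (the result for the elements with numbers `x`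
and `y` is in cell `x q + y`). All other cells are `0`. -/
def inputState {F : Type*} [Field F] {q : ℕ} (e : F ≃ Fin q) (r : ℕ) : State
  | 0, i => if i = 0 then q else 0
  | 1, i => if i = 0 then r else 0
  | 2, i => if i < q * q then (e (elt e (i / q) + elt e (i % q)) : ℕ) else 0
  | 3, i => if i < q * q then (e (elt e (i / q) * elt e (i % q)) : ℕ) else 0
  | _, _ => 0

/-- The memory `τ` holds the matrix `H` as output: its numbers of rows and columns are in the
cells `0` and `1` of array `0`, and its entries (as numbers of field elements) are in array `1`,
row by row. -/
def HoldsMatrix {F : Type*} {q s n : ℕ} (e : F ≃ Fin q) (τ : State)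
    (H : Matrix (Fin s) (Fin n) F) : Prop :=
  τ 0 0 = s ∧ τ 0 1 = n ∧ ∀ (i : Fin s) (j : Fin n), τ 1 ((i : ℕ) * n + j) = (e (H i j) : ℕ)

end RAM

/-!
A code with a parity-check matrix of the Vandermonde type is given by a system of `m` blocks of
`w = r + 1` points of the field. The idea is to choose the blocks greedily, one after the other,
such that no two points of a new block are connected by a chain of `t - 1` or fewer steps, where
`t = ⌊(d - 1) / 2⌋` and each step stays within one of the earlier blocks (`BlockSystem.Good`).

*Distance.* Suppose a nonzero word of weight less than `d` satisfies the parity checks. Its sum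
over all places with the same point vanishes, by Lagrange interpolation (`sum_fiber_eq_zero`). As
its sum over each block vanishes too, it meets at most `t` blocks, each in at least two places.
Starting from a place in the last of these blocks, take the sum over all points connected with it
through the other, at most `t - 1`, blocks. This shows that it is so connected with a second point
of the last block, which is excluded (`eq_zero_of_card_support_le`). A word of weight exactly `d`
exists on a single block if `d ≤ r + 1`. If `d = r + 2`, which is the exceptional case of the
bound, it exists on `r` points of the first block and two points of the second one, provided the
polynomial vanishing on the `r` points takes the same nonzero value at the two others. Power sums
show that there are two such points in a large field (`exists_ne_prod_sub_eq`), and the second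
block is made to contain them.

*Length.* Let all points have degree at most `D`, the degree being the number of blocks that
contain the point. If a block cannot be completed with points of degree less than `D`, then all
these points are within `t - 1` steps of fewer than `w` points, so there are at most
`r (1 + D w) ^ (t - 1)` of them, and the number of places is at least `D` times the number of the
others (`mul_le_of_forall_reach`). With `D` about `(q / 2w) ^ (1 / (t - 1)) / w` this is at least
the required length (`exists_degree`).

*Running time.* The greedy choice is deterministic. Instead of computing the best value of `D`,
the program runs through the degree limits `D = 2, 3, …` and tries `q²` times for each of them to
add a block; blocks are added only while there are at most `q²` places, and a system with more
places would be long enough anyway. The relations of being connected in a given number of steps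
are kept as `q × q` tables, and since `t` depends on `d` only, there are boundedly many of them.
The program is written in a language in which all loops have the same bound, so that its effect is
a function `LProg.run` and its running time is bounded by a polynomial `LProg.costPoly` of this
bound (`LProg.exec_compile`). The bound is `q` at first and then `q²`.

*Memory.* Single numbers are kept in cell `0` of an array of their own. Arrays `0` to `3` hold the
input and at the end also the output; `5` the bound of the loops; `6` the number `q`; `7` the size
`w` of the blocks; `8` the multiples of `q`; `9`, `10`, `11` the field elements `0`, `1`, `-1`;
`12` the points, block after block; `13` their degrees; `14` and `15` the block number and a power
of the point for each place; `16` and `17` the numbers of blocks and of places; `18` and `19` the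
points chosen for the next block and their number; `24` the degree limit; `25` a flag; `26` to
`28` the values of a polynomial and two points with the same value; `29` the multiple of `q`
reached in the tabulation, then `q²`; `30` and `33` the number of entries written and the number
of rows; `20`, `21`, `22`, `31` and `32` loop variables; `41` and the following arrays the
relations of being connected in `1, 2, …` steps.
-/

namespace BlockSystem

open Finset

/-! ### Block systems -/

/-- The points `u` and `v` lie in a common block among the first `m` ones. The blocks are given by
the sequence `L` of points: block `b` consists of `L (b w), …, L (b w + w - 1)`. -/
def Adj (L : ℕ → ℕ) (w m u v : ℕ) : Prop :=
  ∃ b < m, ∃ i < w, ∃ j < w, L (b * w + i) = u ∧ L (b * w + j) = v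

/-- `v` is reached from `u` in at most `k` steps, each within one of the first `m` blocks. -/
def Reach (L : ℕ → ℕ) (w m : ℕ) : ℕ → ℕ → ℕ → Prop
  | 0, u, v => u = v
  | k + 1, u, v => ∃ x, Reach L w m k u x ∧ (x = v ∨ Adj L w m x v)

/-- Blocks of points smaller than `q` such that no two points of a block can be reached from each
other in `s` steps through earlier blocks. -/
structure Good (L : ℕ → ℕ) (w q s m : ℕ) : Prop where
  lt : ∀ p < m * w, L p < q
  far : ∀ b < m, ∀ i j, i < j → j < w → ¬ Reach L w b s (L (b * w + i)) (L (b * w + j))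

variable {L L' : ℕ → ℕ} {w m q s k u v : ℕ}

theorem mul_add_lt {b i : ℕ} (hb : b < m) (hi : i < w) : b * w + i < m * w := by
  calc b * w + i < b * w + w := by omega
    _ = (b + 1) * w := by ring
    _ ≤ m * w := Nat.mul_le_mul_right _ hb

theorem Adj.congr (h : ∀ p < m * w, L p = L' p) : Adj L w m u v ↔ Adj L' w m u v := by
  unfold Adj
  refine exists_congr fun b => and_congr_right fun hb => exists_congr fun i =>
    and_congr_right fun hi => exists_congr fun j => and_congr_right fun hj => ?_
  rw [h _ (mul_add_lt hb hi), h _ (mul_add_lt hb hj)]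

theorem Reach.congr (h : ∀ p < m * w, L p = L' p) :
    Reach L w m k u v ↔ Reach L' w m k u v := by
  induction k generalizing v with
  | zero => rfl
  | succ k ih => simp only [Reach, ih, Adj.congr h]

theorem Reach.succ (h : Reach L w m k u v) : Reach L w m (k + 1) u v := ⟨v, h, .inl rfl⟩

theorem Reach.mono {k' : ℕ} (h : Reach L w m k u v) (hk : k ≤ k') : Reach L w m k' u v := by
  induction hk with
  | refl => exact h
  | step _ ih => exact ih.succ

theorem Reach.refl (k : ℕ) : Reach L w m k u u :=
  Reach.mono (k := 0) (by rfl) (Nat.zero_le k)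

theorem Reach.mono_blocks {m' : ℕ} (h : Reach L w m k u v) (hm : m ≤ m') :
    Reach L w m' k u v := by
  induction k generalizing v with
  | zero => exact h
  | succ k ih =>
    obtain ⟨x, hx, hxv⟩ := h
    refine ⟨x, ih hx, hxv.imp_right ?_⟩
    rintro ⟨b, hb, h⟩
    exact ⟨b, hb.trans_le hm, h⟩

theorem Reach.one : Reach L w m 1 u v ↔ u = v ∨ Adj L w m u v := by
  simp [Reach]

/-- Points outside all blocks are reached from themselves only. -/
theorem Reach.eq_of_forall_not_adj_left (hu : ∀ x, ¬ Adj L w m u x) (h : Reach L w m k u v) :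
    u = v := by
  induction k generalizing v with
  | zero => exact h
  | succ k ih =>
    obtain ⟨x, hx, hxv⟩ := h
    obtain rfl := ih hx
    exact hxv.resolve_right (hu _)

theorem Reach.eq_of_forall_not_adj_right {L : ℕ → ℕ} {w m k u v : ℕ} (hv : ∀ x, ¬ Adj L w m x v)
    (h : Reach L w m k u v) : u = v := by
  induction k with
  | zero => exact h
  | succ k ih =>
    obtain ⟨x, hx, hxv⟩ := h
    obtain rfl := hxv.resolve_right (hv _)
    exact ih hx

theorem Reach.lt (hL : ∀ p < m * w, L p < q) (h : Reach L w m k u v) (hu : u < q) : v < q := by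
  induction k generalizing v with
  | zero => exact h ▸ hu
  | succ k ih =>
    obtain ⟨x, hx, rfl | ⟨b, hb, i, -, j, hj, -, rfl⟩⟩ := h
    · exact ih hx
    · exact hL _ (mul_add_lt hb hj)

theorem Good.congr (h : ∀ p < m * w, L p = L' p) (hL : Good L w q s m) : Good L' w q s m where
  lt p hp := h p hp ▸ hL.lt p hp
  far b hb i j hij hj := by
    rw [← h _ (mul_add_lt hb hj), ← h _ (mul_add_lt hb (hij.trans hj)),
      ← Reach.congr fun p hp => h p (hp.trans_le (Nat.mul_le_mul_right _ hb.le))]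
    exact hL.far b hb i j hij hj

theorem Good.snoc (hL : Good L w q s m) (hlt : ∀ j < w, L (m * w + j) < q)
    (hfar : ∀ i j, i < j → j < w → ¬ Reach L w m s (L (m * w + i)) (L (m * w + j))) :
    Good L w q s (m + 1) where
  lt p hp := by
    rcases lt_or_ge p (m * w) with h | h
    · exact hL.lt p h
    · have := hlt (p - m * w) (by rw [add_mul, one_mul] at hp; omega)
      rwa [Nat.add_sub_cancel' h] at this
  far b hb := by
    rcases Nat.lt_succ_iff_lt_or_eq.1 hb with hb | rfl
    · exact hL.far b hb
    · exact hfar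

theorem Good.injOn (hL : Good L w q s m) {b i j : ℕ} (hb : b < m) (hi : i < w) (hj : j < w)
    (h : L (b * w + i) = L (b * w + j)) : i = j := by
  rcases lt_trichotomy i j with hij | rfl | hij
  · exact absurd (h ▸ Reach.refl s) (hL.far b hb i j hij hj)
  · rfl
  · exact absurd (h ▸ Reach.refl s) (hL.far b hb j i hij hi)

/-! ### Paths through few blocks are short -/

/-- `u` and `v` lie in a common block with number in `B`. -/
def AdjIn (L : ℕ → ℕ) (w : ℕ) (B : Finset ℕ) (u v : ℕ) : Prop :=
  ∃ b ∈ B, ∃ i < w, ∃ j < w, L (b * w + i) = u ∧ L (b * w + j) = v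

theorem AdjIn.symm {B : Finset ℕ} (h : AdjIn L w B u v) : AdjIn L w B v u := by
  obtain ⟨b, hb, i, hi, j, hj, h1, h2⟩ := h
  exact ⟨b, hb, j, hj, i, hi, h2, h1⟩

open Relation in
/-- The part of a path before it meets the block `b` for the first time. -/
theorem reflTransGen_erase {B : Finset ℕ} (b : ℕ) (h : ReflTransGen (AdjIn L w B) u v) :
    ReflTransGen (AdjIn L w (B.erase b)) u v ∨
      ∃ i < w, ReflTransGen (AdjIn L w (B.erase b)) u (L (b * w + i)) := by
  induction h with
  | refl => exact .inl .refl
  | tail _ hxy ih =>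
    rcases ih with ih | ih
    · obtain ⟨b', hb', i, hi, j, hj, rfl, rfl⟩ := hxy
      by_cases hbb : b' = b
      · exact .inr ⟨i, hi, hbb ▸ ih⟩
      · exact .inl (ih.tail ⟨b', mem_erase.2 ⟨hbb, hb'⟩, i, hi, j, hj, rfl, rfl⟩)
    · exact .inr ih

open Relation in
/-- A path within the blocks in `B` can be shortened so that it uses each of them at most once. -/
theorem Reach.of_reflTransGen {B : Finset ℕ} (hB : ∀ b ∈ B, b < m) (hk : #B ≤ k)
    (h : ReflTransGen (AdjIn L w B) u v) : Reach L w m k u v := by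
  induction k generalizing B v with
  | zero =>
    obtain rfl : B = ∅ := by simpa using hk
    cases h with
    | refl => exact Reach.refl 0
    | tail _ hxy => simp [AdjIn] at hxy
  | succ k ih =>
    cases h with
    | refl => exact Reach.refl _
    | tail hux hxv =>
      obtain ⟨b, hb, i, hi, j, hj, rfl, rfl⟩ := hxv
      have hB' : ∀ c ∈ B.erase b, c < m := fun c hc => hB c (mem_of_mem_erase hc)
      have hk' : #(B.erase b) ≤ k := by rw [card_erase_of_mem hb]; omega
      rcases reflTransGen_erase b hux with h | ⟨i', hi', h⟩
      · exact ⟨_, ih hB' hk' h, .inr ⟨b, hB b hb, i, hi, j, hj, rfl, rfl⟩⟩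
      · exact ⟨_, ih hB' hk' h, .inr ⟨b, hB b hb, i', hi', j, hj, rfl, rfl⟩⟩

/-! ### Counting points -/

/-- The number of places below `n` at which the point `v` occurs. -/
def deg (L : ℕ → ℕ) (n v : ℕ) : ℕ := #{p ∈ range n | L p = v}

theorem deg_congr {n : ℕ} (h : ∀ p < n, L p = L' p) : deg L n v = deg L' n v := by
  unfold deg
  congr 1
  refine filter_congr fun p hp => ?_
  rw [h p (mem_range.1 hp)]

theorem deg_succ (L : ℕ → ℕ) (n v : ℕ) :
    deg L (n + 1) v = deg L n v + if L n = v then 1 else 0 := by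
  unfold deg
  rw [range_add_one, filter_insert]
  split <;> simp

/-- A new block increases the degrees of its points by one and no others. -/
theorem deg_add_le {L : ℕ → ℕ} {n w : ℕ} (hinj : ∀ i j, i < j → j < w → L (n + i) ≠ L (n + j))
    (v : ℕ) : (deg L (n + w) v ≤ deg L n v + 1) ∧
      ((∀ j < w, L (n + j) ≠ v) → deg L (n + w) v = deg L n v) := by
  have key : ∀ i ≤ w, (deg L (n + i) v ≤ deg L n v + 1) ∧
      ((∀ j < i, L (n + j) ≠ v) → deg L (n + i) v = deg L n v) := by
    intro i hi
    induction i with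
    | zero => simp
    | succ i ih =>
      obtain ⟨h1, h2⟩ := ih (by omega)
      rw [← add_assoc, deg_succ]
      by_cases hv : L (n + i) = v
      · rw [if_pos hv, h2 fun j hj => hv ▸ hinj j i hj (by omega)]
        exact ⟨le_rfl, fun h => absurd hv (h i (by omega))⟩
      · rw [if_neg hv]
        exact ⟨h1, fun h => h2 fun j hj => h j (by omega)⟩
  exact key w le_rfl

/-- Balls in a block system of bounded degree. -/
theorem exists_finset_of_reach {D : ℕ} (hD : ∀ v, deg L (m * w) v ≤ D) (k u : ℕ) :
    ∃ T : Finset ℕ, #T ≤ (1 + D * w) ^ k ∧ ∀ v, Reach L w m k u v → v ∈ T := by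
  induction k with
  | zero => exact ⟨{u}, by simp, fun v h => by simp [show u = v from h]⟩
  | succ k ih =>
    obtain ⟨T, hT, h⟩ := ih
    let nb : ℕ → Finset ℕ := fun x => insert x
      (({p ∈ range (m * w) | L p = x} ×ˢ range w).image fun y => L (y.1 / w * w + y.2))
    refine ⟨T.biUnion nb, ?_, ?_⟩
    · refine (card_biUnion_le_card_mul _ _ (1 + D * w) fun x _ => ?_).trans ?_
      · refine (card_insert_le _ _).trans ?_
        rw [add_comm 1]
        refine Nat.add_le_add_right (card_image_le.trans ?_) 1
        rw [card_product, card_range]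
        exact Nat.mul_le_mul_right _ (hD x)
      · rw [pow_succ]
        exact Nat.mul_le_mul_right _ hT
    · rintro v ⟨x, hx, hxv⟩
      refine mem_biUnion.2 ⟨x, h x hx, ?_⟩
      rcases hxv with rfl | ⟨b, hb, i, hi, j, hj, rfl, rfl⟩
      · exact mem_insert_self _ _
      · refine mem_insert_of_mem (mem_image.2 ⟨(b * w + i, j), ?_, ?_⟩)
        · simp [mul_add_lt hb hi, hj]
        · have : (b * w + i) / w = b := by
            rw [mul_comm, Nat.mul_add_div (by omega), Nat.div_eq_of_lt hi, add_zero]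
          simp [this]

/-- If every point of degree below `D` is within `s` steps of one of `r` points, then there are
many blocks: all other points have degree `D`. -/
theorem mul_le_of_forall_reach {D r : ℕ} (hL : ∀ p < m * w, L p < q)
    (hD : ∀ v, deg L (m * w) v ≤ D) (S : ℕ → ℕ)
    (h : ∀ v < q, deg L (m * w) v < D → ∃ i < r, Reach L w m s (S i) v) :
    D * q ≤ m * w + D * (r * (1 + D * w) ^ s) := by
  choose T hT hTR using fun u => exists_finset_of_reach hD s u
  set U := (range r).biUnion fun i => T (S i) with hU
  have hUc : #U ≤ r * (1 + D * w) ^ s := by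
    simpa using card_biUnion_le_card_mul (range r) (fun i => T (S i)) _ fun i _ => hT (S i)
  have hsum : m * w = ∑ v ∈ range q, deg L (m * w) v := by
    have := card_eq_sum_card_fiberwise (s := range (m * w)) (t := range q) (f := L)
      (fun p hp => by simpa using hL p (by simpa using hp))
    simpa [deg] using this
  have h1 : ∑ v ∈ range q \ U, D ≤ m * w := by
    rw [hsum]
    refine (sum_le_sum fun v hv => ?_).trans (sum_le_sum_of_subset sdiff_subset)
    rw [mem_sdiff, mem_range] at hv
    by_contra! hlt
    obtain ⟨i, hi, hR⟩ := h v hv.1 hlt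
    exact hv.2 (mem_biUnion.2 ⟨i, mem_range.2 hi, hTR _ _ hR⟩)
  have h2 : q ≤ #(range q \ U) + #U := by
    have := le_card_sdiff U (range q)
    rw [card_range] at this
    omega
  rw [sum_const, smul_eq_mul] at h1
  calc D * q ≤ D * (#(range q \ U) + #U) := Nat.mul_le_mul_left _ h2
    _ = #(range q \ U) * D + D * #U := by ring
    _ ≤ _ := Nat.add_le_add h1 (Nat.mul_le_mul_left _ hUc)

/-! ### Greedy choice of a block -/

/-- The list `S` of `s` points has been extended greedily from the list `S₀` of `s₀` points, by
trying all points below `i`: its points are pairwise unrelated by `R`, have degree below `D`, and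
unless it is full, all points tried are of degree at least `D` or related to a point of the
list. -/
structure IsGreedy (R : ℕ → ℕ → Prop) (dg : ℕ → ℕ) (D q w : ℕ) (S₀ : ℕ → ℕ) (s₀ i : ℕ)
    (S : ℕ → ℕ) (s : ℕ) : Prop where
  le : s ≤ w
  le' : s₀ ≤ s
  eq : ∀ j < s₀, S j = S₀ j
  lt : ∀ j < s, S j < q
  deg_lt : ∀ j < s, dg (S j) < D
  far : ∀ j k, j < k → k < s → ¬ R (S j) (S k)
  stuck : s = w ∨ ∀ v < i, dg v < D → ∃ j < s, R (S j) v

namespace IsGreedy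

variable {R : ℕ → ℕ → Prop} {dg : ℕ → ℕ} {D q w : ℕ} {S₀ S : ℕ → ℕ} {s₀ i s : ℕ}

theorem skip (h : IsGreedy R dg D q w S₀ s₀ i S s)
    (hi : s = w ∨ D ≤ dg i ∨ ∃ j < s, R (S j) i) : IsGreedy R dg D q w S₀ s₀ (i + 1) S s where
  __ := h
  stuck := by
    rcases hi with hi | hi
    · exact .inl hi
    refine h.stuck.imp_right fun h v hv hvD => ?_
    rcases Nat.lt_succ_iff_lt_or_eq.1 hv with hv | rfl
    · exact h v hv hvD
    · exact hi.resolve_left (by omega)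

theorem push (h : IsGreedy R dg D q w S₀ s₀ i S s) (hR : ∀ v, R v v) (hs : s < w) (hi : i < q)
    (hd : dg i < D) (hf : ∀ j < s, ¬ R (S j) i) :
    IsGreedy R dg D q w S₀ s₀ (i + 1) (Function.update S s i) (s + 1) where
  le := hs
  le' := h.le'.trans (Nat.le_succ s)
  eq j hj := by rw [Function.update_of_ne (by have := h.le'; omega), h.eq j hj]
  lt j hj := by
    rcases Nat.lt_succ_iff_lt_or_eq.1 hj with hj | rfl
    · rw [Function.update_of_ne hj.ne]; exact h.lt j hj
    · rwa [Function.update_self]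
  deg_lt j hj := by
    rcases Nat.lt_succ_iff_lt_or_eq.1 hj with hj | rfl
    · rw [Function.update_of_ne hj.ne]; exact h.deg_lt j hj
    · rwa [Function.update_self]
  far j k hjk hk := by
    rcases Nat.lt_succ_iff_lt_or_eq.1 hk with hk | rfl
    · rw [Function.update_of_ne (by omega), Function.update_of_ne hk.ne]
      exact h.far j k hjk hk
    · rw [Function.update_of_ne (by omega), Function.update_self]
      exact hf j hjk
  stuck := by
    refine .inr fun v hv hvD => ?_
    rcases Nat.lt_succ_iff_lt_or_eq.1 hv with hv | rfl
    · obtain ⟨j, hj, hjv⟩ := h.stuck.resolve_left (by omega) v hv hvD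
      exact ⟨j, by omega, by rwa [Function.update_of_ne hj.ne]⟩
    · exact ⟨s, by omega, by rw [Function.update_self]; exact hR v⟩

end IsGreedy

end BlockSystem

namespace BlockSystem

open Finset

/-! ### Words of small weight -/

theorem sum_mul_eval_eq_zero {ι F : Type*} [Fintype ι] [Field F] {c α : ι → F} {n : ℕ}
    (h : ∀ s < n, ∑ x, c x * α x ^ s = 0) {p : Polynomial F} (hp : p.natDegree < n) :
    ∑ x, c x * p.eval (α x) = 0 := by
  simp_rw [Polynomial.eval_eq_sum_range' hp, mul_sum]
  rw [sum_comm]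
  refine sum_eq_zero fun s hs => ?_
  rw [← mul_zero (p.coeff s), ← h s (mem_range.1 hs), mul_sum]
  exact sum_congr rfl fun x _ => by ring

/-- A word whose support has at most `n` elements and which is orthogonal to the powers `α ^ s`,
`s < n`, has sum zero over each fibre of `α`. -/
theorem sum_fiber_eq_zero {ι F : Type*} [Fintype ι] [Field F] [DecidableEq F] (c α : ι → F)
    (n : ℕ) (h : ∀ s < n, ∑ x, c x * α x ^ s = 0) (hc : #{x | c x ≠ 0} ≤ n) (y : F) :
    ∑ x with α x = y, c x = 0 := by
  classical
  set T := ({x | c x ≠ 0} : Finset ι).image α with hT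
  by_cases hy : y ∈ T
  · set p : Polynomial F := ∏ z ∈ T.erase y, (Polynomial.X - Polynomial.C z) with hp
    have hdeg : p.natDegree < n := by
      rw [hp, Polynomial.natDegree_prod_of_monic _ _ fun z _ => Polynomial.monic_X_sub_C z]
      simp only [Polynomial.natDegree_X_sub_C, sum_const, smul_eq_mul, mul_one]
      exact (card_erase_lt_of_mem hy).trans_le (card_image_le.trans hc)
    have h0 := sum_mul_eval_eq_zero h hdeg
    have h1 : ∑ x, c x * p.eval (α x) = (∑ x with α x = y, c x) * p.eval y := by
      rw [sum_filter, sum_mul]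
      refine sum_congr rfl fun x _ => ?_
      by_cases hx : α x = y
      · simp [hx]
      · rw [if_neg hx, zero_mul]
        by_cases hcx : c x = 0
        · simp [hcx]
        · have hmem : α x ∈ T.erase y :=
            mem_erase.2 ⟨hx, mem_image_of_mem _ (by simpa using hcx)⟩
          rw [hp, Polynomial.eval_prod, prod_eq_zero hmem (by simp), mul_zero]
    have h2 : p.eval y ≠ 0 := by
      rw [hp, Polynomial.eval_prod, prod_ne_zero_iff]
      intro z hz
      simpa [sub_eq_zero] using (ne_of_mem_erase hz).symm
    rw [h1] at h0
    exact (mul_eq_zero.1 h0).resolve_right h2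
  · refine sum_eq_zero fun x hx => ?_
    by_contra hcx
    exact hy (mem_image.2 ⟨x, by simpa using hcx, by simpa using hx⟩)

/-- There is a nonzero word orthogonal to fewer powers than its length. -/
theorem exists_ne_zero_forall_sum {ι F : Type*} [Fintype ι] [Field F] (α : ι → F) (n : ℕ)
    (hn : n < Fintype.card ι) : ∃ c : ι → F, c ≠ 0 ∧ ∀ s < n, ∑ x, c x * α x ^ s = 0 := by
  let φ : (ι → F) →ₗ[F] (Fin n → F) :=
    LinearMap.pi fun s => ∑ x, α x ^ (s : ℕ) • LinearMap.proj x
  have : LinearMap.ker φ ≠ ⊥ := LinearMap.ker_ne_bot_of_finrank_lt (by simpa using hn)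
  obtain ⟨c, hc, hc0⟩ := (Submodule.ne_bot_iff _).1 this
  refine ⟨c, hc0, fun s hs => ?_⟩
  have := congrFun (LinearMap.mem_ker.1 hc) ⟨s, hs⟩
  simpa [φ, mul_comm] using this

/-- A word of weight at most `d - 1` satisfying the parity checks of a good block system is zero.
All its point sums vanish. Let `b` be its last block and `u` a point of `b` at which it does not
vanish. The sum over the points connected with `u` through the other blocks vanishes, both in
total and on each other block, hence on `b`. So a second point of `b` is connected with `u`
through at most `(d - 1) / 2 - 1` earlier blocks. -/
theorem eq_zero_of_card_support_le {F : Type*} [Field F] [DecidableEq F] {m w d q : ℕ}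
    {L : ℕ → ℕ} (hL : Good L w q ((d - 1) / 2 - 1) m) (a : Fin m × Fin w → F)
    (ha : ∀ x y, a x = a y ↔ L (x.1 * w + x.2) = L (y.1 * w + y.2))
    (c : Fin m × Fin w → F) (hblock : ∀ b, ∑ j, c (b, j) = 0)
    (hpow : ∀ s < d - 1, ∑ x, c x * a x ^ s = 0) (hc : #{x | c x ≠ 0} ≤ d - 1) : c = 0 := by
  classical
  have hf := sum_fiber_eq_zero c a _ hpow hc
  by_contra hne
  set B : Finset (Fin m) := {b | ∃ j, c (b, j) ≠ 0} with hB
  have hBne : B.Nonempty := by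
    obtain ⟨⟨b, j⟩, hx⟩ := Function.ne_iff.1 hne
    exact ⟨b, by simpa [hB] using ⟨j, hx⟩⟩
  have hBcard : 2 * #B ≤ #{x | c x ≠ 0} := by
    rw [mul_comm, card_eq_sum_card_fiberwise (s := {x | c x ≠ 0}) (t := B) (f := Prod.fst)]
    · rw [← smul_eq_mul]
      refine card_nsmul_le_sum _ _ _ fun b hb => ?_
      by_contra! hlt
      obtain ⟨j, hj⟩ : ∃ j, c (b, j) ≠ 0 := by simpa [hB] using hb
      have hle := card_le_one.1 (Nat.lt_succ_iff.1 hlt)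
      have := hblock b
      rw [Fintype.sum_eq_single j] at this
      · exact hj this
      · intro i hij
        by_contra hi
        exact hij (congrArg Prod.snd (hle (b, i) (by simpa using hi) (b, j) (by simpa using hj)))
    · rintro ⟨b, j⟩ hx
      simpa [hB] using ⟨j, by simpa using hx⟩
  set b := B.max' hBne with hb
  have hbB : b ∈ B := B.max'_mem hBne
  obtain ⟨j₀, hj₀⟩ : ∃ j, c (b, j) ≠ 0 := by simpa [hB] using hbB
  set B' : Finset ℕ := (B.erase b).image Fin.val with hB'
  have hB'lt : ∀ i : ℕ, i ∈ B' → i < b := by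
    intro i hi
    obtain ⟨j, hj, rfl⟩ := mem_image.1 hi
    exact Fin.lt_def.1 (lt_of_le_of_ne (B.le_max' j (mem_of_mem_erase hj)) (ne_of_mem_erase hj))
  have hB'card : #B' ≤ (d - 1) / 2 - 1 := by
    have h1 : #B' ≤ #B - 1 := card_image_le.trans (card_erase_of_mem hbB).le
    have h2 : 2 * #B ≤ d - 1 := hBcard.trans hc
    omega
  let K : ℕ → Prop := Relation.ReflTransGen (AdjIn L w B') (L (b * w + j₀))
  let k : Fin m × Fin w → F := fun x => if K (L (x.1 * w + x.2)) then c x else 0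
  have htotal : ∑ x, k x = 0 := by
    rw [← sum_fiberwise_of_maps_to (t := univ.image a) fun x _ => mem_image_of_mem a (mem_univ x)]
    refine sum_eq_zero fun y _ => ?_
    by_cases hy : ∃ x, a x = y ∧ K (L (x.1 * w + x.2))
    · obtain ⟨x, rfl, hx⟩ := hy
      rw [← hf (a x)]
      refine sum_congr rfl fun z hz => if_pos ?_
      rwa [(ha z x).1 (by simpa using hz)]
    · refine sum_eq_zero fun z hz => if_neg fun hK => hy ⟨z, by simpa using hz, hK⟩
  have hother : ∀ i, i ≠ b → ∑ j, k (i, j) = 0 := by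
    intro i hi
    by_cases hiB : i ∈ B
    · have hiB' : (i : ℕ) ∈ B' := mem_image_of_mem _ (mem_erase.2 ⟨hi, hiB⟩)
      by_cases hj : ∃ j : Fin w, K (L (i * w + j))
      · obtain ⟨j, hj⟩ := hj
        rw [← hblock i]
        refine sum_congr rfl fun j' _ => if_pos ?_
        exact hj.tail ⟨i, hiB', j, j.2, j', j'.2, rfl, rfl⟩
      · exact sum_eq_zero fun j' _ => if_neg fun hK => hj ⟨j', hK⟩
    · refine sum_eq_zero fun j _ => ?_
      have : c (i, j) = 0 := by
        by_contra h
        exact hiB (by simpa [hB] using ⟨j, h⟩)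
      simp [k, this]
  have hlast : ∑ j, k (b, j) = 0 := by
    rw [Fintype.sum_prod_type, Fintype.sum_eq_single b hother] at htotal
    exact htotal
  obtain ⟨j₁, hj₁, hK⟩ : ∃ j₁, j₁ ≠ j₀ ∧ K (L (b * w + j₁)) := by
    by_contra! h
    rw [Fintype.sum_eq_single j₀ fun j hj => if_neg (h j hj)] at hlast
    exact hj₀ (by simpa [k, K, Relation.ReflTransGen.refl] using hlast)
  have hsymm : Relation.ReflTransGen (AdjIn L w B') (L (b * w + j₁)) (L (b * w + j₀)) :=
    have : Std.Symm (AdjIn L w B') := ⟨fun _ _ h => h.symm⟩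
    Relation.ReflTransGen.stdSymm.symm _ _ hK
  rcases lt_or_gt_of_ne (Fin.val_ne_of_ne hj₁) with h | h
  · exact hL.far b b.2 _ _ h j₀.2 (Reach.of_reflTransGen hB'lt hB'card hsymm)
  · exact hL.far b b.2 _ _ h j₁.2 (Reach.of_reflTransGen hB'lt hB'card hK)

/-! ### The code of a good block system -/

section Code

variable {F : Type*} [Field F] {m r d : ℕ}

/-- The columns of the parity-check matrix, indexed by blocks and places. -/
theorem mulVec_vandermondeTypeMatrix_eq_zero (hd : 2 ≤ d) (a : Fin m → Fin (r + 1) → F)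
    (c : Fin (m * (r + 1)) → F) :
    (vandermondeTypeMatrix d a).mulVec c = 0 ↔
      (∀ b, ∑ j, c (finProdFinEquiv (b, j)) = 0) ∧
      ∀ s < d - 1, ∑ x, c (finProdFinEquiv x) * a x.1 x.2 ^ s = 0 := by
  have hsum : ∀ i, (vandermondeTypeMatrix d a).mulVec c i =
      ∑ x, vandermondeTypeMatrix d a i (finProdFinEquiv x) * c (finProdFinEquiv x) := fun i =>
    (Equiv.sum_comp finProdFinEquiv
      (fun j => vandermondeTypeMatrix d a i j * c j)).symm
  have hdiv : ∀ x : Fin m × Fin (r + 1), (finProdFinEquiv x).divNat = x.1 := fun x =>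
    congrArg Prod.fst (finProdFinEquiv.symm_apply_apply x)
  have hmod : ∀ x : Fin m × Fin (r + 1), (finProdFinEquiv x).modNat = x.2 := fun x =>
    congrArg Prod.snd (finProdFinEquiv.symm_apply_apply x)
  have h1 : ∀ b : Fin m, (vandermondeTypeMatrix d a).mulVec c (Fin.castAdd (d - 2) b) =
      ∑ j, c (finProdFinEquiv (b, j)) := by
    intro b
    rw [hsum, Fintype.sum_prod_type, Fintype.sum_eq_single b]
    · simp [vandermondeTypeMatrix, hdiv]
    · intro b' hb'
      simp [vandermondeTypeMatrix, hdiv, hb']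
  have h2 : ∀ s : Fin (d - 2), (vandermondeTypeMatrix d a).mulVec c (Fin.natAdd m s) =
      ∑ x, c (finProdFinEquiv x) * a x.1 x.2 ^ ((s : ℕ) + 1) := by
    intro s
    rw [hsum]
    refine sum_congr rfl fun x _ => ?_
    simp [vandermondeTypeMatrix, hdiv, hmod, mul_comm]
  constructor
  · intro h
    have hb : ∀ b, ∑ j, c (finProdFinEquiv (b, j)) = 0 := fun b => by rw [← h1, h]; rfl
    refine ⟨hb, fun s hs => ?_⟩
    cases s with
    | zero => simp [Fintype.sum_prod_type, hb]
    | succ s => rw [← h2 ⟨s, by omega⟩, h]; rfl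
  · rintro ⟨hb, hp⟩
    ext i
    refine Fin.addCases (fun b => ?_) (fun s => ?_) i
    · rw [h1, hb]; rfl
    · rw [h2, hp _ (by omega)]; rfl

/-- The rows of the parity-check matrix are independent: a dependency is, on each block, a
polynomial of degree at most `d - 2` with `r + 1` roots. -/
theorem linearIndependent_vandermondeTypeMatrix (hm : 0 < m) (hdr : d - 2 ≤ r)
    (a : Fin m → Fin (r + 1) → F) (ha : ∀ b, Function.Injective (a b)) :
    LinearIndependent F (fun i => vandermondeTypeMatrix d a i) := by
  classical
  rw [Fintype.linearIndependent_iff]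
  intro g hg
  let p : Fin m → Polynomial F := fun b => Polynomial.C (g (Fin.castAdd _ b)) +
    ∑ s : Fin (d - 2), Polynomial.C (g (Fin.natAdd m s)) * Polynomial.X ^ ((s : ℕ) + 1)
  have hp : ∀ b, p b = 0 := by
    intro b
    have hdeg : (p b).natDegree ≤ d - 2 := by
      refine Polynomial.natDegree_add_le_of_degree_le (by simp)
        (Polynomial.natDegree_sum_le_of_forall_le _ _ fun s _ => ?_)
      exact (Polynomial.natDegree_C_mul_X_pow_le _ _).trans (by omega)
    refine Polynomial.eq_zero_of_natDegree_lt_card_of_eval_eq_zero (p b) (ha b) (fun j => ?_)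
      (by rw [Fintype.card_fin]; omega)
    have := congrFun hg (finProdFinEquiv (b, j))
    have hdiv : (finProdFinEquiv (b, j)).divNat = b :=
      congrArg Prod.fst (finProdFinEquiv.symm_apply_apply (b, j))
    have hmod : (finProdFinEquiv (b, j)).modNat = j :=
      congrArg Prod.snd (finProdFinEquiv.symm_apply_apply (b, j))
    simpa [p, Fin.sum_univ_add, vandermondeTypeMatrix, hdiv, hmod, Polynomial.eval_finsetSum]
      using this
  intro i
  refine Fin.addCases (fun b => ?_) (fun s => ?_) i
  · have := congrArg (Polynomial.coeff · 0) (hp b)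
    simpa [p, Polynomial.finsetSum_coeff] using this
  · have := congrArg (Polynomial.coeff · ((s : ℕ) + 1)) (hp ⟨0, hm⟩)
    simp only [p, Polynomial.coeff_add, Polynomial.coeff_C_succ, Polynomial.finsetSum_coeff,
      Polynomial.coeff_C_mul, Polynomial.coeff_X_pow, Polynomial.coeff_zero, zero_add] at this
    rw [Fintype.sum_eq_single s] at this
    · simpa using this
    · intro s' hs'
      rw [if_neg (by simpa [Fin.val_inj] using hs'.symm), mul_zero]

/-- A nonzero word of weight at most `d` in the code: it is supported on the points `φ i`. -/
theorem exists_mem_ker_of_injective [DecidableEq F] (hd : 2 ≤ d) (a : Fin m → Fin (r + 1) → F)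
    {ι : Type*} [Fintype ι] (hι : Fintype.card ι = d) (φ : ι → Fin m × Fin (r + 1))
    (hφ : Function.Injective φ)
    (hblock : ∀ c : ι → F, (∀ s < d - 1, ∑ i, c i * a (φ i).1 (φ i).2 ^ s = 0) →
      ∀ b, ∑ i with (φ i).1 = b, c i = 0) :
    ∃ c : Fin (m * (r + 1)) → F, c ≠ 0 ∧ (vandermondeTypeMatrix d a).mulVec c = 0 ∧
      hammingNorm c ≤ d := by
  classical
  obtain ⟨c, hc0, hc⟩ := exists_ne_zero_forall_sum (fun i => a (φ i).1 (φ i).2) (d - 1)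
    (by omega)
  have hsum : ∀ f : Fin m × Fin (r + 1) → F,
      ∑ x, Function.extend φ c 0 x * f x = ∑ i, c i * f (φ i) := by
    intro f
    rw [← sum_subset (subset_univ (univ.image φ)), sum_image hφ.injOn]
    · exact sum_congr rfl fun i _ => by rw [hφ.extend_apply]
    · intro x _ hx
      rw [Function.extend_apply', Pi.zero_apply, zero_mul]
      rintro ⟨i, rfl⟩
      exact hx (mem_image_of_mem _ (mem_univ i))
  refine ⟨fun j => Function.extend φ c 0 (finProdFinEquiv.symm j), ?_, ?_, ?_⟩
  · intro h
    refine hc0 (funext fun i => ?_)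
    have := congrFun h (finProdFinEquiv (φ i))
    simpa [hφ.extend_apply] using this
  · rw [mulVec_vandermondeTypeMatrix_eq_zero hd]
    simp only [Equiv.symm_apply_apply]
    refine ⟨fun b => ?_, fun s hs => ?_⟩
    · have h1 := hsum fun x => if x.1 = b then 1 else 0
      rw [Fintype.sum_prod_type, Fintype.sum_eq_single b] at h1
      · rw [← hblock c hc b, sum_filter]
        simpa using h1
      · intro b' hb'
        simp [hb']
    · rw [hsum fun x => a x.1 x.2 ^ s]
      exact hc s hs
  · rw [hammingNorm, ← hι, ← card_univ]
    refine card_le_card_of_surjOn (fun i => finProdFinEquiv (φ i)) ?_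
    intro j hj
    by_contra hne
    have hj : Function.extend φ c 0 (finProdFinEquiv.symm j) ≠ 0 := by simpa using hj
    refine hj (Function.extend_apply' _ _ _ ?_)
    rintro ⟨i, hi⟩
    exact hne ⟨i, by simp, (Equiv.eq_symm_apply _).1 hi⟩

/-- If `d ≤ r + 1` there is a codeword of weight at most `d` on a single block. -/
theorem exists_mem_ker_of_lt [DecidableEq F] (hd : 2 ≤ d) (hm : 0 < m) (hdr : d ≤ r + 1)
    (a : Fin m → Fin (r + 1) → F) :
    ∃ c : Fin (m * (r + 1)) → F, c ≠ 0 ∧ (vandermondeTypeMatrix d a).mulVec c = 0 ∧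
      hammingNorm c ≤ d := by
  refine exists_mem_ker_of_injective hd a (Fintype.card_fin d)
    (fun i => (⟨0, hm⟩, Fin.castLE hdr i)) (fun i j h => ?_) fun c hc b => ?_
  · simpa using h
  · by_cases hb : ⟨0, hm⟩ = b
    · simpa [hb] using hc 0 (by omega)
    · simp [hb]

/-- If `r = d - 2`, a codeword of weight at most `d` is supported on `r` points of the first block
and two points of the second one at which the polynomial vanishing on the `r` points takes the
same nonzero value. -/
theorem exists_mem_ker_of_prod_eq [DecidableEq F] (hm : 1 < m) (hdr : d = r + 2)
    (hr : 0 < r) (a : Fin m → Fin (r + 1) → F)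
    (heq : ∏ i : Fin r, (a ⟨1, hm⟩ 0 - a ⟨0, by omega⟩ i.castSucc) =
      ∏ i : Fin r, (a ⟨1, hm⟩ 1 - a ⟨0, by omega⟩ i.castSucc))
    (hne : ∏ i : Fin r, (a ⟨1, hm⟩ 0 - a ⟨0, by omega⟩ i.castSucc) ≠ 0) :
    ∃ c : Fin (m * (r + 1)) → F, c ≠ 0 ∧ (vandermondeTypeMatrix d a).mulVec c = 0 ∧
      hammingNorm c ≤ d := by
  have h01 : (0 : Fin (r + 1)) ≠ 1 := by
    obtain ⟨r, rfl⟩ := Nat.exists_eq_succ_of_ne_zero hr.ne'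
    simp
  refine exists_mem_ker_of_injective (by omega) a (ι := Fin r ⊕ Bool)
    (by simp [hdr]) (Sum.elim (fun i => (⟨0, by omega⟩, i.castSucc))
      (fun i => (⟨1, hm⟩, if i then 1 else 0))) ?_ fun c hc b => ?_
  · rintro (i | i) (j | j) h
    · simpa using h
    · simp at h
    · simp at h
    · cases i <;> cases j <;> simp_all
  · set p : Polynomial F :=
      ∏ i : Fin r, (Polynomial.X - Polynomial.C (a ⟨0, by omega⟩ i.castSucc)) with hp
    have hdeg : p.natDegree < d - 1 := by
      rw [hp, Polynomial.natDegree_prod_of_monic _ _ fun z _ => Polynomial.monic_X_sub_C _]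
      simp only [Polynomial.natDegree_X_sub_C, sum_const, smul_eq_mul, mul_one, card_univ,
        Fintype.card_fin]
      omega
    have hev : ∀ x, p.eval x = ∏ i : Fin r, (x - a ⟨0, by omega⟩ i.castSucc) := fun x => by
      simp [hp, Polynomial.eval_prod]
    have h0 := hc 0 (by omega)
    have h1 := sum_mul_eval_eq_zero hc hdeg
    have h2 : ∀ i : Fin r, p.eval (a ⟨0, by omega⟩ i.castSucc) = 0 := fun i => by
      rw [hev]
      exact prod_eq_zero (mem_univ i) (sub_self _)
    simp only [Fintype.sum_sum_type, Sum.elim_inl, Sum.elim_inr, h2, mul_zero, sum_const_zero,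
      zero_add, Fintype.sum_bool, if_true, Bool.false_eq_true, if_false] at h1
    rw [hev, hev, ← heq, ← add_mul] at h1
    have h3 : c (.inr true) + c (.inr false) = 0 := (mul_eq_zero.1 h1).resolve_right hne
    have h4 : ∑ i : Fin r, c (.inl i) = 0 := by
      simpa [Fintype.sum_sum_type, h3] using h0
    rw [sum_filter, Fintype.sum_sum_type]
    simp only [Sum.elim_inl, Sum.elim_inr, Fintype.sum_bool]
    by_cases hb0 : (⟨0, by omega⟩ : Fin m) = b <;> by_cases hb1 : (⟨1, hm⟩ : Fin m) = b <;>
      simp [hb0, hb1, h3, h4]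

/-- The Singleton-type bound for dimension `k = m r - (d - 2)`: here `⌈k / r⌉` is `m - 1` if
`d - 2 = r`, and `m` otherwise. -/
theorem eq_sub_ceil_div_add_of_add_eq {m r k : ℕ} (hd : 3 ≤ d) (hdr : d - 2 ≤ r)
    (hk : k + (d - 2) = m * r) :
    (d : ℤ) = ((m * (r + 1) : ℕ) : ℤ) - k - ⌈(k : ℚ) / r⌉ +
      (if (d : ℤ) - 2 ≡ r [ZMOD (r + 1)] then 1 else 2) := by
  have hr : (0 : ℚ) < r := by exact_mod_cast (by omega : 0 < r)
  have hkq : (k : ℚ) = m * r - (d - 2) := by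
    have : (k : ℚ) + ((d - 2 : ℕ) : ℚ) = m * r := by exact_mod_cast hk
    rw [Nat.cast_sub (by omega)] at this
    push_cast at this
    linarith
  have hkz : (k : ℤ) = m * r - (d - 2) := by exact_mod_cast hkq
  have hd3 : (3 : ℚ) ≤ d := by exact_mod_cast hd
  have hmod : (d : ℤ) - 2 ≡ r [ZMOD (r + 1)] ↔ d = r + 2 := by
    rw [Int.ModEq, Int.emod_eq_of_lt (by omega) (by omega), Int.emod_eq_of_lt (by omega) (by omega)]
    omega
  by_cases h : d = r + 2
  · have : ⌈(k : ℚ) / r⌉ = m - 1 := by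
      have h1 : (k : ℚ) / r = ((m - 1 : ℤ) : ℚ) := by
        rw [hkq, h]
        field_simp
        push_cast
        ring
      rw [h1, Int.ceil_intCast]
    rw [if_pos (hmod.2 h), this, hkz, h]
    push_cast
    ring
  · have : ⌈(k : ℚ) / r⌉ = m := by
      have hlt : ((d : ℚ)) < r + 2 := by exact_mod_cast (by omega : d < r + 2)
      rw [Int.ceil_eq_iff]
      push_cast
      rw [lt_div_iff₀ hr, div_le_iff₀ hr, hkq]
      constructor <;> linarith
    rw [if_neg (mt hmod.1 h), this, hkz]
    push_cast
    ring

/-- A good block system whose second block starts with two points of equal nonzero value under the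
polynomial vanishing on the first `r` points gives an optimal code. -/
theorem givesLongOptimalLRC [Fintype F] [DecidableEq F] {q : ℕ} (e : F ≃ Fin q) (hd : 5 ≤ d)
    (hdr : d - 2 ≤ r) (hm : 2 ≤ m) {L : ℕ → ℕ} (hL : Good L (r + 1) q ((d - 1) / 2 - 1) m)
    (heq : ∏ i ∈ range r, (RAM.elt e (L (r + 1)) - RAM.elt e (L i)) =
      ∏ i ∈ range r, (RAM.elt e (L (r + 2)) - RAM.elt e (L i)))
    (hne : ∏ i ∈ range r, (RAM.elt e (L (r + 1)) - RAM.elt e (L i)) ≠ 0)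
    (hlen : lengthBound (Fintype.card F) d r ≤ ((m * (r + 1) : ℕ) : ℝ)) :
    GivesLongOptimalLRC d
      (fun (b : Fin m) (j : Fin (r + 1)) => RAM.elt e (L (b * (r + 1) + j))) := by
  set a : Fin m → Fin (r + 1) → F := fun b j => RAM.elt e (L (b * (r + 1) + j)) with ha
  have haL : ∀ x y : Fin m × Fin (r + 1), a x.1 x.2 = a y.1 y.2 ↔
      L (x.1 * (r + 1) + x.2) = L (y.1 * (r + 1) + y.2) := by
    intro x y
    simp only [ha, RAM.elt, hL.lt _ (mul_add_lt x.1.2 x.2.2), hL.lt _ (mul_add_lt y.1.2 y.2.2),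
      dif_pos, e.symm.injective.eq_iff, Fin.mk.injEq]
  have hinj : ∀ b, Function.Injective (a b) := fun b i j h =>
    Fin.ext (hL.injOn b.2 i.2 j.2 ((haL (b, i) (b, j)).1 h))
  have hle : m + (d - 2) ≤ m * (r + 1) := by nlinarith
  set H := vandermondeTypeMatrix d a with hH
  have hli : LinearIndependent F (fun i => H i) :=
    linearIndependent_vandermondeTypeMatrix (by omega) hdr a hinj
  set C := LinearMap.ker H.mulVecLin with hC
  have hmem : ∀ c, c ∈ C ↔ H.mulVec c = 0 := fun c => by simp [hC]
  have hfin : Module.finrank F C = m * (r + 1) - (m + (d - 2)) := by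
    have h1 := LinearMap.finrank_range_add_finrank_ker H.mulVecLin
    have h2 : H.rank = m + (d - 2) := by
      rw [LinearIndependent.rank_matrix (M := H) hli, Fintype.card_fin]
    rw [Matrix.rank] at h2
    rw [h2, Module.finrank_fin_fun, ← hC] at h1
    omega
  have hzero : ∀ c ∈ C, hammingNorm c ≤ d - 1 → c = 0 := by
    intro c hc hcd
    rw [hmem, mulVec_vandermondeTypeMatrix_eq_zero (by omega)] at hc
    have := eq_zero_of_card_support_le (d := d) hL (fun x => a x.1 x.2) haL
      (fun x => c (finProdFinEquiv x)) hc.1 hc.2 (by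
        refine le_trans ?_ hcd
        refine card_le_card_of_injOn finProdFinEquiv (fun x hx => by simpa using hx)
          finProdFinEquiv.injective.injOn)
    funext j
    obtain ⟨x, rfl⟩ := finProdFinEquiv.surjective j
    exact congrFun this x
  obtain ⟨c, hc0, hcC, hcd⟩ : ∃ c : Fin (m * (r + 1)) → F, c ≠ 0 ∧ H.mulVec c = 0 ∧
      hammingNorm c ≤ d := by
    rcases Nat.lt_or_ge (r + 1) d with h | h
    · refine exists_mem_ker_of_prod_eq (by omega) (by omega) (by omega) a ?_ ?_
      · simpa [ha, ← Fin.prod_univ_eq_prod_range, Nat.mod_eq_of_lt (by omega : 1 < r + 1)] using heq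
      · simpa [ha, ← Fin.prod_univ_eq_prod_range] using hne
    · exact exists_mem_ker_of_lt (by omega) (by omega) h a
  refine ⟨hinj, hlen, m * (r + 1) - (m + (d - 2)), C, ⟨hfin, ⟨?_, ?_⟩, ?_, ?_⟩, hli, hmem⟩
  · refine ⟨c, (hmem c).2 hcC, 0, C.zero_mem, hc0, ?_⟩
    rw [hammingDist_zero_right]
    refine le_antisymm hcd ?_
    by_contra! hlt
    exact hc0 (hzero c ((hmem c).2 hcC) (by omega))
  · rintro _ ⟨u, hu, v, hv, huv, rfl⟩
    rw [hammingDist_eq_hammingNorm]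
    by_contra! hlt
    exact huv (neg_add_eq_zero.1 (hzero _ (C.add_mem (C.neg_mem hu) hv) (by omega)))
  · intro i
    obtain ⟨⟨b, j⟩, rfl⟩ := finProdFinEquiv.surjective i
    have hφ : Function.Injective fun j' : Fin (r + 1) => finProdFinEquiv (b, j') :=
      fun x y h => by simpa using h
    refine ⟨(univ.erase j).image fun j' => finProdFinEquiv (b, j'), ?_, ?_, fun u hu v hv =>
      ⟨fun h k hk => h k (mem_insert_of_mem hk), fun h k hk => ?_⟩⟩
    · rw [mem_image]
      rintro ⟨j', hj', h⟩
      exact ne_of_mem_erase hj' (hφ h)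
    · rw [card_image_of_injective _ hφ, card_erase_of_mem (mem_univ j), card_univ,
        Fintype.card_fin, Nat.add_sub_cancel]
    · rcases mem_insert.1 hk with rfl | hk
      · have h1 := ((mulVec_vandermondeTypeMatrix_eq_zero (by omega) a _).1
          ((hmem _).1 (C.sub_mem hu hv))).1 b
        rw [Fintype.sum_eq_single j] at h1
        · exact sub_eq_zero.1 h1
        · intro j' hj'
          exact sub_eq_zero.2 (h _ (mem_image_of_mem _ (mem_erase.2 ⟨hj', mem_univ _⟩)))
      · exact h k hk
  · refine eq_sub_ceil_div_add_of_add_eq (by omega) hdr ?_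
    have : m * (r + 1) = m * r + m := by ring
    omega

end Code

/-! ### Two points with the same value of a polynomial -/

/-- A completely split polynomial of degree `r ≥ 2` takes some nonzero value twice, provided the
field is large. Otherwise exactly `r - 1` nonzero elements are not values; since the power sums
over all values vanish, so do the first `r - 1` power sums over these elements. -/
theorem exists_ne_prod_sub_eq {F : Type*} [Field F] [Fintype F] [DecidableEq F] (B : Finset F)
    (hB : 2 ≤ #B) (hq : #B * #B < Fintype.card F) :
    ∃ x y, x ≠ y ∧ ∏ b ∈ B, (x - b) = ∏ b ∈ B, (y - b) ∧ ∏ b ∈ B, (x - b) ≠ 0 := by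
  set p : Polynomial F := ∏ b ∈ B, (Polynomial.X - Polynomial.C b) with hp
  have hev : ∀ x, p.eval x = ∏ b ∈ B, (x - b) := fun x => by simp [hp, Polynomial.eval_prod]
  have hdeg : p.natDegree = #B := by
    rw [hp, Polynomial.natDegree_prod_of_monic _ _ fun z _ => Polynomial.monic_X_sub_C _]
    simp
  have hzero : ∀ x, p.eval x = 0 ↔ x ∈ B := fun x => by
    rw [hev, prod_eq_zero_iff]
    simp [sub_eq_zero]
  simp_rw [← hev]
  by_contra! hcon
  have hinj : Set.InjOn (fun x => p.eval x) (univ \ B : Finset F) := by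
    intro x hx y _ hxy
    by_contra hne
    have hx' : x ∉ B := by simpa using hx
    exact hx' ((hzero x).1 (hcon x y hne hxy))
  set I := (univ \ B).image fun x => p.eval x with hI
  set Z := univ.erase (0 : F) \ I with hZ
  have hI0 : I ⊆ univ.erase 0 := by
    intro y hy
    obtain ⟨x, hx, rfl⟩ := mem_image.1 hy
    have hx' : x ∉ B := by simpa using hx
    simpa [hzero] using hx'
  have hBq : #B ≤ Fintype.card F := card_le_univ B
  have hZcard : #Z = #B - 1 := by
    rw [hZ, card_sdiff_of_subset hI0, card_erase_of_mem (mem_univ _), hI,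
      card_image_of_injOn hinj, card_sdiff_of_subset (subset_univ B), card_univ]
    omega
  have hpow : ∀ j, 0 < j → j < #B → ∑ z ∈ Z, z ^ j = 0 := by
    intro j hj0 hjB
    have hlt : #B * j < Fintype.card F - 1 := by
      have : #B * j + #B ≤ #B * #B := by nlinarith
      omega
    have h1 : ∑ x, p.eval x ^ j = 0 := by
      have hd' : (p ^ j).natDegree < #B * j + 1 := by
        rw [Polynomial.natDegree_pow, hdeg, mul_comm]
        omega
      simp_rw [← Polynomial.eval_pow, Polynomial.eval_eq_sum_range' hd']
      rw [sum_comm]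
      refine sum_eq_zero fun s hs => ?_
      rw [← mul_sum, FiniteField.sum_pow_lt_card_sub_one F s (by rw [mem_range] at hs; omega),
        mul_zero]
    have h2 : ∑ y ∈ I, y ^ j = 0 := by
      rw [hI, sum_image hinj, ← h1]
      refine sum_subset (subset_univ _) fun x _ hx => ?_
      have hx' : x ∈ B := by simpa using hx
      rw [(hzero x).2 hx', zero_pow hj0.ne']
    have h3 : ∑ y ∈ univ.erase (0 : F), y ^ j = 0 := by
      rw [sum_erase _ (zero_pow hj0.ne')]
      exact FiniteField.sum_pow_lt_card_sub_one F j (by nlinarith)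
    have h4 := sum_sdiff (f := fun y => y ^ j) hI0
    rwa [h2, h3, add_zero] at h4
  obtain ⟨z, hz⟩ : Z.Nonempty := card_pos.1 (by omega)
  have := sum_fiber_eq_zero (fun z : Z => (z : F)) (fun z : Z => (z : F)) (#B - 1)
    (fun s hs => by
      simp_rw [← pow_succ']
      rw [sum_coe_sort Z fun z => z ^ (s + 1)]
      exact hpow _ (by omega) (by omega))
    ((card_le_univ _).trans (by rw [Fintype.card_coe, hZcard])) z
  rw [sum_filter, Fintype.sum_eq_single ⟨z, hz⟩ fun x hx =>
    if_neg fun h => hx (Subtype.ext h)] at this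
  have hz0 : z ≠ 0 := ne_of_mem_erase (mem_sdiff.1 hz).1
  exact hz0 (by simpa using this)

/-! ### The length -/

theorem lengthBound_eq (q d r : ℕ) (hq : 0 < q) (x : ℝ)
    (hx : x = 1 / ((((d - 1) / 2 : ℕ) : ℝ) - 1)) :
    lengthBound q d r = (q : ℝ) * (q : ℝ) ^ x /
      (2 * (((d - 1) / 2 : ℕ) : ℝ) ^ 2 * (((r : ℝ) + 1) * ((r : ℝ) + 1) ^ (2 * x))) := by
  have hq' : (0 : ℝ) < q := by exact_mod_cast hq
  have hr : (0 : ℝ) < (r : ℝ) + 1 := by positivity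
  have h2 : 2 / ((((d - 1) / 2 : ℕ) : ℝ) - 1) = 2 * x := by rw [hx]; ring
  simp only [lengthBound]
  rw [h2, ← hx, Real.rpow_add hq', Real.rpow_add hr, Real.rpow_one, Real.rpow_one]

/-- The length of a block system in which no further block of degree at most `D` can be added, for
a suitable `D`, is at least the required bound. -/
theorem exists_degree (d r q : ℕ) (hd : 5 ≤ d)
    (hq : 2 * (r + 1) * (4 * (r + 1)) ^ ((d - 1) / 2 - 1) ≤ q) :
    ∃ D : ℕ, 2 ≤ D ∧ D ≤ q ∧ ∀ n : ℕ,
      D * q ≤ n + D * (r * (1 + D * (r + 1)) ^ ((d - 1) / 2 - 1)) →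
      lengthBound q d r ≤ n := by
  set t := (d - 1) / 2 with ht
  obtain ⟨u, hu⟩ : ∃ u, t = u + 2 := ⟨t - 2, by omega⟩
  have htu : t - 1 = u + 1 := by omega
  rw [htu] at hq ⊢
  set w : ℝ := (r : ℝ) + 1 with hw
  have hw1 : 1 ≤ w := by simp [hw]
  have hq' : 2 * w * (4 * w) ^ (u + 1) ≤ q := by rw [hw]; exact_mod_cast hq
  have hq0 : (0 : ℝ) < q := lt_of_lt_of_le (by positivity) hq'
  set x : ℝ := 1 / ((t : ℝ) - 1) with hx
  have hx' : x = ((u + 1 : ℕ) : ℝ)⁻¹ := by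
    rw [hx, hu]; push_cast; rw [one_div]; congr 1; ring
  set Y : ℝ := ((q : ℝ) / (2 * w)) ^ x with hY
  have hYpow : Y ^ (u + 1) = (q : ℝ) / (2 * w) := by
    rw [hY, hx']
    exact Real.rpow_inv_natCast_pow (by positivity) (by omega)
  have hY0 : 0 ≤ Y := by positivity
  have hY4 : 4 * w ≤ Y := by
    refine le_of_pow_le_pow_left₀ (n := u + 1) (by omega) hY0 ?_
    rw [hYpow, le_div_iff₀ (by positivity)]
    linarith
  have hYq : Y ≤ q := by
    have h1 : Y ≤ Y ^ (u + 1) := le_self_pow₀ (by linarith) (by omega)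
    rw [hYpow] at h1
    exact h1.trans (div_le_self hq0.le (by linarith))
  have hYw : 4 ≤ Y / w := by rwa [le_div_iff₀ (by linarith)]
  have hfl : 4 ≤ ⌊Y / w⌋₊ := Nat.le_floor (by exact_mod_cast hYw)
  -- This choice gives `1 + D w ≤ Y`, so that the balls of the counting argument cover at most half
  -- of the field.
  set D := ⌊Y / w⌋₊ - 1 with hD
  have hD1 : (D : ℝ) + 1 ≤ Y / w := by
    have h1 : D + 1 = ⌊Y / w⌋₊ := by omega
    have h2 : ((D + 1 : ℕ) : ℝ) ≤ Y / w := h1 ▸ Nat.floor_le (by positivity)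
    exact_mod_cast h2
  have hD2 : Y / w < D + 2 := by
    have h1 : D + 2 = ⌊Y / w⌋₊ + 1 := by omega
    have h2 : Y / w < ((D + 2 : ℕ) : ℝ) := by rw [h1]; exact_mod_cast Nat.lt_floor_add_one _
    exact_mod_cast h2
  have hDY : (D : ℝ) ≤ Y := by
    have : Y / w ≤ Y := div_le_self hY0 hw1
    linarith
  refine ⟨D, by omega, by exact_mod_cast hDY.trans hYq, fun n hn => ?_⟩
  have hn' : (D : ℝ) * q ≤ n + D * (r * (1 + D * w) ^ (u + 1)) := by
    rw [hw]; exact_mod_cast hn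
  have hball : (r : ℝ) * (1 + D * w) ^ (u + 1) ≤ q / 2 := by
    have h1 : 1 + D * w ≤ Y := by
      have := (le_div_iff₀ (by linarith)).1 hD1
      nlinarith
    calc (r : ℝ) * (1 + D * w) ^ (u + 1) ≤ w * Y ^ (u + 1) := by
          gcongr
          linarith
      _ = q / 2 := by rw [hYpow]; field_simp
  have hn2 : (D : ℝ) * q / 2 ≤ n := by
    have : (D : ℝ) * (r * (1 + D * w) ^ (u + 1)) ≤ D * (q / 2) := by gcongr
    linarith
  refine le_trans ?_ hn2
  rw [lengthBound_eq q d r (by exact_mod_cast hq0) x hx, ← hw, ← ht]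
  have hx0 : 0 < x := by rw [hx']; positivity
  have hx1 : x ≤ 1 := by
    rw [hx']
    exact inv_le_one_of_one_le₀ (by push_cast; linarith [Nat.cast_nonneg (α := ℝ) u])
  have ht2 : (2 : ℝ) ≤ t := by rw [hu]; push_cast; linarith [Nat.cast_nonneg (α := ℝ) u]
  have h2x : (2 : ℝ) ^ x ≤ 2 := by
    simpa using Real.rpow_le_rpow_of_exponent_le (by norm_num : (1 : ℝ) ≤ 2) hx1
  have hwx : w ^ x ≤ w ^ (2 * x) := Real.rpow_le_rpow_of_exponent_le hw1 (by linarith)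
  have hYe : Y * (2 ^ x * w ^ x) = (q : ℝ) ^ x := by
    rw [hY, Real.div_rpow hq0.le (by positivity), Real.mul_rpow (by norm_num) (by positivity)]
    field_simp
  calc (q : ℝ) * (q : ℝ) ^ x / (2 * (t : ℝ) ^ 2 * (w * w ^ (2 * x)))
      ≤ q * (Y / w) / 4 := by
        rw [← hYe, div_le_div_iff₀ (by positivity) (by norm_num)]
        have h1 : (2 : ℝ) ^ x * w ^ x * 4 ≤ 2 * (t : ℝ) ^ 2 * w ^ (2 * x) := by
          calc (2 : ℝ) ^ x * w ^ x * 4 ≤ 2 * w ^ (2 * x) * 4 := by gcongr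
            _ = 2 * 2 ^ 2 * w ^ (2 * x) := by ring
            _ ≤ _ := by gcongr
        calc q * (Y * (2 ^ x * w ^ x)) * 4 = q * Y * (2 ^ x * w ^ x * 4) := by ring
          _ ≤ q * Y * (2 * (t : ℝ) ^ 2 * w ^ (2 * x)) := by gcongr
          _ = q * (Y / w) * (2 * (t : ℝ) ^ 2 * (w * w ^ (2 * x))) := by field_simp
    _ ≤ (D : ℝ) * q / 2 := by
        have : Y / w ≤ 2 * D := by linarith
        nlinarith

/-- The estimates on which the first two blocks depend. -/
theorem two_mul_lt {r q n : ℕ} (hq : 2 * (r + 1) * (4 * (r + 1)) ^ (n + 1) ≤ q) :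
    (r + 1) + 2 * (r * (1 + 2 * (r + 1)) ^ (n + 1)) < 2 * q ∧ 2 * (r + 1) ≤ q ∧ r * r < q := by
  have h1 : (1 + 2 * (r + 1)) ^ (n + 1) ≤ (4 * (r + 1)) ^ (n + 1) :=
    Nat.pow_le_pow_left (by omega) _
  have h2 : 4 * (r + 1) ≤ (4 * (r + 1)) ^ (n + 1) := Nat.le_self_pow (by omega) _
  have h3 : 2 * (r * (1 + 2 * (r + 1)) ^ (n + 1)) ≤ q := by
    calc 2 * (r * (1 + 2 * (r + 1)) ^ (n + 1))
        ≤ 2 * ((r + 1) * (4 * (r + 1)) ^ (n + 1)) := by gcongr; omega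
      _ = 2 * (r + 1) * (4 * (r + 1)) ^ (n + 1) := by ring
      _ ≤ q := hq
  have h4 : 2 * (r + 1) * (4 * (r + 1)) ≤ q := le_trans (Nat.mul_le_mul_left _ h2) hq
  refine ⟨?_, ?_, ?_⟩ <;> nlinarith

/-- A block system that leaves no space for a further block within `q²` places is long enough. -/
theorem lengthBound_le_of_lt (d r q n : ℕ) (hd : 5 ≤ d) (hq : 2 * (r + 1) ≤ q)
    (hn : q * q < n + (r + 1)) : lengthBound q d r ≤ n := by
  set t := (d - 1) / 2 with ht
  have ht2 : (2 : ℝ) ≤ t := by exact_mod_cast (by omega : 2 ≤ t)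
  set x : ℝ := 1 / ((t : ℝ) - 1) with hx
  rw [lengthBound_eq q d r (by omega) x hx, ← ht]
  have hx0 : 0 < x := by rw [hx]; exact one_div_pos.2 (by linarith)
  have hx1 : x ≤ 1 := by rw [hx, div_le_one] <;> linarith
  have hq' : 2 * ((r : ℝ) + 1) ≤ q := by exact_mod_cast hq
  have hr0 : (0 : ℝ) ≤ r := Nat.cast_nonneg r
  have hn' : (q : ℝ) * q < n + (r + 1) := by exact_mod_cast hn
  have hqx : (q : ℝ) ^ x ≤ q := by
    simpa using Real.rpow_le_rpow_of_exponent_le (by linarith : (1 : ℝ) ≤ q) hx1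
  have hwx : 1 ≤ ((r : ℝ) + 1) * ((r : ℝ) + 1) ^ (2 * x) :=
    one_le_mul_of_one_le_of_one_le (by linarith) (Real.one_le_rpow (by linarith) (by linarith))
  have hden : (2 : ℝ) ≤ 2 * (t : ℝ) ^ 2 * (((r : ℝ) + 1) * ((r : ℝ) + 1) ^ (2 * x)) := by
    have : 1 ≤ (t : ℝ) ^ 2 := by nlinarith
    nlinarith
  calc (q : ℝ) * (q : ℝ) ^ x / (2 * (t : ℝ) ^ 2 * (((r : ℝ) + 1) * ((r : ℝ) + 1) ^ (2 * x)))
      ≤ (q * q) / 2 := by gcongr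
    _ ≤ n := by nlinarith

end BlockSystem

namespace RAM

/-! ### Programs with bounded loops -/

/-- Overwrite cell `i` of array `k` by `v`. -/
def write (σ : State) (k i v : ℕ) : State :=
  Function.update σ k (Function.update (σ k) i v)

theorem write_apply (σ : State) (k i v k' : ℕ) :
    write σ k i v k' = if k' = k then Function.update (σ k) i v else σ k' := by
  unfold write
  by_cases h : k' = k
  · subst h; simp
  · simp [h]

theorem write_apply_of_ne {σ : State} {k i v k' : ℕ} (h : k' ≠ k) : write σ k i v k' = σ k' := by
  simp [write_apply, h]

@[simp]
theorem write_apply_self (σ : State) (k i v : ℕ) :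
    write σ k i v k = Function.update (σ k) i v := by
  simp [write_apply]

/-- Programs with bounded loops only. `loop x P` repeats `P` for `x = 0, 1, …, N - 1`, where
`N` is the content of cell `0` of array `5` and the loop variable is cell `0` of array `x`. -/
inductive LProg where
  | skip
  | set (k : ℕ) (i e : Expr)
  | seq (P Q : LProg)
  | ite (e : Expr) (P Q : LProg)
  | loop (x : ℕ) (P : LProg)

namespace LProg

/-- The memory in which a loop program ends. -/
def run : LProg → State → State
  | skip, σ => σ
  | set k i e, σ => write σ k (i.eval σ) (e.eval σ)
  | seq P Q, σ => Q.run (P.run σ)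
  | ite e P Q, σ => if e.eval σ ≠ 0 then P.run σ else Q.run σ
  | loop x P, σ => (fun τ => write (P.run τ) x 0 (P.run τ x 0 + 1))^[σ 5 0] (write σ x 0 0)

/-- The arrays that a loop program may write to. -/
def writes : LProg → List ℕ
  | skip => []
  | set k _ _ => [k]
  | seq P Q => P.writes ++ Q.writes
  | ite _ P Q => P.writes ++ Q.writes
  | loop x P => x :: P.writes

/-- The program never changes the common bound of the loops, and no loop changes its own loop
variable. -/
def WF : LProg → Prop
  | skip => True
  | set k _ _ => k ≠ 5
  | seq P Q => P.WF ∧ Q.WF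
  | ite _ P Q => P.WF ∧ Q.WF
  | loop x P => x ≠ 5 ∧ x ∉ P.writes ∧ P.WF

/-- The translation into a program of the random access machine. -/
def compile : LProg → Prog
  | skip => .skip
  | set k i e => .set k i e
  | seq P Q => .seq P.compile Q.compile
  | ite e P Q => .ite e P.compile Q.compile
  | loop x P => .seq (.set x (.const 0) (.const 0))
      (.while (.sub (.get 5 (.const 0)) (.get x (.const 0)))
        (.seq P.compile (.set x (.const 0) (.add (.get x (.const 0)) (.const 1)))))

open Polynomial in
/-- A bound for the running time, as a polynomial in the common bound of the loops. -/
noncomputable def costPoly : LProg → Polynomial ℕ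
  | skip => 1
  | set _ i e => C (i.cost + e.cost + 1)
  | seq P Q => P.costPoly + Q.costPoly
  | ite e P Q => C (e.cost + 1) + P.costPoly + Q.costPoly
  | loop _ P => C 9 + X * (P.costPoly + C 12)

theorem run_of_notMem_writes {P : LProg} {σ : State} {k : ℕ} (hk : k ∉ P.writes) :
    P.run σ k = σ k := by
  induction P generalizing σ with
  | skip => rfl
  | set k' i e =>
    simp only [writes, List.mem_singleton] at hk
    simp [run, write_apply, hk]
  | seq P Q ihP ihQ =>
    simp only [writes, List.mem_append, not_or] at hk
    simp [run, ihP hk.1, ihQ hk.2]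
  | ite e P Q ihP ihQ =>
    simp only [writes, List.mem_append, not_or] at hk
    simp only [run]
    split
    · exact ihP hk.1
    · exact ihQ hk.2
  | loop x P ih =>
    simp only [writes, List.mem_cons, not_or] at hk
    simp only [run]
    generalize σ 5 0 = N
    induction N with
    | zero => simp [write_apply, hk.1]
    | succ N ihN => rw [Function.iterate_succ_apply', write_apply_of_ne hk.1, ih hk.2, ihN]

theorem WF.notMem_writes {P : LProg} (hP : P.WF) : 5 ∉ P.writes := by
  induction P with
  | skip => simp [writes]
  | set k i e => simpa [writes] using fun h => hP h.symm
  | seq P Q ihP ihQ => simp [writes, ihP hP.1, ihQ hP.2]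
  | ite e P Q ihP ihQ => simp [writes, ihP hP.1, ihQ hP.2]
  | loop x P ih => simpa [writes, ih hP.2.2] using fun h => hP.1 h.symm

/-- The invariant rule for loops. The body may use that only the arrays in its list of written
arrays have changed since the start of the loop. -/
theorem loop_rule {x : ℕ} {P : LProg} (hP : (loop x P).WF) {σ : State}
    (Inv : ℕ → State → Prop)
    (hx : ∀ i τ v, Inv i τ → Inv i (write τ x 0 v)) (h0 : Inv 0 σ)
    (hs : ∀ i < σ 5 0, ∀ τ, (∀ k, k ∉ x :: P.writes → τ k = σ k) → τ x 0 = i → Inv i τ →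
      Inv (i + 1) (P.run τ)) :
    Inv (σ 5 0) ((loop x P).run σ) := by
  obtain ⟨hx5, hxP, hP⟩ := hP
  have key : ∀ n ≤ σ 5 0, ∃ τ, (fun τ => write (P.run τ) x 0 (P.run τ x 0 + 1))^[n]
      (write σ x 0 0) = τ ∧ (∀ k, k ∉ x :: P.writes → τ k = σ k) ∧ τ x 0 = n ∧ Inv n τ := by
    intro n hn
    induction n with
    | zero =>
      refine ⟨_, rfl, fun k hk => ?_, ?_, hx _ _ _ h0⟩
      · exact write_apply_of_ne (List.ne_of_not_mem_cons hk)
      · simp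
    | succ n ih =>
      obtain ⟨τ, hτ, hf, hτx, hI⟩ := ih (by omega)
      refine ⟨_, rfl, ?_, ?_, ?_⟩
      · intro k hk
        rw [Function.iterate_succ_apply', hτ, write_apply_of_ne (List.ne_of_not_mem_cons hk),
          run_of_notMem_writes (List.not_mem_of_not_mem_cons hk), hf k hk]
      · rw [Function.iterate_succ_apply', hτ, write_apply_self, Function.update_self,
          run_of_notMem_writes hxP, hτx]
      · rw [Function.iterate_succ_apply', hτ]
        exact hx _ _ _ (hs n (by omega) τ hf hτx hI)
  obtain ⟨τ, hτ, -, -, hI⟩ := key _ le_rfl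
  simp only [run, hτ, hI]

open Polynomial in
/-- A loop program takes a number of steps that is polynomial in the bound of its loops. -/
theorem exec_compile {P : LProg} (hP : P.WF) (σ : State) :
    ∃ T ≤ P.costPoly.eval (σ 5 0), Exec P.compile σ (P.run σ) T := by
  induction P generalizing σ with
  | skip => exact ⟨1, by simp [costPoly], Exec.skip σ⟩
  | set k i e => exact ⟨_, by simp [costPoly], Exec.set k i e σ⟩
  | seq P Q ihP ihQ =>
    obtain ⟨S, hS, hP'⟩ := ihP hP.1 σ
    obtain ⟨T, hT, hQ'⟩ := ihQ hP.2 (P.run σ)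
    rw [run_of_notMem_writes hP.1.notMem_writes] at hT
    exact ⟨S + T, by simpa only [costPoly, eval_add] using Nat.add_le_add hS hT, Exec.seq hP' hQ'⟩
  | ite e P Q ihP ihQ =>
    obtain ⟨S, hS, hP'⟩ := ihP hP.1 σ
    obtain ⟨T, hT, hQ'⟩ := ihQ hP.2 σ
    simp only [costPoly, eval_add, eval_C, run, compile]
    split
    · next h => exact ⟨_, by omega, Exec.ite_true h hP'⟩
    · next h => exact ⟨_, by omega, Exec.ite_false (by simpa using h) hQ'⟩
  | loop x P ih =>
    obtain ⟨hx5, hxP, hP⟩ := hP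
    have h5P := hP.notMem_writes
    set N := σ 5 0 with hN
    set B := P.costPoly.eval N with hB
    have key : ∀ n τ, n ≤ N → τ 5 0 = N → τ x 0 = N - n →
        ∃ T ≤ n * (B + 12) + 6, Exec (.while (.sub (.get 5 (.const 0)) (.get x (.const 0)))
          (.seq P.compile (.set x (.const 0) (.add (.get x (.const 0)) (.const 1))))) τ
          ((fun τ => write (P.run τ) x 0 (P.run τ x 0 + 1))^[n] τ) T := by
      intro n
      induction n with
      | zero =>
        intro τ _ h5 hx
        exact ⟨_, by simp [Expr.cost], Exec.while_false (by simp [Expr.eval, h5, hx])⟩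
      | succ n ihn =>
        intro τ hn h5 hx
        obtain ⟨S, hS, hex⟩ := ih hP τ
        rw [h5] at hS
        obtain ⟨T, hT, hex'⟩ := ihn (write (P.run τ) x 0 (P.run τ x 0 + 1)) (by omega)
          (by rw [write_apply_of_ne (Ne.symm hx5), run_of_notMem_writes h5P, h5])
          (by
            rw [write_apply_self, Function.update_self, run_of_notMem_writes hxP, hx]
            omega)
        refine ⟨_, ?_, Exec.while_true ?_ (Exec.seq hex (Exec.set _ _ _ _)) hex'⟩
        · simp only [Expr.cost]
          rw [Nat.succ_mul]
          omega
        · simp only [Expr.eval, h5, hx]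
          omega
    obtain ⟨T, hT, hex⟩ := key N (write σ x 0 0) le_rfl
      (by rw [write_apply_of_ne (Ne.symm hx5)]) (by simp)
    refine ⟨_, ?_, Exec.seq (Exec.set _ _ _ _) hex⟩
    simp only [costPoly, eval_add, eval_mul, eval_X, eval_C, Expr.cost, ← hB]
    omega

/-! ### Loops with a variable bound -/

/-- Repeat `P` for `x = 0, 1, …, n - 1`, where `n` is the content of cell `0` of array `j`. This
value has to be at most the common bound of the loops, and must not be changed by `P`. -/
def forLt (x j : ℕ) (P : LProg) : LProg :=
  loop x (ite (.sub (.get j (.const 0)) (.get x (.const 0))) P skip)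

theorem writes_forLt (x j : ℕ) (P : LProg) : (forLt x j P).writes = x :: P.writes := by
  simp [forLt, writes]

theorem WF_forLt {x j : ℕ} {P : LProg} :
    (forLt x j P).WF ↔ x ≠ 5 ∧ x ∉ P.writes ∧ P.WF := by
  simp [forLt, WF, writes]

theorem forLt_rule {x j : ℕ} {P : LProg} (hP : (forLt x j P).WF) (hj : j ∉ x :: P.writes)
    {σ : State} {n : ℕ} (hσ : σ j 0 = n) (hn : n ≤ σ 5 0) (Inv : ℕ → State → Prop)
    (hx : ∀ i τ v, Inv i τ → Inv i (write τ x 0 v)) (h0 : Inv 0 σ)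
    (hs : ∀ i < n, ∀ τ, (∀ k, k ∉ x :: P.writes → τ k = σ k) → τ x 0 = i → Inv i τ →
      Inv (i + 1) (P.run τ)) :
    Inv n ((forLt x j P).run σ) := by
  have := loop_rule hP (σ := σ)
    (fun i τ => Inv (min i n) τ) (fun i τ v h => hx _ _ _ h) (by simpa using h0)
    (fun i _ τ hf hτ hI => by
      replace hf : ∀ k, k ∉ x :: P.writes → τ k = σ k :=
        fun k h => hf k (by simpa [writes] using h)
      simp only [run, Expr.eval, hf j hj, hσ, hτ]
      by_cases h : i < n
      · rw [if_pos (by omega), min_eq_left (by omega)]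
        exact hs i h τ hf hτ (by rwa [min_eq_left (by omega)] at hI)
      · rw [if_neg (by omega), min_eq_right (by omega)]
        rwa [min_eq_right (by omega)] at hI)
  rwa [min_eq_right hn] at this

/-- The cells of the array `A` that are nonzero after a loop which only marks cells of this
array. -/
theorem forLt_mark {x j : ℕ} {P : LProg} (hP : (forLt x j P).WF) (hj : j ∉ x :: P.writes)
    {σ : State} {n : ℕ} (hσ : σ j 0 = n) (hn : n ≤ σ 5 0) {A : ℕ} (hA : A ≠ x) (S : ℕ → ℕ → Prop)
    (hs : ∀ i < n, ∀ τ, (∀ k, k ∉ x :: P.writes → τ k = σ k) → τ x 0 = i →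
      ∀ c, P.run τ A c ≠ 0 ↔ τ A c ≠ 0 ∨ S i c) (c : ℕ) :
    (forLt x j P).run σ A c ≠ 0 ↔ σ A c ≠ 0 ∨ ∃ i < n, S i c := by
  refine forLt_rule hP hj hσ hn
    (fun m τ => τ A c ≠ 0 ↔ σ A c ≠ 0 ∨ ∃ i < m, S i c)
    (fun i τ v h => by rwa [write_apply_of_ne hA]) (by simp) ?_
  intro i hi τ hf hτ hI
  rw [hs i hi τ hf hτ, hI, or_assoc]
  refine or_congr_right ⟨?_, ?_⟩
  · rintro (⟨j, hj, h⟩ | h)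
    · exact ⟨j, by omega, h⟩
    · exact ⟨i, by omega, h⟩
  · rintro ⟨j, hj, h⟩
    rcases Nat.lt_succ_iff_lt_or_eq.1 hj with hj | rfl
    · exact .inl ⟨j, hj, h⟩
    · exact .inr h

end LProg
end RAM

namespace RAM

open LProg BlockSystem

/-! ### The greedy algorithm as a program -/

/-- The contents of cell `0` of array `k`. -/
def var (k : ℕ) : Expr := .get k (.const 0)

/-- The number `x q + y`, by a table of the multiples of `q` in array `8`. -/
def pair (x y : Expr) : Expr := .add (.get 8 x) y

theorem eval_var (σ : State) (k : ℕ) : (var k).eval σ = σ k 0 := rfl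

theorem eval_pair (σ : State) (x y : Expr) :
    (pair x y).eval σ = σ 8 (x.eval σ) + y.eval σ := rfl

namespace LProg

theorem run_seq (P Q : LProg) (σ : State) : (seq P Q).run σ = Q.run (P.run σ) := rfl

theorem run_ite_apply (e : Expr) (P Q : LProg) (σ : State) (k i : ℕ) :
    (ite e P Q).run σ k i = if e.eval σ ≠ 0 then P.run σ k i else Q.run σ k i := by
  rw [run]
  split <;> rfl

/-- Array `41 + k` holds the relation of being at most `k + 1` steps apart. This program computes
it in array `42 + k`, for one step more. -/
def layer (k : ℕ) : LProg :=
  forLt 20 6 <| forLt 21 6 <| forLt 22 6 <|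
    ite (.get (41 + k) (pair (var 20) (var 21)))
      (ite (.get 41 (pair (var 21) (var 22)))
        (set (42 + k) (pair (var 20) (var 22)) (.const 1)) skip) skip

/-- Compute the relations of being at most `2, 3, …, n + 1` steps apart. -/
def layers : ℕ → LProg
  | 0 => skip
  | n + 1 => seq (layers n) (layer n)

/-- Extend the list of the `s` points in array `18` greedily, as long as it is shorter than a
block, by points of degree less than the limit in array `24` which are more than `n + 1` steps away
from all points of the list. -/
def extend (n : ℕ) : LProg :=
  forLt 20 6 <|
    ite (.sub (var 7) (var 19))
      (ite (.sub (var 24) (.get 13 (var 20)))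
        (seq (set 25 (.const 0) (.const 0)) <|
          seq (forLt 21 19 <|
              ite (.get (41 + n) (pair (.get 18 (var 21)) (var 20)))
                (set 25 (.const 0) (.const 1)) skip) <|
            ite (var 25) skip <|
              seq (set 18 (var 19) (var 20)) (set 19 (.const 0) (.add (var 19) (.const 1))))
        skip)
      skip

/-- Write the points of the list into the sequence of points, and update the degrees, the numbers
of the blocks, and the powers of the points. -/
def commitPoints : LProg :=
  forLt 20 7 <|
    seq (set 12 (.add (var 17) (var 20)) (.get 18 (var 20))) <|
    seq (set 13 (.get 18 (var 20)) (.add (.get 13 (.get 18 (var 20))) (.const 1))) <|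
    seq (set 14 (.add (var 17) (var 20)) (var 16)) <|
      set 15 (.add (var 17) (var 20)) (var 10)

/-- Mark all pairs of points of the list as adjacent. -/
def commitAdj : LProg :=
  forLt 20 7 <| forLt 21 7 <|
    set 41 (pair (.get 18 (var 20)) (.get 18 (var 21))) (.const 1)

/-- If the list is a full block, and there is space for it, add it to the block system. -/
def commit : LProg :=
  ite (.sub (var 7) (var 19)) skip <|
    ite (.sub (.add (var 17) (var 7)) (var 5)) skip <|
      seq commitPoints <| seq commitAdj <|
        seq (set 16 (.const 0) (.add (var 16) (.const 1)))
          (set 17 (.const 0) (.add (var 17) (var 7)))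

/-- Try to complete the list to a new block, and clear the list. -/
def attempt (n : ℕ) : LProg :=
  seq (layers n) <| seq (extend n) <| seq commit <| set 19 (.const 0) (.const 0)

theorem writes_layer (k : ℕ) : (layer k).writes = [20, 21, 22, 42 + k] := by
  simp [layer, writes_forLt, writes]

theorem WF_layer (k : ℕ) : (layer k).WF := by
  simp [layer, WF_forLt, WF, writes_forLt, writes]
  omega

theorem notMem_writes_layers {n k : ℕ} (h : k ≠ 20) (h' : k ≠ 21) (h'' : k ≠ 22)
    (hk : k < 42 ∨ 41 + n < k) : k ∉ (layers n).writes := by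
  induction n with
  | zero => simp [layers, writes]
  | succ n ih =>
    simp only [layers, writes, writes_layer, List.mem_append, List.mem_cons, List.not_mem_nil]
    have := ih (by omega)
    have : k ≠ 42 + n := by omega
    tauto

theorem WF_layers (n : ℕ) : (layers n).WF := by
  induction n with
  | zero => trivial
  | succ n ih => exact ⟨ih, WF_layer n⟩

theorem writes_extend (n : ℕ) : (extend n).writes = [20, 25, 21, 25, 18, 19] := by
  simp [extend, writes_forLt, writes]

theorem WF_extend (n : ℕ) : (extend n).WF := by
  simp [extend, WF_forLt, WF, writes_forLt, writes]

theorem writes_commit : commit.writes = [20, 12, 13, 14, 15, 20, 21, 41, 16, 17] := by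
  simp [commit, commitPoints, commitAdj, writes_forLt, writes]

theorem WF_commitPoints : commitPoints.WF := by
  simp [commitPoints, WF_forLt, WF, writes]

theorem WF_commitAdj : commitAdj.WF := by
  simp [commitAdj, WF_forLt, WF, writes, writes_forLt]

theorem WF_commit : commit.WF := by
  simp [commit, WF_commitPoints, WF_commitAdj, WF]

theorem WF_attempt (n : ℕ) : (attempt n).WF := by
  simp [attempt, WF_layers, WF_extend, WF_commit, WF]

theorem notMem_writes_attempt {n k : ℕ} (hk : k < 12 ∨ 23 < k ∧ k < 41) (hk' : k ≠ 25) :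
    k ∉ (attempt n).writes := by
  have h1 := notMem_writes_layers (n := n) (k := k) (by omega) (by omega) (by omega) (by omega)
  simp [attempt, writes, h1, writes_extend, writes_commit]
  omega

theorem layer_spec {σ : State} {q : ℕ} (h6 : σ 6 0 = q) (hq : q ≤ σ 5 0)
    (h8 : ∀ u < q, σ 8 u = u * q) (k c : ℕ) :
    (layer k).run σ (42 + k) c ≠ 0 ↔ σ (42 + k) c ≠ 0 ∨ ∃ u < q, ∃ x < q, ∃ v < q,
      σ (41 + k) (u * q + x) ≠ 0 ∧ σ 41 (x * q + v) ≠ 0 ∧ c = u * q + v := by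
  have hwf := WF_layer k
  rw [layer, WF_forLt, WF_forLt] at hwf
  refine forLt_mark (A := 42 + k) (WF_layer k) (by simp [writes_forLt, writes]; omega) h6 hq
    (by omega) (fun u c => ∃ x < q, ∃ v < q,
      σ (41 + k) (u * q + x) ≠ 0 ∧ σ 41 (x * q + v) ≠ 0 ∧ c = u * q + v) ?_ c
  intro u hu τ hτ hτu c
  simp only [writes, writes_forLt, List.mem_cons, List.mem_append, List.not_mem_nil, or_false]
    at hτ
  have e6 : τ 6 = σ 6 := hτ 6 (by omega)
  have e5 : τ 5 = σ 5 := hτ 5 (by omega)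
  refine forLt_mark (A := 42 + k) (WF_forLt.2 hwf.2.2) (by simp [writes_forLt, writes]; omega)
    (e6 ▸ h6) (e5 ▸ hq) (by omega) (fun x c => ∃ v < q,
      σ (41 + k) (u * q + x) ≠ 0 ∧ σ 41 (x * q + v) ≠ 0 ∧ c = u * q + v) ?_ c
  intro x hx τ' hτ' hτx c
  simp only [writes, writes_forLt, List.mem_cons, List.mem_append, List.not_mem_nil, or_false]
    at hτ'
  have e6' : τ' 6 = σ 6 := (hτ' 6 (by omega)).trans e6
  have e5' : τ' 5 = σ 5 := (hτ' 5 (by omega)).trans e5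
  refine forLt_mark (A := 42 + k) hwf.2.2.2.2 (by simp [writes]; omega)
    (e6' ▸ h6) (e5' ▸ hq) (by omega) (fun v c =>
      σ (41 + k) (u * q + x) ≠ 0 ∧ σ 41 (x * q + v) ≠ 0 ∧ c = u * q + v) ?_ c
  intro v hv ρ hρ hρv c
  simp only [writes, List.mem_append, List.mem_cons, List.not_mem_nil, or_false] at hρ
  have e8 : ρ 8 = σ 8 := by
    rw [hρ 8 (by omega), hτ' 8 (by omega), hτ 8 (by omega)]
  have e41 : ρ 41 = σ 41 := by
    rw [hρ 41 (by omega), hτ' 41 (by omega), hτ 41 (by omega)]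
  have ek : ρ (41 + k) = σ (41 + k) := by
    by_cases hk : k = 0
    · rw [hk, e41]
    · rw [hρ _ (by omega), hτ' _ (by omega), hτ _ (by omega)]
  have e20 : ρ 20 0 = u := by rw [hρ 20 (by omega), hτ' 20 (by omega), hτu]
  have e21 : ρ 21 0 = x := by rw [hρ 21 (by omega), hτx]
  rw [run_ite_apply, run_ite_apply]
  simp only [run, Expr.eval, eval_pair, eval_var, e8, e41, ek, e20, e21, hρv, h8 u hu,
    h8 x hx]
  by_cases h1 : σ (41 + k) (u * q + x) = 0
  · simp [h1]
  by_cases h2 : σ 41 (x * q + v) = 0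
  · simp [h1, h2]
  simp only [ne_eq, h1, h2, not_false_eq_true, if_true, write_apply_self, Function.update_apply,
    true_and]
  split <;> simp_all

end LProg

/-! ### The invariant of the algorithm -/

theorem pair_div_mod {q u v : ℕ} (hv : v < q) : (u * q + v) / q = u ∧ (u * q + v) % q = v := by
  rw [mul_comm, Nat.mul_add_div (by omega), Nat.div_eq_of_lt hv, add_zero, Nat.mul_add_mod,
    Nat.mod_eq_of_lt hv]
  exact ⟨rfl, rfl⟩

theorem pair_inj {q u v u' v' : ℕ} (hv : v < q) (hv' : v' < q) (h : u * q + v = u' * q + v') :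
    u = u' ∧ v = v' := by
  obtain ⟨h1, h2⟩ := pair_div_mod (u := u) hv
  obtain ⟨h3, h4⟩ := pair_div_mod (u := u') hv'
  exact ⟨by rw [← h1, h, h3], by rw [← h2, h, h4]⟩

/-- The constants of the program: the bound `q²` of the loops, the number `q` of points, the size
`w` of the blocks, and the multiples of `q`. -/
structure Consts (q w : ℕ) (σ : State) : Prop where
  bound : σ 5 0 = q * q
  points : σ 6 0 = q
  size : σ 7 0 = w
  table : ∀ u < q, σ 8 u = u * q

theorem Consts.congr {q w : ℕ} {σ τ : State} (h : Consts q w σ)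
    (he : ∀ k, 5 ≤ k → k ≤ 8 → τ k = σ k) : Consts q w τ where
  bound := by rw [he 5 (by omega) (by omega), h.bound]
  points := by rw [he 6 (by omega) (by omega), h.points]
  size := by rw [he 7 (by omega) (by omega), h.size]
  table := by rw [he 8 (by omega) (by omega)]; exact h.table

/-- The memory holds a good system of `m` blocks: the points in array `12`, their degrees in
array `13`, the numbers of the blocks in array `14`, ones in array `15`, the numbers of blocks and
of places in arrays `16` and `17`. Array `41` holds the relation of being equal or adjacent, and the
next `n` arrays hold relations that imply being reachable in `2, …, n + 1` steps. -/
structure Holds (q w n : ℕ) (σ : State) (m : ℕ) : Prop where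
  blocks : σ 16 0 = m
  places : σ 17 0 = m * w
  le : m * w ≤ q * q
  good : Good (σ 12) w q (n + 1) m
  degree : ∀ v < q, σ 13 v = deg (σ 12) (m * w) v
  owner : ∀ p < m * w, σ 14 p = p / w
  power : ∀ p < m * w, σ 15 p = σ 10 0
  adj : ∀ u < q, ∀ v < q, σ 41 (u * q + v) ≠ 0 ↔ u = v ∨ Adj (σ 12) w m u v
  layer : ∀ k ≤ n, ∀ u < q, ∀ v < q, σ (41 + k) (u * q + v) ≠ 0 →
    Reach (σ 12) w m (k + 1) u v

theorem Holds.congr {q w n m : ℕ} {σ τ : State} (h : Holds q w n σ m)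
    (he : ∀ k, 10 ≤ k → k ≤ 17 → τ k = σ k) (he' : ∀ k ≤ n, τ (41 + k) = σ (41 + k)) :
    Holds q w n τ m where
  blocks := by rw [he 16 (by omega) (by omega), h.blocks]
  places := by rw [he 17 (by omega) (by omega), h.places]
  le := h.le
  good := by rw [he 12 (by omega) (by omega)]; exact h.good
  degree := by
    rw [he 12 (by omega) (by omega), he 13 (by omega) (by omega)]; exact h.degree
  owner := by rw [he 14 (by omega) (by omega)]; exact h.owner
  power := by rw [he 15 (by omega) (by omega), he 10 (by omega) (by omega)]; exact h.power
  adj := by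
    rw [he 12 (by omega) (by omega), show τ 41 = σ 41 from he' 0 (by omega)]; exact h.adj
  layer k hk := by
    rw [he 12 (by omega) (by omega), he' k hk]; exact h.layer k hk

namespace LProg

variable {q w n m : ℕ} {σ : State}

/-- The entries left from earlier attempts do no harm: what was reachable then still is. -/
theorem layers_spec (hc : Consts q w σ) (h : Holds q w n σ m) {j : ℕ} (hj : j ≤ n) :
    ∀ k ≤ j, ∀ u < q, ∀ v < q, (layers j).run σ (41 + k) (u * q + v) ≠ 0 ↔
      Reach (σ 12) w m (k + 1) u v := by
  induction j with
  | zero =>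
    intro k hk u hu v hv
    obtain rfl : k = 0 := by omega
    rw [Reach.one]
    exact h.adj u hu v hv
  | succ j ih =>
    intro k hk u hu v hv
    have ih := ih (by omega)
    set τ := (layers j).run σ with hτ
    have hfr : ∀ k, k ≠ 20 → k ≠ 21 → k ≠ 22 → (k < 42 ∨ 41 + j < k) → τ k = σ k :=
      fun k h1 h2 h3 h4 => run_of_notMem_writes (notMem_writes_layers h1 h2 h3 h4)
    change (layer j).run τ _ _ ≠ 0 ↔ _
    rcases Nat.lt_or_ge k (j + 1) with hk' | hk'
    · rw [run_of_notMem_writes (by rw [writes_layer]; simp; omega)]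
      exact ih k (by omega) u hu v hv
    obtain rfl : k = j + 1 := by omega
    have h41 : τ 41 = σ 41 := hfr 41 (by omega) (by omega) (by omega) (by omega)
    have h6 : τ 6 = σ 6 := hfr 6 (by omega) (by omega) (by omega) (by omega)
    have h5 : τ 5 = σ 5 := hfr 5 (by omega) (by omega) (by omega) (by omega)
    have h8 : τ 8 = σ 8 := hfr 8 (by omega) (by omega) (by omega) (by omega)
    rw [show 41 + (j + 1) = 42 + j by omega, layer_spec (h6 ▸ hc.points)
      (by rw [h5, hc.bound]; exact Nat.le_mul_self q) (h8 ▸ hc.table),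
      hfr (42 + j) (by omega) (by omega) (by omega) (by omega), h41]
    constructor
    · rintro (h0 | ⟨u', hu', x, hx, v', hv', h1, h2, he⟩)
      · exact h.layer (j + 1) hj u hu v hv (by rwa [show 41 + (j + 1) = 42 + j by omega])
      · obtain ⟨rfl, rfl⟩ := pair_inj hv hv' he
        exact ⟨x, (ih j le_rfl u hu x hx).1 h1, (h.adj x hx v hv).1 h2⟩
    · rintro ⟨x, hx, hxv⟩
      have hxq : x < q := hx.lt h.good.lt hu
      exact .inr ⟨u, hu, x, hxq, v, hv, (ih j le_rfl u hu x hxq).2 hx,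
        (h.adj x hxq v hv).2 hxv, rfl⟩

/-- The list is extended greedily, for any reflexive relation in place of reachability. -/
theorem extend_spec (hc : Consts q w σ) {R : ℕ → ℕ → Prop} (hRr : ∀ v, R v v) (hwq : w ≤ q * q)
    (hR : ∀ u < q, ∀ v < q, σ (41 + n) (u * q + v) ≠ 0 ↔ R u v) {D : ℕ} (hD : σ 24 0 = D)
    (h0 : IsGreedy R (σ 13) D q w (σ 18) (σ 19 0) 0 (σ 18) (σ 19 0)) :
    IsGreedy R (σ 13) D q w (σ 18) (σ 19 0) q ((extend n).run σ 18) ((extend n).run σ 19 0) := by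
  have hwf := WF_extend n
  refine forLt_rule hwf (by simp [writes, writes_forLt]) hc.points
    (by rw [hc.bound]; exact Nat.le_mul_self q)
    (fun i τ => IsGreedy R (σ 13) D q w (σ 18) (σ 19 0) i (τ 18) (τ 19 0))
    (fun i τ v h => by rwa [write_apply_of_ne (by omega), write_apply_of_ne (by omega)]) h0 ?_
  intro i hi τ hτ hτi hI
  simp only [writes, writes_forLt, List.mem_cons, List.mem_append, List.not_mem_nil, or_false,
    false_or] at hτ
  have e7 : τ 7 0 = w := by rw [hτ 7 (by omega), hc.size]
  have e24 : τ 24 0 = D := by rw [hτ 24 (by omega), hD]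
  have e13 : τ 13 = σ 13 := hτ 13 (by omega)
  rw [run]
  split
  swap
  · next hs =>
    simp only [Expr.eval, eval_var, e7] at hs
    exact hI.skip (.inl (by have := hI.le; omega))
  next hs =>
  simp only [Expr.eval, eval_var, e7] at hs
  rw [run]
  split
  swap
  · next hd =>
    simp only [Expr.eval, eval_var, e24, e13, hτi] at hd
    exact hI.skip (.inr (.inl (by omega)))
  next hd =>
  simp only [Expr.eval, eval_var, e24, e13, hτi] at hd
  rw [run_seq, run_seq]
  set ρ := (set 25 (.const 0) (.const 0)).run τ with hρ
  have hρe : ∀ k, k ≠ 25 → ρ k = τ k := fun k hk => run_of_notMem_writes (by simpa [writes])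
  set ρ' := (forLt 21 19 (ite (.get (41 + n) (pair (.get 18 (var 21)) (var 20)))
    (set 25 (.const 0) (.const 1)) skip)).run ρ with hρ'
  have hρe' : ∀ k, k ≠ 21 → k ≠ 25 → ρ' k = ρ k := fun k h1 h2 =>
    run_of_notMem_writes (by simp [writes, writes_forLt, h1, h2])
  have hmark : ρ' 25 0 ≠ 0 ↔ ∃ j < τ 19 0, R (τ 18 j) i := by
    have := forLt_mark (x := 21) (j := 19) (A := 25)
      (P := ite (.get (41 + n) (pair (.get 18 (var 21)) (var 20)))
        (set 25 (.const 0) (.const 1)) skip) (by simp [WF_forLt, WF, writes])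
      (by simp [writes]) (σ := ρ) (n := τ 19 0) (by rw [hρe 19 (by omega)])
      (by rw [hρe 5 (by omega), hτ 5 (by omega), hc.bound]; exact hI.le.trans hwq) (by omega)
      (fun j c => R (τ 18 j) i ∧ c = 0) (fun j hj ν hν hνj c => ?_) 0
    · rw [hρ', this]
      simp [hρ, run, Expr.eval]
    · simp only [writes, List.mem_cons, List.mem_append, List.not_mem_nil, or_false] at hν
      have e18 : ν 18 = τ 18 := by rw [hν 18 (by omega), hρe 18 (by omega)]
      have e20 : ν 20 0 = i := by rw [hν 20 (by omega), hρe 20 (by omega), hτi]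
      have e8 : ν 8 = σ 8 := by rw [hν 8 (by omega), hρe 8 (by omega), hτ 8 (by omega)]
      have en : ν (41 + n) = σ (41 + n) := by
        rw [hν _ (by omega), hρe _ (by omega), hτ _ (by omega)]
      have hjq := hI.lt j hj
      have hcond : (Expr.get (41 + n) (pair (.get 18 (var 21)) (var 20))).eval ν ≠ 0 ↔
          R (τ 18 j) i := by
        simp only [Expr.eval, eval_pair, eval_var, hνj, e18, e20, e8, en, hc.table _ hjq,
          hR _ hjq i hi]
      rw [run_ite_apply]
      by_cases hr : R (τ 18 j) i
      · rw [if_pos (hcond.2 hr)]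
        by_cases hc0 : c = 0 <;> simp [hr, hc0, run, Expr.eval]
      · rw [if_neg (mt hcond.1 hr)]
        simp [hr, run]
  have e18 : ρ' 18 = τ 18 := by rw [hρe' 18 (by omega) (by omega), hρe 18 (by omega)]
  have e19 : ρ' 19 = τ 19 := by rw [hρe' 19 (by omega) (by omega), hρe 19 (by omega)]
  have e20 : ρ' 20 0 = i := by rw [hρe' 20 (by omega) (by omega), hρe 20 (by omega), hτi]
  rw [run]
  split
  · next hb =>
    simp only [eval_var, hmark] at hb
    rw [run, e18, e19]
    exact hI.skip (.inr (.inr hb))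
  · next hb =>
    simp only [eval_var, hmark] at hb
    simp only [run, Expr.eval, eval_var, e18, e19, e20, write_apply, Function.update_self,
      reduceIte, Nat.reduceEqDiff]
    push Not at hb
    exact hI.push hRr (by omega) hi (by omega) hb

theorem commitPoints_spec (hc : Consts q w σ) (hwq : w ≤ q * q) {b : ℕ} (hb : σ 17 0 = b)
    (hdeg : ∀ v < q, σ 13 v = deg (σ 12) b v) {L' : ℕ → ℕ}
    (hL' : ∀ p < b, L' p = σ 12 p) (hLS : ∀ j < w, L' (b + j) = σ 18 j) :
    (∀ p < b + w, commitPoints.run σ 12 p = L' p) ∧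
    (∀ v < q, commitPoints.run σ 13 v = deg L' (b + w) v) ∧
    ((∀ p < b, commitPoints.run σ 14 p = σ 14 p) ∧
      ∀ j < w, commitPoints.run σ 14 (b + j) = σ 16 0) ∧
    (∀ p < b, commitPoints.run σ 15 p = σ 15 p) ∧
      ∀ j < w, commitPoints.run σ 15 (b + j) = σ 10 0 := by
  refine forLt_rule WF_commitPoints (by simp [writes]) hc.size (by rwa [hc.bound])
    (fun i τ => (∀ p < b + i, τ 12 p = L' p) ∧ (∀ v < q, τ 13 v = deg L' (b + i) v) ∧
      ((∀ p < b, τ 14 p = σ 14 p) ∧ ∀ j < i, τ 14 (b + j) = σ 16 0) ∧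
      (∀ p < b, τ 15 p = σ 15 p) ∧ ∀ j < i, τ 15 (b + j) = σ 10 0)
    (fun i τ v h => by simpa [write_apply] using h) ?_ ?_
  · refine ⟨fun p hp => (hL' p hp).symm, fun v hv => ?_, by simp, by simp⟩
    rw [hdeg v hv]
    exact deg_congr fun p hp => (hL' p hp).symm
  rintro i hi τ hτ hτi ⟨h12, h13, ⟨h14, h14'⟩, h15, h15'⟩
  simp only [writes, List.mem_cons, List.mem_append, List.not_mem_nil, or_false] at hτ
  have e17 : τ 17 0 = b := by rw [hτ 17 (by omega), hb]
  have e18 : τ 18 = σ 18 := hτ 18 (by omega)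
  have e16 : τ 16 = σ 16 := hτ 16 (by omega)
  have e10 : τ 10 = σ 10 := hτ 10 (by omega)
  simp only [run, Expr.eval, eval_var, write_apply, hτi, e17, e18, e16, e10, reduceIte,
    Nat.reduceEqDiff]
  refine ⟨fun p hp => ?_, fun v hv => ?_, ⟨fun p hp => ?_, fun j hj => ?_⟩, fun p hp => ?_,
    fun j hj => ?_⟩
  · rcases Nat.lt_or_ge p (b + i) with hp' | hp'
    · rw [Function.update_of_ne (by omega), h12 p hp']
    · obtain rfl : p = b + i := by omega
      rw [Function.update_self, hLS i hi]
  · rw [← add_assoc, deg_succ, hLS i hi, ← h13 v hv]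
    by_cases hv' : σ 18 i = v
    · rw [hv', Function.update_self, if_pos rfl]
    · rw [Function.update_of_ne (Ne.symm hv'), if_neg hv', add_zero]
  · rw [Function.update_of_ne (by omega), h14 p hp]
  · rcases Nat.lt_succ_iff_lt_or_eq.1 hj with hj | rfl
    · rw [Function.update_of_ne (by omega), h14' j hj]
    · rw [Function.update_self]
  · rw [Function.update_of_ne (by omega), h15 p hp]
  · rcases Nat.lt_succ_iff_lt_or_eq.1 hj with hj | rfl
    · rw [Function.update_of_ne (by omega), h15' j hj]
    · rw [Function.update_self]

theorem commitAdj_spec (hc : Consts q w σ) (hwq : w ≤ q * q) (hS : ∀ j < w, σ 18 j < q) (c : ℕ) :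
    commitAdj.run σ 41 c ≠ 0 ↔
      σ 41 c ≠ 0 ∨ ∃ i < w, ∃ j < w, c = σ 18 i * q + σ 18 j := by
  have hwf := WF_commitAdj
  rw [commitAdj, WF_forLt] at hwf
  refine forLt_mark (A := 41) WF_commitAdj (by simp [writes, writes_forLt]) hc.size
    (by rwa [hc.bound]) (by omega) (fun i c => ∃ j < w, c = σ 18 i * q + σ 18 j) ?_ c
  intro i hi τ hτ hτi c
  simp only [writes, writes_forLt, List.mem_cons, List.not_mem_nil, or_false] at hτ
  refine forLt_mark (A := 41) hwf.2.2 (by simp [writes])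
    (by rw [hτ 7 (by omega), hc.size])
    (by rwa [hτ 5 (by omega), hc.bound]) (by omega) (fun j c => c = σ 18 i * q + σ 18 j) ?_ c
  intro j hj ρ hρ hρj c
  simp only [writes, List.mem_cons, List.not_mem_nil, or_false] at hρ
  have e8 : ρ 8 = σ 8 := by rw [hρ 8 (by omega), hτ 8 (by omega)]
  have e18 : ρ 18 = σ 18 := by rw [hρ 18 (by omega), hτ 18 (by omega)]
  have e20 : ρ 20 0 = i := by rw [hρ 20 (by omega), hτi]
  simp only [run, Expr.eval, eval_pair, eval_var, e8, e18, e20, hρj, hc.table _ (hS i hi),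
    write_apply_self, Function.update_apply]
  split <;> simp_all

/-- The effect of adding a full list of points as a new block. -/
theorem commit_spec (hc : Consts q w σ) (h : Holds q w n σ m) (hs : σ 19 0 = w)
    (hle : m * w + w ≤ q * q) (hS : ∀ j < w, σ 18 j < q)
    (hfar : ∀ i j, i < j → j < w → ¬ Reach (σ 12) w m (n + 1) (σ 18 i) (σ 18 j)) :
    Holds q w n (commit.run σ) (m + 1) ∧
    (∀ p < m * w, commit.run σ 12 p = σ 12 p) ∧
    ∀ j < w, commit.run σ 12 (m * w + j) = σ 18 j := by
  have hwq : w ≤ q * q := by omega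
  set τ := commitPoints.run σ with hτ
  set ρ := commitAdj.run τ with hρ
  have hτe : ∀ k, k ≠ 20 → k ≠ 12 → k ≠ 13 → k ≠ 14 → k ≠ 15 → τ k = σ k := fun k h1 h2 h3 h4 h5 =>
    run_of_notMem_writes (by simp [commitPoints, writes_forLt, writes, *])
  have hρe : ∀ k, k ≠ 20 → k ≠ 21 → k ≠ 41 → ρ k = τ k := fun k h1 h2 h3 =>
    run_of_notMem_writes (by simp [commitAdj, writes_forLt, writes, *])
  have e17 : ρ 17 0 = m * w := by
    rw [hρe 17 (by omega) (by omega) (by omega),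
      hτe 17 (by omega) (by omega) (by omega) (by omega) (by omega), h.places]
  have e16 : ρ 16 0 = m := by
    rw [hρe 16 (by omega) (by omega) (by omega),
      hτe 16 (by omega) (by omega) (by omega) (by omega) (by omega), h.blocks]
  have e7 : ρ 7 0 = w := by
    rw [hρe 7 (by omega) (by omega) (by omega),
      hτe 7 (by omega) (by omega) (by omega) (by omega) (by omega), hc.size]
  have hrun : commit.run σ = write (write ρ 16 0 (m + 1)) 17 0 (m * w + w) := by
    rw [commit, run, if_neg, run, if_neg]
    · simp only [run_seq, ← hτ, ← hρ]
      simp only [run, Expr.eval, eval_var, e16, e17, e7, write_apply_of_ne (show 17 ≠ 16 by omega),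
        write_apply_of_ne (show 7 ≠ 16 by omega)]
    · simp only [Expr.eval, eval_var, h.places, hc.size, hc.bound]
      omega
    · simp only [Expr.eval, eval_var, hc.size, hs]
      omega
  have he : ∀ k, k ≠ 16 → k ≠ 17 → commit.run σ k = ρ k := fun k h1 h2 => by
    rw [hrun, write_apply_of_ne h2, write_apply_of_ne h1]
  -- The sequence of points after adding the block.
  set L' : ℕ → ℕ := fun p => if p < m * w then σ 12 p else σ 18 (p - m * w) with hL'
  have hL1 : ∀ p < m * w, L' p = σ 12 p := fun p hp => if_pos hp
  have hL2 : ∀ j < w, L' (m * w + j) = σ 18 j := fun j _ => by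
    simp [hL']
  obtain ⟨h12, h13, ⟨h14, h14'⟩, h15, h15'⟩ :=
    commitPoints_spec hc hwq h.places h.degree hL1 hL2
  simp only [← hτ] at h12 h13 h14 h14' h15 h15'
  have e12 : commit.run σ 12 = τ 12 := by
    rw [he 12 (by omega) (by omega), hρe 12 (by omega) (by omega) (by omega)]
  have hmw : (m + 1) * w = m * w + w := by ring
  have hg : Good L' w q (n + 1) (m + 1) := by
    refine (h.good.congr fun p hp => (hL1 p hp).symm).snoc
      (fun j hj => by rw [hL2 j hj]; exact hS j hj) fun i j hij hj => ?_
    rw [hL2 i (hij.trans hj), hL2 j hj, Reach.congr hL1]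
    exact hfar i j hij hj
  have hagree : ∀ p < (m + 1) * w, L' p = commit.run σ 12 p := fun p hp => by
    rw [e12, h12 p (hmw ▸ hp)]
  have hadj : ∀ u v, Adj L' w (m + 1) u v ↔
      Adj (σ 12) w m u v ∨ ∃ i < w, ∃ j < w, σ 18 i = u ∧ σ 18 j = v := by
    intro u v
    constructor
    · rintro ⟨b, hb, i, hi, j, hj, h1, h2⟩
      rcases Nat.lt_succ_iff_lt_or_eq.1 hb with hb | rfl
      · refine .inl ⟨b, hb, i, hi, j, hj, ?_, ?_⟩
        · rwa [hL1 _ (mul_add_lt hb hi)] at h1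
        · rwa [hL1 _ (mul_add_lt hb hj)] at h2
      · refine .inr ⟨i, hi, j, hj, ?_, ?_⟩
        · rwa [hL2 i hi] at h1
        · rwa [hL2 j hj] at h2
    · rintro (⟨b, hb, i, hi, j, hj, h1, h2⟩ | ⟨i, hi, j, hj, h1, h2⟩)
      · exact ⟨b, by omega, i, hi, j, hj, by rwa [hL1 _ (mul_add_lt hb hi)],
          by rwa [hL1 _ (mul_add_lt hb hj)]⟩
      · exact ⟨m, by omega, i, hi, j, hj, by rwa [hL2 i hi], by rwa [hL2 j hj]⟩
  refine ⟨⟨?_, ?_, by omega, hg.congr hagree, fun v hv => ?_, fun p hp => ?_, fun p hp => ?_,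
    fun u hu v hv => ?_, fun k hk u hu v hv h0 => ?_⟩, fun p hp => ?_, fun j hj => ?_⟩
  · rw [hrun, write_apply_of_ne (by omega)]
    simp
  · rw [hrun, hmw]
    simp
  · rw [he 13 (by omega) (by omega), hρe 13 (by omega) (by omega) (by omega), h13 v hv,
      ← hmw, deg_congr hagree]
  · rw [he 14 (by omega) (by omega), hρe 14 (by omega) (by omega) (by omega)]
    rcases Nat.lt_or_ge p (m * w) with hp' | hp'
    · rw [h14 p hp', h.owner p hp']
    · obtain ⟨j, rfl⟩ := Nat.exists_eq_add_of_le hp'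
      have hj : j < w := by omega
      rw [h14' j hj, h.blocks, mul_comm m w, Nat.mul_add_div (by omega), Nat.div_eq_of_lt hj,
        add_zero]
  · rw [he 15 (by omega) (by omega), hρe 15 (by omega) (by omega) (by omega),
      he 10 (by omega) (by omega), hρe 10 (by omega) (by omega) (by omega),
      hτe 10 (by omega) (by omega) (by omega) (by omega) (by omega)]
    rcases Nat.lt_or_ge p (m * w) with hp' | hp'
    · rw [h15 p hp', h.power p hp']
    · obtain ⟨j, rfl⟩ := Nat.exists_eq_add_of_le hp'
      rw [h15' j (by omega)]
  · have hcτ : Consts q w τ := hc.congr fun k h1 h2 => hτe k (by omega) (by omega) (by omega)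
      (by omega) (by omega)
    have e18 : τ 18 = σ 18 := hτe 18 (by omega) (by omega) (by omega) (by omega) (by omega)
    have e41 : τ 41 = σ 41 := hτe 41 (by omega) (by omega) (by omega) (by omega) (by omega)
    rw [he 41 (by omega) (by omega), hρ, commitAdj_spec hcτ hwq (e18 ▸ hS), e18, e41,
      ← Adj.congr hagree, hadj, h.adj u hu v hv, or_assoc]
    refine or_congr_right (or_congr_right ⟨?_, ?_⟩)
    · rintro ⟨i, hi, j, hj, hij⟩
      obtain ⟨h1, h2⟩ := pair_inj hv (hS j hj) hij
      exact ⟨i, hi, j, hj, h1.symm, h2.symm⟩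
    · rintro ⟨i, hi, j, hj, rfl, rfl⟩
      exact ⟨i, hi, j, hj, rfl⟩
  · rw [← Reach.congr hagree]
    rcases Nat.eq_zero_or_pos k with rfl | hk0
    · have hcτ : Consts q w τ := hc.congr fun k h1 h2 => hτe k (by omega) (by omega) (by omega)
        (by omega) (by omega)
      have e18 : τ 18 = σ 18 := hτe 18 (by omega) (by omega) (by omega) (by omega) (by omega)
      have e41 : τ 41 = σ 41 := hτe 41 (by omega) (by omega) (by omega) (by omega) (by omega)
      rw [he 41 (by omega) (by omega), hρ, commitAdj_spec hcτ hwq (e18 ▸ hS), e18, e41,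
        h.adj u hu v hv] at h0
      rw [Reach.one, hadj]
      rcases h0 with (h0 | h0) | ⟨i, hi, j, hj, hij⟩
      · exact .inl h0
      · exact .inr (.inl h0)
      · obtain ⟨h1, h2⟩ := pair_inj hv (hS j hj) hij
        exact .inr (.inr ⟨i, hi, j, hj, h1.symm, h2.symm⟩)
    · rw [he _ (by omega) (by omega), hρe _ (by omega) (by omega) (by omega),
        hτe _ (by omega) (by omega) (by omega) (by omega) (by omega)] at h0
      exact ((Reach.congr hL1).2 (h.layer k hk u hu v hv h0)).mono_blocks (by omega)
  · rw [e12, h12 p (by omega), hL1 p hp]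
  · rw [e12, h12 _ (by omega), hL2 j hj]

/-- The effect of an attempt: the block system is unchanged or has a new block, which contains the
points already chosen. If it is unchanged then there was no space, or by lack of points of degree
below the limit the number of blocks was large. -/
theorem attempt_spec {r D : ℕ} (hc : Consts q (r + 1) σ) (hrq : r + 1 ≤ q * q)
    (h : Holds q (r + 1) n σ m) (hlim : σ 24 0 = D)
    (hdeg : ∀ v, deg (σ 12) (m * (r + 1)) v ≤ D) (hs : σ 19 0 ≤ r + 1)
    (hS : ∀ j < σ 19 0, σ 18 j < q) (hSd : ∀ j < σ 19 0, deg (σ 12) (m * (r + 1)) (σ 18 j) < D)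
    (hSf : ∀ i j, i < j → j < σ 19 0 → ¬ Reach (σ 12) (r + 1) m (n + 1) (σ 18 i) (σ 18 j)) :
    ∃ m', Holds q (r + 1) n ((attempt n).run σ) m' ∧
      (∀ v, deg ((attempt n).run σ 12) (m' * (r + 1)) v ≤ D) ∧
      (attempt n).run σ 19 0 = 0 ∧
      (∀ p < m * (r + 1), (attempt n).run σ 12 p = σ 12 p) ∧
      ((m' = m ∧ (q * q < m * (r + 1) + (r + 1) ∨
          D * q ≤ m * (r + 1) + D * (r * (1 + D * (r + 1)) ^ (n + 1)))) ∨
        (m' = m + 1 ∧ ∀ i < σ 19 0, (attempt n).run σ 12 (m * (r + 1) + i) = σ 18 i)) := by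
  set τ := (layers n).run σ with hτ
  set ρ := (extend n).run τ with hρ
  have hτe : ∀ k, k ≠ 20 → k ≠ 21 → k ≠ 22 → k < 42 → τ k = σ k := fun k h1 h2 h3 h4 =>
    run_of_notMem_writes (notMem_writes_layers h1 h2 h3 (.inl h4))
  have hρe : ∀ k, k ≠ 20 → k ≠ 25 → k ≠ 21 → k ≠ 18 → k ≠ 19 → ρ k = τ k :=
    fun k h1 h2 h3 h4 h5 => run_of_notMem_writes (by simp [writes_extend, *])
  have hrun : (attempt n).run σ = write (commit.run ρ) 19 0 0 := rfl
  have hlay := layers_spec hc h le_rfl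
  have hτ12 : τ 12 = σ 12 := hτe 12 (by omega) (by omega) (by omega) (by omega)
  have hcτ : Consts q (r + 1) τ := hc.congr fun k h1 h2 => hτe k (by omega) (by omega) (by omega)
    (by omega)
  -- Computing the layers changes none of the other arrays, and the new layers are correct.
  have hHτ : Holds q (r + 1) n τ m :=
    { h.congr (τ := fun k => if k ≤ 41 then τ k else σ k)
        (fun k h1 h2 => by
          rw [if_pos (by omega), hτe k (by omega) (by omega) (by omega) (by omega)])
        (fun k _ => by
          rcases Nat.eq_zero_or_pos k with rfl | hk
          · rw [if_pos (by omega), hτe _ (by omega) (by omega) (by omega) (by omega)]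
          · rw [if_neg (by omega)]) with
      layer := fun k hk u hu v hv h0 => by
        rw [hτ12]
        exact (hlay k hk u hu v hv).1 h0 }
  have hcρ : Consts q (r + 1) ρ := hcτ.congr fun k h1 h2 => hρe k (by omega) (by omega) (by omega)
    (by omega) (by omega)
  have hHρ : Holds q (r + 1) n ρ m := hHτ.congr
    (fun k h1 h2 => hρe k (by omega) (by omega) (by omega) (by omega) (by omega))
    (fun k hk => hρe _ (by omega) (by omega) (by omega) (by omega) (by omega))
  have e18 : τ 18 = σ 18 := hτe 18 (by omega) (by omega) (by omega) (by omega)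
  have e19 : τ 19 = σ 19 := hτe 19 (by omega) (by omega) (by omega) (by omega)
  have hdq : ∀ v < q, τ 13 v = deg (σ 12) (m * (r + 1)) v := hτ12 ▸ hHτ.degree
  have hgr := extend_spec (n := n) hcτ (R := Reach (σ 12) (r + 1) m (n + 1))
    (fun v => Reach.refl _) hrq (hlay n le_rfl) (D := D)
    (by rw [hτe 24 (by omega) (by omega) (by omega) (by omega), hlim])
    (by
      rw [e18, e19]
      exact ⟨hs, le_rfl, fun _ _ => rfl, hS, fun j hj => by rw [hdq _ (hS j hj)]; exact hSd j hj,
        hSf, .inr fun v hv => absurd hv (Nat.not_lt_zero v)⟩)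
  rw [← hρ, e18, e19] at hgr
  have hρ12 : ρ 12 = σ 12 := by
    rw [hρe 12 (by omega) (by omega) (by omega) (by omega) (by omega), hτ12]
  have hfail : commit.run ρ = ρ → (q * q < m * (r + 1) + (r + 1) ∨
      D * q ≤ m * (r + 1) + D * (r * (1 + D * (r + 1)) ^ (n + 1))) → ∃ m',
      Holds q (r + 1) n ((attempt n).run σ) m' ∧
      (∀ v, deg ((attempt n).run σ 12) (m' * (r + 1)) v ≤ D) ∧
      (attempt n).run σ 19 0 = 0 ∧
      (∀ p < m * (r + 1), (attempt n).run σ 12 p = σ 12 p) ∧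
      ((m' = m ∧ (q * q < m * (r + 1) + (r + 1) ∨
          D * q ≤ m * (r + 1) + D * (r * (1 + D * (r + 1)) ^ (n + 1)))) ∨
        (m' = m + 1 ∧ ∀ i < σ 19 0, (attempt n).run σ 12 (m * (r + 1) + i) = σ 18 i)) := by
    intro hid hcase
    have h12 : (attempt n).run σ 12 = σ 12 := by
      rw [hrun, hid, write_apply_of_ne (by omega), hρ12]
    refine ⟨m, ?_, h12 ▸ hdeg, by rw [hrun]; simp, fun p _ => by rw [h12], .inl ⟨rfl, hcase⟩⟩
    rw [hrun, hid]
    exact hHρ.congr (fun k _ _ => write_apply_of_ne (by omega))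
      (fun k _ => write_apply_of_ne (by omega))
  -- If the list is not full, all points of degree less than `D` are near its points.
  by_cases hfull : ρ 19 0 = r + 1
  swap
  · refine hfail ?_ (.inr ?_)
    · rw [commit, run, if_pos]
      · rfl
      · simp only [Expr.eval, eval_var, hcρ.size]
        have := hgr.le
        omega
    · refine mul_le_of_forall_reach h.good.lt hdeg (ρ 18) fun v hv hvD => ?_
      obtain ⟨i, hi, hR⟩ := hgr.stuck.resolve_left hfull v hv (by rwa [hdq v hv])
      exact ⟨i, by have := hgr.le; omega, hR⟩
  by_cases hspace : q * q < m * (r + 1) + (r + 1)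
  · refine hfail ?_ (.inl hspace)
    rw [commit, run, if_neg, run, if_pos]
    · rfl
    · simp only [Expr.eval, eval_var, hHρ.places, hcρ.size, hcρ.bound]
      omega
    · simp only [Expr.eval, eval_var, hcρ.size, hfull]
      omega
  · rw [hfull] at hgr
    obtain ⟨hH, hold, hnew⟩ := commit_spec hcρ hHρ hfull (by omega) hgr.lt
      (by rw [hρ12]; exact hgr.far)
    have h12 : (attempt n).run σ 12 = commit.run ρ 12 := by
      rw [hrun, write_apply_of_ne (by omega)]
    rw [hρ12] at hold
    refine ⟨m + 1, ?_, fun v => ?_, by rw [hrun]; simp, fun p hp => by rw [h12, hold p hp],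
      .inr ⟨rfl, fun i hi => ?_⟩⟩
    · rw [hrun]
      exact hH.congr (fun k _ _ => write_apply_of_ne (by omega))
        (fun k _ => write_apply_of_ne (by omega))
    · rw [h12, add_mul, one_mul]
      have hold' : deg (commit.run ρ 12) (m * (r + 1)) v = deg (σ 12) (m * (r + 1)) v :=
        deg_congr hold
      have := deg_add_le (L := commit.run ρ 12) (n := m * (r + 1)) (w := r + 1)
        (fun i j hij hj => by
          rw [hnew i (hij.trans hj), hnew j hj]
          exact fun he => hgr.far i j hij hj (he ▸ Reach.refl _)) v
      rw [hold'] at this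
      by_cases hv : ∃ j < r + 1, commit.run ρ 12 (m * (r + 1) + j) = v
      · obtain ⟨j, hj, rfl⟩ := hv
        have := hgr.deg_lt j hj
        rw [hdq _ (hgr.lt j hj), ← hnew j hj] at this
        omega
      · push Not at hv
        rw [this.2 hv]
        exact hdeg v
    · rw [h12, hnew i (by omega), hgr.eq i hi]

end LProg

/-! ### Arithmetic in the field -/

/-- An expression that is nonzero if and only if the two given ones have different values. -/
def diff (a b : Expr) : Expr := .add (.sub a b) (.sub b a)

theorem eval_diff {σ : State} {a b : Expr} : (diff a b).eval σ ≠ 0 ↔ a.eval σ ≠ b.eval σ := by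
  simp only [diff, Expr.eval]
  omega

/-- The sum of two field elements, by the table in array `2`. -/
def fadd (a b : Expr) : Expr := .get 2 (pair a b)

/-- The product of two field elements, by the table in array `3`. -/
def fmul (a b : Expr) : Expr := .get 3 (pair a b)

namespace LProg

/-- Copy the input numbers, compute the multiples of `q`, and mark the pairs of equal points. -/
def prelude : LProg :=
  seq (set 6 (.const 0) (var 0)) <| seq (set 7 (.const 0) (.add (var 1) (.const 1))) <|
    forLt 20 6 <|
      seq (set 8 (var 20) (var 29)) <| seq (set 41 (.add (var 29) (var 20)) (.const 1)) <|
        set 29 (.const 0) (.add (var 29) (var 6))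

/-- Find the elements `0`, `1` and `-1` of the field. -/
def findConsts : LProg :=
  seq (forLt 20 6 <| ite (diff (fadd (var 20) (var 20)) (var 20)) skip
      (set 9 (.const 0) (var 20))) <|
  seq (forLt 20 6 <| ite (diff (fmul (var 20) (var 20)) (var 20)) skip
      (ite (diff (var 20) (var 9)) (set 10 (.const 0) (var 20)) skip)) <|
  forLt 20 6 <| ite (diff (fadd (var 20) (var 10)) (var 9)) skip (set 11 (.const 0) (var 20))

/-- Tabulate the polynomial vanishing on the first `r` points of the first block. -/
def evalPoly : LProg :=
  forLt 20 6 <| seq (set 26 (var 20) (var 10)) <| forLt 21 1 <|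
    set 26 (var 20) (fmul (.get 26 (var 20))
      (fadd (var 20) (fmul (var 11) (.get 12 (var 21)))))

/-- Find two points at which this polynomial has the same nonzero value. -/
def findPair : LProg :=
  forLt 20 6 <| forLt 21 6 <| ite (diff (var 20) (var 21))
    (ite (diff (.get 26 (var 20)) (var 9))
      (ite (diff (.get 26 (var 20)) (.get 26 (var 21))) skip
        (seq (set 27 (.const 0) (var 20)) (set 28 (.const 0) (var 21)))) skip) skip

theorem WF_prelude : prelude.WF := by
  simp [prelude, WF, WF_forLt, writes]

theorem WF_findConsts : findConsts.WF := by
  simp [findConsts, WF, WF_forLt, writes]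

theorem WF_evalPoly : evalPoly.WF := by
  simp [evalPoly, WF, WF_forLt, writes, writes_forLt]

theorem WF_findPair : findPair.WF := by
  simp [findPair, WF, WF_forLt, writes, writes_forLt]

theorem prelude_spec {σ : State} {q r : ℕ} (h0 : σ 0 0 = q) (h1 : σ 1 0 = r) (h5 : σ 5 0 = q)
    (h29 : σ 29 0 = 0) (h41 : ∀ c, σ 41 c = 0) :
    prelude.run σ 6 0 = q ∧ prelude.run σ 7 0 = r + 1 ∧
      (∀ u < q, prelude.run σ 8 u = u * q) ∧ prelude.run σ 29 0 = q * q ∧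
      ∀ c, prelude.run σ 41 c ≠ 0 ↔ ∃ u < q, c = u * q + u := by
  rw [prelude, run_seq, run_seq]
  set τ := (set 7 (.const 0) (.add (var 1) (.const 1))).run
    ((set 6 (.const 0) (var 0)).run σ) with hτ
  have e6 : τ 6 0 = q := by simp [hτ, run, Expr.eval, eval_var, write_apply, h0]
  have e7 : τ 7 0 = r + 1 := by simp [hτ, run, Expr.eval, eval_var, write_apply, h1]
  have he : ∀ k, k ≠ 6 → k ≠ 7 → τ k = σ k := fun k h1 h2 => by
    simp [hτ, run, write_apply, h1, h2]
  have hwf := WF_prelude.2.2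
  refine ⟨?_, ?_, ?_⟩
  · rw [run_of_notMem_writes (by simp [writes_forLt, writes]), e6]
  · rw [run_of_notMem_writes (by simp [writes_forLt, writes]), e7]
  refine forLt_rule hwf (by simp [writes]) e6 (by rw [he 5 (by omega) (by omega), h5])
    (fun i ρ => (∀ u < i, ρ 8 u = u * q) ∧ ρ 29 0 = i * q ∧
      ∀ c, ρ 41 c ≠ 0 ↔ ∃ u < i, c = u * q + u)
    (fun i ρ v h => by simpa [write_apply] using h) ?_ ?_
  · simp [he, h29, h41]
  rintro i hi ρ hρ hρi ⟨h8, h29, h41⟩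
  simp only [writes, List.mem_cons, List.mem_append, List.not_mem_nil, or_false] at hρ
  have e6' : ρ 6 0 = q := by rw [hρ 6 (by omega), e6]
  simp only [run, Expr.eval, eval_var, write_apply, hρi, h29, e6', reduceIte, Nat.reduceEqDiff,
    Function.update_self]
  refine ⟨fun u hu => ?_, by ring, fun c => ?_⟩
  · rcases Nat.lt_succ_iff_lt_or_eq.1 hu with hu | rfl
    · rw [Function.update_of_ne hu.ne, h8 u hu]
    · rw [Function.update_self]
  · rw [Function.update_apply]
    split
    · next hc => exact ⟨fun _ => ⟨i, by omega, hc⟩, fun _ => one_ne_zero⟩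
    · next hc =>
      rw [h41]
      constructor
      · rintro ⟨u, hu, h⟩
        exact ⟨u, by omega, h⟩
      · rintro ⟨u, hu, h⟩
        rcases Nat.lt_succ_iff_lt_or_eq.1 hu with hu | rfl
        · exact ⟨u, hu, h⟩
        · exact absurd h hc

/-- A loop that stores its loop variable whenever a condition holds ends with a solution of this
condition, if there is one. -/
theorem forLt_search {x j y : ℕ} {P : LProg} (hP : (forLt x j P).WF) (hj : j ∉ x :: P.writes)
    {σ : State} {n : ℕ} (hσ : σ j 0 = n) (hn : n ≤ σ 5 0) (hy : y ≠ x) (c : ℕ → Prop)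
    (hs : ∀ i < n, ∀ τ, (∀ k, k ∉ x :: P.writes → τ k = σ k) → τ x 0 = i →
      (c i → P.run τ y 0 = i) ∧ (¬ c i → P.run τ y 0 = τ y 0))
    (hex : ∃ i < n, c i) : (forLt x j P).run σ y 0 < n ∧ c ((forLt x j P).run σ y 0) := by
  refine forLt_rule hP hj hσ hn
    (fun i τ => (∃ i' < i, c i') → τ y 0 < i ∧ c (τ y 0))
    (fun i τ v h => by rwa [write_apply_of_ne hy]) (by simp) ?_ hex
  intro i hi τ hτ hτi hI hex
  obtain ⟨h1, h2⟩ := hs i hi τ hτ hτi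
  by_cases hc : c i
  · rw [h1 hc]
    exact ⟨by omega, hc⟩
  · rw [h2 hc]
    obtain ⟨i', hi', hci'⟩ := hex
    rcases Nat.lt_succ_iff_lt_or_eq.1 hi' with hi' | rfl
    · obtain ⟨h3, h4⟩ := hI ⟨i', hi', hci'⟩
      exact ⟨by omega, h4⟩
    · exact absurd hci' hc

end LProg

/-- The memory holds the tables of the field operations. -/
structure Tables {F : Type*} [Field F] {q : ℕ} (e : F ≃ Fin q) (σ : State) : Prop where
  add : ∀ x y : F, σ 2 ((e x : ℕ) * q + e y) = e (x + y)
  mul : ∀ x y : F, σ 3 ((e x : ℕ) * q + e y) = e (x * y)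

/-- The memory holds the numbers of the elements `0`, `1` and `-1`. -/
structure Units {F : Type*} [Field F] {q : ℕ} (e : F ≃ Fin q) (σ : State) : Prop where
  zero : σ 9 0 = e 0
  one : σ 10 0 = e 1
  neg_one : σ 11 0 = e (-1)

theorem val_inj {F : Type*} {q : ℕ} {e : F ≃ Fin q} {x y : F} : (e x : ℕ) = e y ↔ x = y := by
  rw [Fin.val_inj, e.injective.eq_iff]

section Field

variable {F : Type*} [Field F] {q w : ℕ} {e : F ≃ Fin q} {σ : State}

theorem elt_val (x : F) : elt e (e x) = x := by
  simp [elt]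

theorem val_elt {i : ℕ} (hi : i < q) : (e (elt e i) : ℕ) = i := by
  simp [elt, hi]

theorem Tables.congr {τ : State} (h : Tables e σ) (h2 : τ 2 = σ 2) (h3 : τ 3 = σ 3) :
    Tables e τ where
  add := h2 ▸ h.add
  mul := h3 ▸ h.mul

theorem eval_fadd (hc : Consts q w σ) (ht : Tables e σ) {a b : Expr} {x y : F}
    (ha : a.eval σ = e x) (hb : b.eval σ = e y) : (fadd a b).eval σ = e (x + y) := by
  simp only [fadd, Expr.eval, eval_pair, ha, hb, hc.table _ (e x).2, ht.add]

theorem eval_fmul (hc : Consts q w σ) (ht : Tables e σ) {a b : Expr} {x y : F}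
    (ha : a.eval σ = e x) (hb : b.eval σ = e y) : (fmul a b).eval σ = e (x * y) := by
  simp only [fmul, Expr.eval, eval_pair, ha, hb, hc.table _ (e x).2, ht.mul]

theorem exists_eq_val {i : ℕ} (hi : i < q) : ∃ x : F, i = e x := ⟨elt e i, (val_elt hi).symm⟩

namespace LProg

theorem findConsts_spec (hc : Consts q w σ) (ht : Tables e σ) : Units e (findConsts.run σ) := by
  obtain ⟨hwf1, hwf2, hwf3⟩ := WF_findConsts
  set τ := (forLt 20 6 <| ite (diff (fadd (var 20) (var 20)) (var 20)) skip
      (set 9 (.const 0) (var 20))).run σ with hτ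
  set ρ := (forLt 20 6 <| ite (diff (fmul (var 20) (var 20)) (var 20)) skip
      (ite (diff (var 20) (var 9)) (set 10 (.const 0) (var 20)) skip)).run τ with hρ
  have hτe : ∀ k, k ≠ 20 → k ≠ 9 → τ k = σ k := fun k h1 h2 =>
    run_of_notMem_writes (by simp [writes, writes_forLt, *])
  have hρe : ∀ k, k ≠ 20 → k ≠ 10 → ρ k = τ k := fun k h1 h2 =>
    run_of_notMem_writes (by simp [writes, writes_forLt, *])
  have hcτ : Consts q w τ := hc.congr fun k h1 h2 => hτe k (by omega) (by omega)
  have htτ : Tables e τ := ht.congr (hτe 2 (by omega) (by omega)) (hτe 3 (by omega) (by omega))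
  have hcρ : Consts q w ρ := hcτ.congr fun k h1 h2 => hρe k (by omega) (by omega)
  have htρ : Tables e ρ := htτ.congr (hρe 2 (by omega) (by omega)) (hρe 3 (by omega) (by omega))
  have hqq : q ≤ q * q := Nat.le_mul_self q
  have h9 : τ 9 0 = e 0 := by
    refine (forLt_search hwf1 (by simp [writes]) hc.points (by rwa [hc.bound]) (by omega)
      (fun i => i = e 0) (fun i hi ν hν hνi => ?_) ⟨e 0, (e 0).2, rfl⟩).2
    obtain ⟨x, rfl⟩ := exists_eq_val (e := e) hi
    simp only [writes, List.mem_cons, List.mem_append, List.not_mem_nil, or_false, false_or] at hν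
    have hcν : Consts q w ν := hc.congr fun k h1 h2 => hν k (by omega)
    have htν : Tables e ν := ht.congr (hν 2 (by omega)) (hν 3 (by omega))
    have h20 : (var 20).eval ν = e x := hνi
    have hcond : (diff (fadd (var 20) (var 20)) (var 20)).eval ν ≠ 0 ↔ x ≠ 0 := by
      rw [eval_diff, eval_fadd hcν htν h20 h20, eval_var, hνi, ne_eq, val_inj, add_eq_left]
    rw [run_ite_apply, val_inj]
    exact ⟨fun h => by rw [if_neg (by simpa [hcond] using h)]; simp [run, Expr.eval, eval_var, hνi],
      fun h => by rw [if_pos (hcond.2 h)]; rfl⟩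
  have h10 : ρ 10 0 = e 1 := by
    refine (forLt_search hwf2 (by simp [writes]) hcτ.points (by rwa [hcτ.bound]) (by omega)
      (fun i => i = e 1) (fun i hi ν hν hνi => ?_) ⟨e 1, (e 1).2, rfl⟩).2
    obtain ⟨x, rfl⟩ := exists_eq_val (e := e) hi
    simp only [writes, List.mem_cons, List.mem_append, List.not_mem_nil, or_false, false_or] at hν
    have hcν : Consts q w ν := hcτ.congr fun k h1 h2 => hν k (by omega)
    have htν : Tables e ν := htτ.congr (hν 2 (by omega)) (hν 3 (by omega))
    have h20 : (var 20).eval ν = e x := hνi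
    have hcond : (diff (fmul (var 20) (var 20)) (var 20)).eval ν ≠ 0 ↔ ¬ (x = 1 ∨ x = 0) := by
      rw [eval_diff, eval_fmul hcν htν h20 h20, eval_var, hνi, ne_eq, val_inj, mul_right_eq_self₀]
    have hcond' : (diff (var 20) (var 9)).eval ν ≠ 0 ↔ x ≠ 0 := by
      rw [eval_diff, eval_var, eval_var, hνi, hν 9 (by omega), h9, ne_eq, val_inj]
    rw [run_ite_apply, val_inj]
    constructor
    · rintro rfl
      rw [if_neg (by simp [hcond]), run_ite_apply, if_pos (hcond'.2 one_ne_zero)]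
      simp [run, Expr.eval, eval_var, hνi]
    · intro h
      by_cases h0 : x = 0
      · rw [if_neg (by simp [hcond, h0]), run_ite_apply, if_neg (by simpa [hcond'] using h0)]
        rfl
      · rw [if_pos (by simp [hcond, h, h0])]
        rfl
  have h11 : findConsts.run σ 11 0 = e (-1) := by
    refine (forLt_search hwf3 (by simp [writes]) hcρ.points (by rwa [hcρ.bound]) (by omega)
      (fun i => i = e (-1)) (fun i hi ν hν hνi => ?_) ⟨e (-1), (e (-1)).2, rfl⟩).2
    obtain ⟨x, rfl⟩ := exists_eq_val (e := e) hi
    simp only [writes, List.mem_cons, List.mem_append, List.not_mem_nil, or_false, false_or] at hν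
    have hcν : Consts q w ν := hcρ.congr fun k h1 h2 => hν k (by omega)
    have htν : Tables e ν := htρ.congr (hν 2 (by omega)) (hν 3 (by omega))
    have h10ν : (var 10).eval ν = e 1 := by rw [eval_var, hν 10 (by omega), h10]
    have h20 : (var 20).eval ν = e x := hνi
    have hcond : (diff (fadd (var 20) (var 10)) (var 9)).eval ν ≠ 0 ↔ x ≠ -1 := by
      rw [eval_diff, eval_fadd hcν htν h20 h10ν, eval_var, hν 9 (by omega),
        hρe 9 (by omega) (by omega), h9, ne_eq, val_inj, ← eq_neg_iff_add_eq_zero]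
    rw [run_ite_apply, val_inj]
    exact ⟨fun h => by rw [if_neg (by simpa [hcond] using h)]; simp [run, Expr.eval, eval_var, hνi],
      fun h => by rw [if_pos (hcond.2 h)]; rfl⟩
  have he : ∀ k, k ≠ 20 → k ≠ 11 → findConsts.run σ k = ρ k := fun k h1 h2 =>
    run_of_notMem_writes (P := forLt 20 6 <| ite (diff (fadd (var 20) (var 10)) (var 9)) skip
      (set 11 (.const 0) (var 20))) (by simp [writes, writes_forLt, *])
  exact ⟨by rw [he 9 (by omega) (by omega), hρe 9 (by omega) (by omega), h9],
    by rw [he 10 (by omega) (by omega), h10], h11⟩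

theorem evalPoly_spec {r : ℕ} (hc : Consts q w σ) (ht : Tables e σ) (hu : Units e σ)
    (h1 : σ 1 0 = r) (hr : r ≤ q * q) (hL : ∀ i < r, σ 12 i < q) (x : F) :
    evalPoly.run σ 26 (e x) = e (∏ i ∈ Finset.range r, (x - elt e (σ 12 i))) := by
  have hwf := WF_evalPoly
  suffices h : ∀ x : F, (e x : ℕ) < q →
      evalPoly.run σ 26 (e x) = e (∏ i ∈ Finset.range r, (x - elt e (σ 12 i))) from h x (e x).2
  refine forLt_rule hwf (by simp [writes, writes_forLt]) hc.points
    (by rw [hc.bound]; exact Nat.le_mul_self q)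
    (fun i τ => ∀ x : F, (e x : ℕ) < i →
      τ 26 (e x) = e (∏ i ∈ Finset.range r, (x - elt e (σ 12 i))))
    (fun i τ v h => by simpa [write_apply] using h) (by simp) ?_
  intro i hi τ hτ hτi hI
  obtain ⟨x, rfl⟩ := exists_eq_val (e := e) hi
  simp only [writes, writes_forLt, List.mem_cons, List.mem_append, List.not_mem_nil, or_false] at hτ
  rw [run_seq]
  set ρ := (set 26 (var 20) (var 10)).run τ with hρ
  have hρe : ∀ k, k ≠ 26 → ρ k = τ k := fun k hk => by simp [hρ, run, write_apply, hk]
  have key := forLt_rule (x := 21) (j := 1)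
    (P := set 26 (var 20) (fmul (.get 26 (var 20))
      (fadd (var 20) (fmul (var 11) (.get 12 (var 21)))))) (by simp [WF_forLt, WF, writes])
    (by simp [writes]) (σ := ρ) (n := r) (by rw [hρe 1 (by omega), hτ 1 (by omega), h1])
    (by rw [hρe 5 (by omega), hτ 5 (by omega), hc.bound]; exact hr)
    (fun j ν => ν 26 (e x) = e (∏ i ∈ Finset.range j, (x - elt e (σ 12 i))) ∧
      ∀ c : ℕ, c ≠ e x → ν 26 c = τ 26 c)
    (fun j ν v h => by simpa [write_apply] using h)
    (by
      have e10 : τ 10 0 = e 1 := by rw [hτ 10 (by omega), hu.one]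
      simp only [hρ, run, eval_var, hτi, write_apply_self, Function.update_self, e10,
        Finset.range_zero, Finset.prod_empty, true_and]
      exact fun c hc => Function.update_of_ne hc _ _)
    (fun j hj ν hν hνj hJ => by
      simp only [writes, List.mem_cons, List.not_mem_nil, or_false] at hν
      have he : ∀ k, k ≠ 21 → k ≠ 26 → k ≠ 20 → ν k = σ k := fun k h1 h2 h3 => by
        rw [hν k (by omega), hρe k h2, hτ k (by omega)]
      have hcν : Consts q w ν := hc.congr fun k h1 h2 => he k (by omega) (by omega) (by omega)
      have htν : Tables e ν := ht.congr (he 2 (by omega) (by omega) (by omega))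
        (he 3 (by omega) (by omega) (by omega))
      have h20 : (var 20).eval ν = e x := by
        rw [eval_var, hν 20 (by omega), hρe 20 (by omega), hτi]
      have h11 : (var 11).eval ν = e (-1) := by
        rw [eval_var, he 11 (by omega) (by omega) (by omega), hu.neg_one]
      have h12 : (Expr.get 12 (var 21)).eval ν = e (elt e (σ 12 j)) := by
        simp only [Expr.eval, eval_var]
        rw [hνj, he 12 (by omega) (by omega) (by omega), val_elt (hL j hj)]
      have h26 : (Expr.get 26 (var 20)).eval ν =
          e (∏ i ∈ Finset.range j, (x - elt e (σ 12 i))) := by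
        simp only [Expr.eval, h20, hJ.1]
      simp only [run, h20, eval_fmul hcν htν h26 (eval_fadd hcν htν h20
        (eval_fmul hcν htν h11 h12)), write_apply_self, Function.update_self]
      refine ⟨?_, fun c hc => ?_⟩
      · rw [Finset.prod_range_succ, neg_one_mul, ← sub_eq_add_neg]
      · rw [Function.update_of_ne hc, hJ.2 c hc])
  intro y hy
  by_cases hyx : y = x
  · rw [hyx, key.1]
  · have hne : (e y : ℕ) ≠ e x := by rwa [ne_eq, val_inj]
    rw [key.2 _ hne]
    exact hI y (by omega)

theorem findPair_spec (hc : Consts q w σ) (hu : Units e σ) (g : F → F)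
    (hg : ∀ x : F, σ 26 (e x) = e (g x)) (hex : ∃ x y, x ≠ y ∧ g x = g y ∧ g x ≠ 0) :
    ∃ x y, x ≠ y ∧ g x = g y ∧ g x ≠ 0 ∧ findPair.run σ 27 0 = e x ∧ findPair.run σ 28 0 = e y := by
  have hwf := WF_findPair
  have hwf' : _ ∧ _ ∧ _ := WF_forLt.1 hwf
  let G : State → Prop := fun τ => ∃ x y, x ≠ y ∧ g x = g y ∧ g x ≠ 0 ∧ τ 27 0 = e x ∧ τ 28 0 = e y
  have hqq : q ≤ q * q := Nat.le_mul_self q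
  have main : G (findPair.run σ) ∨ ∀ x y : F, (e x : ℕ) < q → x ≠ y → g x = g y → g x = 0 := by
    refine forLt_rule hwf (by simp [writes, writes_forLt]) hc.points (by rwa [hc.bound])
      (fun i τ => G τ ∨ ∀ x y : F, (e x : ℕ) < i → x ≠ y → g x = g y → g x = 0)
      (fun i τ v h => by simpa [G, write_apply] using h) (by simp) ?_
    intro i hi τ hτ hτi hI
    obtain ⟨x, rfl⟩ := exists_eq_val (e := e) hi
    simp only [writes, writes_forLt, List.mem_cons, List.mem_append, List.not_mem_nil, or_false,
      false_or] at hτ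
    have inner := forLt_rule hwf'.2.2 (by simp [writes]) (σ := τ) (n := q)
      (by rw [hτ 6 (by omega), hc.points]) (by rwa [hτ 5 (by omega), hc.bound])
      (fun j ν => G ν ∨ ((∀ x' y : F, (e x' : ℕ) < e x → x' ≠ y → g x' = g y → g x' = 0) ∧
        ∀ y : F, (e y : ℕ) < j → x ≠ y → g x = g y → g x = 0))
      (fun j ν v h => by simpa [G, write_apply] using h) (by simpa using hI)
      (fun j hj ν hν hνj hJ => by
        obtain ⟨y, rfl⟩ := exists_eq_val (e := e) hj
        simp only [writes, List.mem_cons, List.mem_append, List.not_mem_nil, or_false,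
          false_or] at hν
        have h20 : ν 20 0 = e x := by rw [hν 20 (by omega), hτi]
        have h26 : ν 26 = σ 26 := by rw [hν 26 (by omega), hτ 26 (by omega)]
        have h9 : ν 9 0 = e 0 := by rw [hν 9 (by omega), hτ 9 (by omega), hu.zero]
        have c1 : (diff (var 20) (var 21)).eval ν ≠ 0 ↔ x ≠ y := by
          rw [eval_diff, eval_var, eval_var, h20, hνj, ne_eq, val_inj]
        have c2 : (diff (.get 26 (var 20)) (var 9)).eval ν ≠ 0 ↔ g x ≠ 0 := by
          rw [eval_diff, Expr.eval, eval_var, eval_var, h20, h26, h9, hg, ne_eq, val_inj]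
        have c3 : (diff (.get 26 (var 20)) (.get 26 (var 21))).eval ν ≠ 0 ↔ g x ≠ g y := by
          rw [eval_diff, Expr.eval, Expr.eval, eval_var, eval_var, h20, hνj, h26, hg, hg, ne_eq,
            val_inj]
        have hnext : (x ≠ y → g x = g y → g x = 0) → G ν ∨
            ((∀ x' y : F, (e x' : ℕ) < e x → x' ≠ y → g x' = g y → g x' = 0) ∧
            ∀ y' : F, (e y' : ℕ) < e y + 1 → x ≠ y' → g x = g y' → g x = 0) := by
          intro h
          refine hJ.imp_right fun hJ => ⟨hJ.1, fun y' hy' => ?_⟩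
          rcases Nat.lt_succ_iff_lt_or_eq.1 hy' with hy' | hy'
          · exact hJ.2 y' hy'
          · rwa [val_inj.1 hy']
        rw [run]
        split
        swap
        · next h => exact hnext fun h' => absurd (c1.2 h') h
        next h1 =>
        rw [run]
        split
        swap
        · next h => exact hnext fun _ _ => by simpa [c2] using h
        next h2 =>
        rw [run]
        split
        · next h => exact hnext fun _ h' => absurd h' (c3.1 h)
        next h3 =>
        refine .inl ⟨x, y, c1.1 h1, by simpa [c3] using h3, c2.1 h2, ?_, ?_⟩ <;>
          simp [run, Expr.eval, eval_var, write_apply, h20, hνj])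
    refine inner.imp_right fun h x' y hx' => ?_
    rcases Nat.lt_succ_iff_lt_or_eq.1 hx' with hx' | hx'
    · exact h.1 x' y hx'
    · rw [val_inj.1 hx']
      exact h.2 y (e y).2
  refine main.resolve_right fun h => ?_
  obtain ⟨x, y, hxy, hgxy, hg0⟩ := hex
  exact hg0 (h x y (e x).2 hxy hgxy)

end LProg
end Field

/-! ### The construction of the block system -/

namespace LProg

/-- Construct the first two blocks. The second one starts with two points at which the polynomial
vanishing on the first `r` points of the first block has the same nonzero value. -/
def start (n : ℕ) : LProg :=
  seq findConsts <| seq (set 24 (.const 0) (.const 2)) <| seq (attempt n) <| seq evalPoly <|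
    seq findPair <| seq (set 18 (.const 0) (var 27)) <| seq (set 18 (.const 1) (var 28)) <|
      seq (set 19 (.const 0) (.const 2)) <| attempt n

/-- For the degree limits `2, 3, …, q² + 1`, make `q²` attempts each to find a new block. -/
def rounds (n : ℕ) : LProg :=
  forLt 31 5 <| seq (set 24 (.const 0) (.add (var 31) (.const 2))) <| forLt 32 5 <| attempt n

theorem WF_start (n : ℕ) : (start n).WF := by
  simp [start, WF, WF_findConsts, WF_attempt, WF_evalPoly, WF_findPair]

theorem WF_rounds (n : ℕ) : (rounds n).WF := by
  have h := fun k hk hk' => notMem_writes_attempt (n := n) (k := k) hk hk'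
  simp [rounds, WF, WF_forLt, writes_forLt, writes, WF_attempt, h 31, h 32]

theorem notMem_writes_rounds {n k : ℕ} (hk : k < 12 ∨ 24 < k ∧ k < 31 ∨ 32 < k ∧ k < 41)
    (hk' : k ≠ 25) : k ∉ (rounds n).writes := by
  have h := notMem_writes_attempt (n := n) (k := k) (by omega) hk'
  simp [rounds, writes_forLt, writes, h]
  omega

theorem notMem_writes_start {n k : ℕ} (hk : k < 9 ∨ 28 < k ∧ k < 41) :
    k ∉ (start n).writes := by
  have h := notMem_writes_attempt (n := n) (k := k) (by omega) (by omega)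
  simp [start, findConsts, evalPoly, findPair, writes_forLt, writes, h]
  omega

/-- The first two blocks are found, because there are many points of degree less than `2`, and the
two points with which the second block starts are not both in the first block. -/
theorem start_spec {F : Type*} [Field F] [Fintype F] [DecidableEq F] {q r n : ℕ} {e : F ≃ Fin q}
    {σ : State} (hc : Consts q (r + 1) σ) (ht : Tables e σ) (h1 : σ 1 0 = r)
    (h : Holds q (r + 1) n σ 0) (h19 : σ 19 0 = 0) (hr : 2 ≤ r)
    (hq : 2 * (r + 1) * (4 * (r + 1)) ^ (n + 1) ≤ q) :
    Units e ((start n).run σ) ∧ Holds q (r + 1) n ((start n).run σ) 2 ∧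
      (∀ v, deg ((start n).run σ 12) (2 * (r + 1)) v ≤ 2) ∧ (start n).run σ 19 0 = 0 ∧
      ∏ i ∈ Finset.range r, (elt e ((start n).run σ 12 (r + 1)) - elt e ((start n).run σ 12 i)) =
        ∏ i ∈ Finset.range r, (elt e ((start n).run σ 12 (r + 2)) - elt e ((start n).run σ 12 i)) ∧
      ∏ i ∈ Finset.range r, (elt e ((start n).run σ 12 (r + 1)) - elt e ((start n).run σ 12 i))
        ≠ 0 := by
  obtain ⟨hq1, hq2, hq3⟩ := two_mul_lt hq
  have hqq : q ≤ q * q := Nat.le_mul_self q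
  have hrq : r + 1 ≤ q * q := by omega
  -- The first attempt finds a block, as all points have degree `0`.
  set σ₁ := (set 24 (.const 0) (.const 2)).run (findConsts.run σ) with hσ₁
  have e₁ : ∀ k, k ≠ 24 → k ≠ 20 → k ≠ 9 → k ≠ 10 → k ≠ 11 → σ₁ k = σ k :=
      fun k h1 h2 h3 h4 h5 => by
    rw [hσ₁, run_of_notMem_writes (by simpa [writes] using h1),
      run_of_notMem_writes (by simp [findConsts, writes_forLt, writes, *])]
  have hc₁ : Consts q (r + 1) σ₁ := hc.congr fun k _ _ => e₁ k (by omega) (by omega) (by omega)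
    (by omega) (by omega)
  have ht₁ : Tables e σ₁ := ht.congr (e₁ 2 (by omega) (by omega) (by omega) (by omega) (by omega))
    (e₁ 3 (by omega) (by omega) (by omega) (by omega) (by omega))
  have hu₁ : Units e σ₁ := by
    have := findConsts_spec hc ht
    exact ⟨by simpa [hσ₁, run, write_apply] using this.zero,
      by simpa [hσ₁, run, write_apply] using this.one,
      by simpa [hσ₁, run, write_apply] using this.neg_one⟩
  have hH₁ : Holds q (r + 1) n σ₁ 0 := by
    have e : ∀ k, 12 ≤ k → k ≤ 17 ∨ 41 ≤ k → σ₁ k = σ k := fun k h h' =>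
      e₁ k (by omega) (by omega) (by omega) (by omega) (by omega)
    exact
    { blocks := by rw [e 16 (by omega) (by omega), h.blocks]
      places := by rw [e 17 (by omega) (by omega), h.places]
      le := h.le
      good := by rw [e 12 (by omega) (by omega)]; exact h.good
      degree := by
        rw [e 12 (by omega) (by omega), e 13 (by omega) (by omega)]; exact h.degree
      owner := fun p hp => by omega
      power := fun p hp => by omega
      adj := by rw [e 12 (by omega) (by omega), e 41 (by omega) (by omega)]; exact h.adj
      layer := fun k hk => by
        rw [e 12 (by omega) (by omega), e (41 + k) (by omega) (by omega)]; exact h.layer k hk }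
  obtain ⟨m₁, hH₂, -, h19₂, -, hm₁⟩ := attempt_spec (D := 2) hc₁ hrq hH₁
    (by simp [hσ₁, run, Expr.eval]) (by simp [deg])
    (by rw [e₁ 19 (by omega) (by omega) (by omega) (by omega) (by omega), h19]; omega)
    (by rw [e₁ 19 (by omega) (by omega) (by omega) (by omega) (by omega), h19]; simp)
    (by rw [e₁ 19 (by omega) (by omega) (by omega) (by omega) (by omega), h19]; simp)
    (by rw [e₁ 19 (by omega) (by omega) (by omega) (by omega) (by omega), h19]; simp)
  obtain rfl : m₁ = 1 := by
    rcases hm₁ with ⟨-, hm | hm⟩ | ⟨hm, -⟩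
    · omega
    · omega
    · exact hm
  set σ₂ := (attempt n).run σ₁ with hσ₂
  have e₂ : ∀ k, k < 12 ∨ 23 < k ∧ k < 41 → k ≠ 25 → σ₂ k = σ₁ k := fun k h1 h2 =>
    run_of_notMem_writes (notMem_writes_attempt h1 h2)
  have hc₂ : Consts q (r + 1) σ₂ := hc₁.congr fun k _ _ => e₂ k (by omega) (by omega)
  have ht₂ : Tables e σ₂ := ht₁.congr (e₂ 2 (by omega) (by omega)) (e₂ 3 (by omega) (by omega))
  have hu₂ : Units e σ₂ := by
    refine ⟨?_, ?_, ?_⟩ <;> rw [e₂ _ (by omega) (by omega)]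
    exacts [hu₁.zero, hu₁.one, hu₁.neg_one]
  have h1₂ : σ₂ 1 0 = r := by
    rw [e₂ 1 (by omega) (by omega), e₁ 1 (by omega) (by omega) (by omega) (by omega) (by omega), h1]
  -- The polynomial vanishing on `r` points of this block takes a nonzero value twice.
  set L := σ₂ 12 with hL
  have hLlt : ∀ i < r + 1, L i < q := fun i hi => hH₂.good.lt i (by omega)
  have hLinj : ∀ i < r + 1, ∀ j < r + 1, L i = L j → i = j := fun i hi j hj hij =>
    hH₂.good.injOn (b := 0) (by omega) hi hj (by simpa using hij)
  set g : F → F := fun x => ∏ i ∈ Finset.range r, (x - elt e (L i)) with hg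
  have hginj : Set.InjOn (fun i => elt e (L i)) (Finset.range r : Set ℕ) := by
    intro i hi j hj hij
    simp only [Finset.coe_range, Set.mem_Iio] at hi hj
    have := congrArg (fun x => (e x : ℕ)) hij
    simp only [val_elt (hLlt i (by omega)), val_elt (hLlt j (by omega))] at this
    exact hLinj i (by omega) j (by omega) this
  set B := (Finset.range r).image fun i => elt e (L i) with hB
  have hBcard : B.card = r := by rw [hB, Finset.card_image_of_injOn hginj, Finset.card_range]
  have hgB : ∀ x, ∏ b ∈ B, (x - b) = g x := fun x => by
    rw [hB, Finset.prod_image hginj]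
  have hcard : Fintype.card F = q := by rw [Fintype.card_congr e, Fintype.card_fin]
  set σ₃ := evalPoly.run σ₂ with hσ₃
  have e₃ : ∀ k, k ≠ 20 → k ≠ 21 → k ≠ 26 → σ₃ k = σ₂ k := fun k h1 h2 h3 =>
    run_of_notMem_writes (by simp [evalPoly, writes_forLt, writes, *])
  obtain ⟨x, y, hxy, hgxy, hgx, h27, h28⟩ := findPair_spec (e := e) (σ := σ₃)
    (hc₂.congr fun k _ _ => e₃ k (by omega) (by omega) (by omega))
    (by
      refine ⟨?_, ?_, ?_⟩ <;> rw [e₃ _ (by omega) (by omega) (by omega)]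
      exacts [hu₂.zero, hu₂.one, hu₂.neg_one]) g
    (fun x => evalPoly_spec hc₂ ht₂ hu₂ h1₂ (by omega) (fun i hi => hLlt i (by omega)) x)
    (by
      obtain ⟨x, y, h1, h2, h3⟩ := exists_ne_prod_sub_eq B (by omega)
        (by rw [hBcard, hcard]; exact hq3)
      rw [hgB, hgB] at h2
      rw [hgB] at h3
      exact ⟨x, y, h1, h2, h3⟩)
  set σ₄ := findPair.run σ₃ with hσ₄
  have e₄ : ∀ k, k ≠ 20 → k ≠ 21 → k ≠ 27 → k ≠ 28 → σ₄ k = σ₃ k := fun k h1 h2 h3 h4 =>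
    run_of_notMem_writes (by simp [findPair, writes_forLt, writes, *])
  set σ₅ := (set 19 (.const 0) (.const 2)).run ((set 18 (.const 1) (var 28)).run
    ((set 18 (.const 0) (var 27)).run σ₄)) with hσ₅
  have e₅' : ∀ k, k ≠ 18 → k ≠ 19 → σ₅ k = σ₄ k := fun k h1 h2 => by
    simp [run, write_apply, *]
  have e₅ : ∀ k, k ≠ 18 → k ≠ 19 → k ≠ 20 → k ≠ 21 → k ≠ 27 → k ≠ 28 → k ≠ 26 → σ₅ k = σ₂ k :=
    fun k h1 h2 h3 h4 h5 h6 h7 => by rw [e₅' k h1 h2, e₄ k h3 h4 h5 h6, e₃ k h3 h4 h7]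
  have h190 : σ₅ 19 0 = 2 := by simp [hσ₅, run, Expr.eval]
  have h180 : σ₅ 18 0 = e x := by
    simp [hσ₅, run, Expr.eval, eval_var, write_apply, h27]
  have h181 : σ₅ 18 1 = e y := by
    simp [hσ₅, run, Expr.eval, eval_var, write_apply, h28]
  have hH₅ : Holds q (r + 1) n σ₅ 1 := hH₂.congr
    (fun k _ _ => e₅ k (by omega) (by omega) (by omega) (by omega) (by omega) (by omega) (by omega))
    (fun k _ => e₅ _ (by omega) (by omega) (by omega) (by omega) (by omega) (by omega) (by omega))
  have h12₅ : σ₅ 12 = L :=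
    e₅ 12 (by omega) (by omega) (by omega) (by omega) (by omega) (by omega) (by omega)
  have hdeg1 : ∀ v, deg L (1 * (r + 1)) v ≤ 1 := fun v => by
    have := (deg_add_le (L := L) (n := 0) (w := r + 1) (fun i j hij hj h => by
      rw [zero_add, zero_add] at h
      exact hij.ne (hLinj i (by omega) j hj h)) v).1
    simpa [deg] using this
  -- At most one of the two points lies in the first block, so they are not connected.
  have hnotin : ∀ z : F, g z ≠ 0 → (e z : ℕ) ≠ L r → ∀ i < r + 1, L i ≠ e z := by
    intro z hz hzr i hi hiz
    rcases Nat.lt_succ_iff_lt_or_eq.1 hi with hi | rfl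
    · refine hz (Finset.prod_eq_zero (Finset.mem_range.2 hi) ?_)
      rw [hiz, elt_val, sub_self]
    · exact hzr hiz.symm
  have hfar : ¬ Reach L (r + 1) 1 (n + 1) (e x) (e y) := by
    intro hR
    have hne : (e x : ℕ) ≠ e y := fun h => hxy (val_inj.1 h)
    by_cases hx : (e x : ℕ) = L r
    · refine hne (hR.eq_of_forall_not_adj_right ?_)
      rintro z ⟨b, hb, i, hi, j, hj, -, h2⟩
      obtain rfl : b = 0 := by omega
      rw [zero_mul, zero_add] at h2
      exact hnotin y (hgxy ▸ hgx) (fun h => hne (hx.trans h.symm)) j hj h2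
    · refine hne (hR.eq_of_forall_not_adj_left ?_)
      rintro z ⟨b, hb, i, hi, j, hj, h1, -⟩
      obtain rfl : b = 0 := by omega
      rw [zero_mul, zero_add] at h1
      exact hnotin x hgx hx i hi h1
  obtain ⟨m₂, hH₆, hdeg₆, h19₆, hold, hm₂⟩ := attempt_spec (D := 2)
    (hc₂.congr fun k _ _ => e₅ k (by omega) (by omega) (by omega) (by omega) (by omega) (by omega)
      (by omega)) hrq hH₅
    (by
      rw [e₅ 24 (by omega) (by omega) (by omega) (by omega) (by omega) (by omega) (by omega),
        e₂ 24 (by omega) (by omega)]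
      simp [hσ₁, run, Expr.eval])
    (by rw [h12₅]; exact fun v => (hdeg1 v).trans (by omega)) (by rw [h190]; omega)
    (by
      rw [h190]
      intro j hj
      interval_cases j
      · rw [h180]; exact (e x).2
      · rw [h181]; exact (e y).2)
    (by rw [h12₅]; exact fun j _ => (hdeg1 _).trans_lt (by omega))
    (by
      rw [h190, h12₅]
      intro i j hij hj
      obtain ⟨rfl, rfl⟩ : i = 0 ∧ j = 1 := by omega
      rw [h180, h181]
      exact hfar)
  have hsize : (q * q < 1 * (r + 1) + (r + 1)) → False := fun h => by
    have : q * 2 ≤ q * q := Nat.mul_le_mul_left q (by omega)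
    omega
  obtain ⟨rfl, hnew⟩ : m₂ = 2 ∧ ∀ i < 2, (attempt n).run σ₅ 12 (1 * (r + 1) + i) = σ₅ 18 i := by
    rcases hm₂ with ⟨-, hm | hm⟩ | hm
    · exact (hsize hm).elim
    · omega
    · rwa [h190] at hm
  have hx' : (attempt n).run σ₅ 12 (r + 1) = e x := by
    simpa [h180] using hnew 0 (by omega)
  have hy' : (attempt n).run σ₅ 12 (r + 2) = e y := by
    simpa [h181] using hnew 1 (by omega)
  have hLi : ∀ i ∈ Finset.range r, (attempt n).run σ₅ 12 i = L i := fun i hi => by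
    rw [hold i (by rw [Finset.mem_range] at hi; omega), h12₅]
  have hprod : ∀ z : F,
      ∏ i ∈ Finset.range r, (z - elt e ((attempt n).run σ₅ 12 i)) = g z := fun z =>
    Finset.prod_congr rfl fun i hi => by rw [hLi i hi]
  have hrun : (start n).run σ = (attempt n).run σ₅ := rfl
  rw [hrun, hx', hy', elt_val, elt_val, hprod, hprod]
  refine ⟨⟨?_, ?_, ?_⟩, hH₆, hdeg₆, h19₆, hgxy, hgx⟩ <;>
    rw [run_of_notMem_writes (notMem_writes_attempt (by omega) (by omega)),
      e₅ _ (by omega) (by omega) (by omega) (by omega) (by omega) (by omega) (by omega)]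
  exacts [hu₂.zero, hu₂.one, hu₂.neg_one]

/-- In the round with degree limit `D`, every attempt adds a block unless the number of blocks is
already as large as wanted. -/
theorem rounds_spec {q r n m₀ D₀ : ℕ} {σ : State} (hc : Consts q (r + 1) σ)
    (hrq : r + 1 ≤ q * q) (h : Holds q (r + 1) n σ m₀)
    (hdeg : ∀ v, deg (σ 12) (m₀ * (r + 1)) v ≤ 2) (h19 : σ 19 0 = 0)
    (Long : ℕ → Prop) (hmono : ∀ m m', m ≤ m' → Long m → Long m')
    (hfull : ∀ m, q * q < m * (r + 1) + (r + 1) → Long m) (hD₀ : 2 ≤ D₀) (hD₀q : D₀ ≤ q)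
    (hstuck : ∀ m, D₀ * q ≤ m * (r + 1) + D₀ * (r * (1 + D₀ * (r + 1)) ^ (n + 1)) → Long m) :
    ∃ m, m₀ ≤ m ∧ Holds q (r + 1) n ((rounds n).run σ) m ∧ Long m ∧
      ∀ p < m₀ * (r + 1), (rounds n).run σ 12 p = σ 12 p := by
  have hwf := WF_rounds n
  have hwf' : (forLt 32 5 (attempt n)).WF := (WF_forLt.1 hwf).2.2.2
  have hqq : q ≤ q * q := Nat.le_mul_self q
  let J : ℕ → State → ℕ → Prop := fun D τ m => m₀ ≤ m ∧ Holds q (r + 1) n τ m ∧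
    (∀ v, deg (τ 12) (m * (r + 1)) v ≤ D) ∧ τ 19 0 = 0 ∧ (∀ p < m₀ * (r + 1), τ 12 p = σ 12 p)
  have hJw : ∀ D τ m x v, 24 ≤ x → x < 41 → J D τ m → J D (write τ x 0 v) m := by
    rintro D τ m x v hx hx' ⟨h1, h2, h3, h4, h5⟩
    refine ⟨h1, h2.congr (fun k _ _ => write_apply_of_ne (by omega))
      (fun k _ => write_apply_of_ne (by omega)), ?_, ?_, ?_⟩
    · rwa [write_apply_of_ne (by omega)]
    · rwa [write_apply_of_ne (by omega)]
    · rwa [write_apply_of_ne (by omega)]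
  have main : ∃ m, J (q * q + 2) ((rounds n).run σ) m ∧ (D₀ < q * q + 2 → Long m) := by
    refine forLt_rule hwf ?_ hc.bound (by rw [hc.bound])
      (fun x τ => ∃ m, J (x + 2) τ m ∧ (D₀ < x + 2 → Long m))
      (fun i τ v h => h.imp fun m h => ⟨hJw _ _ _ _ _ (by omega) (by omega) h.1, h.2⟩)
      ⟨m₀, ⟨le_rfl, h, hdeg, h19, fun _ _ => rfl⟩, fun h => by omega⟩ ?_
    · have := notMem_writes_attempt (n := n) (k := 5) (by omega) (by omega)
      simp [writes, writes_forLt, this]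
    rintro x hx τ hτ hτx ⟨m₁, hJ₁, hL₁⟩
    rw [run_seq]
    set τ' := (set 24 (.const 0) (.add (var 31) (.const 2))).run τ with hτ'
    have hfr : ∀ k, k < 12 → τ' k = σ k := fun k hk => by
      rw [hτ', run_of_notMem_writes (by simp [writes]; omega), hτ k]
      have := notMem_writes_attempt (n := n) (k := k) (by omega) (by omega)
      simp [writes, writes_forLt, this]
      omega
    have h24 : τ' 24 0 = x + 2 := by simp [hτ', run, Expr.eval, eval_var, hτx]
    have hJ' : J (x + 2) τ' m₁ := hJw _ _ _ _ _ (by omega) (by omega) hJ₁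
    have inner := forLt_rule hwf' (by
        have := notMem_writes_attempt (n := n) (k := 5) (by omega) (by omega)
        simpa using this) (σ := τ') (n := q * q)
      (by rw [hfr 5 (by omega), hc.bound]) (by rw [hfr 5 (by omega), hc.bound])
      (fun i ρ => ∃ m, J (x + 2) ρ m ∧ (D₀ < x + 2 → Long m) ∧ (D₀ = x + 2 → Long m ∨ i ≤ m))
      (fun i ρ v h => h.imp fun m h => ⟨hJw _ _ _ _ _ (by omega) (by omega) h.1, h.2⟩)
      ⟨m₁, hJ', hL₁, fun _ => .inr (Nat.zero_le _)⟩
      (by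
        rintro i hi ρ hρ hρi ⟨m, ⟨hm, hH, hd, hs, hL⟩, hL1, hL2⟩
        have hρe : ∀ k, k < 12 ∨ k = 24 → ρ k = τ' k := fun k hk => hρ k (by
          have := notMem_writes_attempt (n := n) (k := k) (by omega) (by omega)
          simp [this]
          omega)
        obtain ⟨m', hH', hd', hs', hold, hcase⟩ := attempt_spec (D := x + 2)
          (hc.congr fun k _ _ => by rw [hρe k (by omega), hfr k (by omega)]) hrq hH
          (by rw [hρe 24 (by omega), h24]) hd (by omega) (by simp [hs]) (by simp [hs])
          (by simp [hs])
        have hmm' : m ≤ m' := by rcases hcase with ⟨rfl, -⟩ | ⟨rfl, -⟩ <;> omega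
        refine ⟨m', ⟨by omega, hH', hd', hs', fun p hp => ?_⟩,
          fun h => hmono m m' hmm' (hL1 h), fun h => ?_⟩
        · rw [hold p (hp.trans_le (Nat.mul_le_mul_right _ hm)), hL p hp]
        · rcases hcase with ⟨rfl, hcase | hcase⟩ | ⟨rfl, -⟩
          · exact .inl (hfull _ hcase)
          · exact .inl (hstuck _ (h ▸ hcase))
          · exact (hL2 h).imp (hmono _ _ hmm') (by omega))
    obtain ⟨m, ⟨hm, hH, hd, hs, hL⟩, hL1, hL2⟩ := inner
    refine ⟨m, ⟨hm, hH, fun v => (hd v).trans (by omega), hs, hL⟩, fun h => ?_⟩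
    rcases Nat.lt_succ_iff_lt_or_eq.1 (show D₀ < x + 2 + 1 by omega) with h' | h'
    · exact hL1 h'
    · refine (hL2 h').elim id fun hle => hfull _ ?_
      have : q * q ≤ m * (r + 1) := hle.trans (Nat.le_mul_of_pos_right m (by omega))
      omega
  obtain ⟨m, ⟨hm, hH, -, -, hL⟩, hlong⟩ := main
  exact ⟨m, hm, hH, hlong (by omega), hL⟩

end LProg

/-! ### The output of the matrix -/

namespace LProg

theorem run_ite_of_ne {e : Expr} {P Q : LProg} {σ : State} (h : e.eval σ ≠ 0) :
    (ite e P Q).run σ = P.run σ := if_pos h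

theorem run_ite_of_eq {e : Expr} {P Q : LProg} {σ : State} (h : e.eval σ = 0) :
    (ite e P Q).run σ = Q.run σ := if_neg (not_not.2 h)

/-- Write the entry of the matrix in row `i` and column `p`, where `i` and `p` are the loop
variables in arrays `31` and `32`. In the rows below the first `m` ones, the power of the point in
place `p` is raised by one first. -/
def outputEntry : LProg :=
  seq (ite (.sub (var 16) (var 31))
      (ite (diff (.get 14 (var 32)) (var 31)) (set 1 (var 30) (var 9)) (set 1 (var 30) (var 10)))
      (seq (set 15 (var 32) (fmul (.get 15 (var 32)) (.get 12 (var 32))))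
        (set 1 (var 30) (.get 15 (var 32)))))
    (set 30 (.const 0) (.add (var 30) (.const 1)))

/-- Write the parity-check matrix of the block system, with `s` rows of powers. -/
def output (s : ℕ) : LProg :=
  seq (set 33 (.const 0) (.add (var 16) (.const s))) <|
    seq (forLt 31 33 <| forLt 32 17 outputEntry) <|
      seq (set 0 (.const 0) (var 33)) (set 0 (.const 1) (var 17))

theorem writes_outputEntry : outputEntry.writes = [1, 1, 15, 1, 30] := rfl

theorem WF_output (s : ℕ) : (output s).WF := by
  simp [output, outputEntry, WF, WF_forLt, writes, writes_forLt]

end LProg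

section Field

variable {F : Type*} [Field F] {q : ℕ} {e : F ≃ Fin q}

namespace LProg

theorem outputEntry_spec {w i p m : ℕ} {x : F} {τ : State} (hc : Consts q w τ) (ht : Tables e τ)
    (hu : Units e τ) (h31 : τ 31 0 = i) (h32 : τ 32 0 = p) (h16 : τ 16 0 = m) (h14 : τ 14 p = p / w)
    (h12 : τ 12 p = e x) (h15 : τ 15 p = e (x ^ (i - m))) :
    outputEntry.run τ 30 0 = τ 30 0 + 1 ∧
      outputEntry.run τ 1 = Function.update (τ 1) (τ 30 0)
        (e (if i < m then if p / w = i then 1 else 0 else x ^ (i - m + 1))) ∧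
      outputEntry.run τ 15 = Function.update (τ 15) p (e (x ^ (i + 1 - m))) := by
  rw [outputEntry, run_seq]
  have c1 : (Expr.sub (var 16) (var 31)).eval τ ≠ 0 ↔ i < m := by
    rw [Expr.eval, eval_var, eval_var, h16, h31]
    omega
  have c2 : (diff (.get 14 (var 32)) (var 31)).eval τ ≠ 0 ↔ p / w ≠ i := by
    rw [eval_diff, Expr.eval, eval_var, eval_var, h32, h14, h31]
  by_cases hi : i < m
  · rw [run_ite_of_ne (c1.2 hi), if_pos hi]
    have h15' : Function.update (τ 15) p (e (x ^ (i + 1 - m)) : ℕ) = τ 15 := by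
      rw [show i + 1 - m = i - m by omega, ← h15, Function.update_eq_self]
    rw [h15']
    by_cases hp : p / w = i
    · rw [run_ite_of_eq (by simpa [hp] using c2), if_pos hp]
      simp [run, write_apply, Expr.eval, eval_var, hu.one]
    · rw [run_ite_of_ne (c2.2 hp), if_neg hp]
      simp [run, write_apply, Expr.eval, eval_var, hu.zero]
  · rw [run_ite_of_eq (by simpa [hi] using c1), if_neg hi, show i + 1 - m = i - m + 1 by omega]
    have hmul : (fmul (.get 15 (var 32)) (.get 12 (var 32))).eval τ = e (x ^ (i - m) * x) :=
      eval_fmul hc ht (by rw [Expr.eval, eval_var, h32, h15])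
        (by rw [Expr.eval, eval_var, h32, h12])
    simp [run, write_apply, Expr.eval, eval_var, hmul, h32, pow_succ]

theorem output_spec {r n m d : ℕ} {σ : State} (hc : Consts q (r + 1) σ) (ht : Tables e σ)
    (hu : Units e σ) (h : Holds q (r + 1) n σ m) (h30 : σ 30 0 = 0) (hd : m + (d - 2) ≤ q * q) :
    HoldsMatrix e ((output (d - 2)).run σ) (vandermondeTypeMatrix d
      fun (b : Fin m) (j : Fin (r + 1)) => elt e (σ 12 (b * (r + 1) + j))) := by
  set N := m * (r + 1) with hN
  set X : ℕ → F := fun p => elt e (σ 12 p) with hX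
  let V : ℕ → ℕ → F := fun i p =>
    if i < m then if p / (r + 1) = i then 1 else 0 else X p ^ (i - m + 1)
  have hwf : (forLt 31 33 (forLt 32 17 outputEntry)).WF := (WF_output 0).2.1
  have hwf' : (forLt 32 17 outputEntry).WF := (WF_forLt.1 hwf).2.2
  set σ₁ := (set 33 (.const 0) (.add (var 16) (.const (d - 2)))).run σ with hσ₁
  have e₁ : ∀ k, k ≠ 33 → σ₁ k = σ k := fun k hk => by simp [hσ₁, run, write_apply, hk]
  have h33 : σ₁ 33 0 = m + (d - 2) := by simp [hσ₁, run, Expr.eval, eval_var, h.blocks]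
  -- Before row `i`, the first `i` rows are written, and array `15` holds the powers of exponent
  -- `i - m`, which is `0` for the first `m` rows.
  have main := forLt_rule hwf (by simp [writes_forLt, writes_outputEntry]) h33
    (by rw [e₁ 5 (by omega), hc.bound]; exact hd)
    (fun i τ => τ 30 0 = i * N ∧ (∀ c < i * N, τ 1 c = e (V (c / N) (c % N))) ∧
      ∀ p < N, τ 15 p = e (X p ^ (i - m)))
    (fun i τ v h => by
      rwa [write_apply_of_ne (by omega), write_apply_of_ne (by omega),
        write_apply_of_ne (by omega)])
    ⟨by rw [e₁ 30 (by omega), h30, zero_mul], fun c hc => by omega, fun p hp => by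
      rw [e₁ 15 (by omega), h.power p hp, hu.one, Nat.zero_sub, pow_zero]⟩ ?_
  · set τ := (forLt 31 33 (forLt 32 17 outputEntry)).run σ₁ with hτ
    have hτe : ∀ k, k ≠ 31 → k ≠ 32 → k ≠ 1 → k ≠ 15 → k ≠ 30 → τ k = σ₁ k :=
      fun k h1 h2 h3 h4 h5 => run_of_notMem_writes (by
        simp [writes_forLt, writes_outputEntry, *])
    have hrun : (output (d - 2)).run σ =
        (set 0 (.const 1) (var 17)).run ((set 0 (.const 0) (var 33)).run τ) := rfl
    have hτ33 : τ 33 0 = m + (d - 2) := by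
      rw [hτe 33 (by omega) (by omega) (by omega) (by omega) (by omega), h33]
    have hτ17 : τ 17 0 = N := by
      rw [hτe 17 (by omega) (by omega) (by omega) (by omega) (by omega), e₁ 17 (by omega), h.places]
    rw [hrun]
    refine ⟨?_, ?_, fun i j => ?_⟩
    · simp [run, write_apply, Expr.eval, eval_var, hτ33]
    · simp [run, write_apply, Expr.eval, eval_var, hτ17, hN]
    have h1 : (set 0 (.const 1) (var 17)).run ((set 0 (.const 0) (var 33)).run τ) 1 = τ 1 := by
      simp [run, write_apply]
    have hlt : (i : ℕ) * N + j < (m + (d - 2)) * N := mul_add_lt i.2 j.2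
    obtain ⟨hdiv, hmod⟩ := pair_div_mod (u := (i : ℕ)) j.2
    rw [h1, main.2.1 _ hlt, hdiv, hmod]
    refine congrArg (fun x => (e x : ℕ)) ?_
    induction i using Fin.addCases with
    | left b =>
      simp [V, vandermondeTypeMatrix, Fin.ext_iff]
    | right s =>
      simp [V, vandermondeTypeMatrix, X, Nat.div_add_mod']
  rintro i hi τ hτ hτi ⟨hp, hV, hX'⟩
  simp only [writes_forLt, writes_outputEntry, List.mem_cons, List.not_mem_nil, or_false] at hτ
  have hτe : ∀ k, k ≠ 31 → k ≠ 32 → k ≠ 1 → k ≠ 15 → k ≠ 30 → k ≠ 33 → τ k = σ k :=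
    fun k h1 h2 h3 h4 h5 h6 => by rw [hτ k (by omega), e₁ k h6]
  have h17 : τ 17 0 = N := by
    rw [hτe 17 (by omega) (by omega) (by omega) (by omega) (by omega) (by omega), h.places]
  have inner := forLt_rule hwf' (by simp [writes_outputEntry]) h17
    (by
      rw [hτe 5 (by omega) (by omega) (by omega) (by omega) (by omega) (by omega), hc.bound]
      exact h.le)
    (fun p ρ => ρ 30 0 = i * N + p ∧ (∀ c < i * N + p, ρ 1 c = e (V (c / N) (c % N))) ∧
      ∀ p' < N, ρ 15 p' = e (X p' ^ (if p' < p then i + 1 - m else i - m)))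
    (fun p ρ v h => by
      rwa [write_apply_of_ne (by omega), write_apply_of_ne (by omega),
        write_apply_of_ne (by omega)])
    ⟨hp, hV, fun p' hp' => by simpa using hX' p' hp'⟩ ?_
  · obtain ⟨h1, h2, h3⟩ := inner
    refine ⟨by rw [h1, Nat.succ_mul], fun c hc => h2 c (by rwa [← Nat.succ_mul]), fun p hp => ?_⟩
    rw [h3 p hp, if_pos hp]
  rintro p hp ρ hρ hρp ⟨h1, h2, h3⟩
  simp only [writes_outputEntry, List.mem_cons, List.not_mem_nil, or_false] at hρ
  have hρe : ∀ k, k ≠ 31 → k ≠ 32 → k ≠ 1 → k ≠ 15 → k ≠ 30 → k ≠ 33 → ρ k = σ k :=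
    fun k h1 h2 h3 h4 h5 h6 => by rw [hρ k (by omega), hτe k h1 h2 h3 h4 h5 h6]
  have he : ∀ k, k < 15 → k ≠ 1 → ρ k = σ k := fun k h1 h2 =>
    hρe k (by omega) (by omega) (by omega) (by omega) (by omega) (by omega)
  obtain ⟨h4, h5, h6⟩ := outputEntry_spec (x := X p) (m := m)
    (hc.congr fun k _ _ => he k (by omega) (by omega))
    (ht.congr (he 2 (by omega) (by omega)) (he 3 (by omega) (by omega)))
    ⟨by rw [he 9 (by omega) (by omega), hu.zero], by rw [he 10 (by omega) (by omega), hu.one],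
      by rw [he 11 (by omega) (by omega), hu.neg_one]⟩
    (i := i) (by rw [hρ 31 (by omega), hτi]) hρp
    (by
      rw [hρe 16 (by omega) (by omega) (by omega) (by omega) (by omega) (by omega), h.blocks])
    (by rw [he 14 (by omega) (by omega), h.owner p hp])
    (by rw [he 12 (by omega) (by omega), val_elt (h.good.lt p hp)])
    (by rw [h3 p hp, if_neg (lt_irrefl p)])
  refine ⟨by rw [h4, h1, add_assoc], fun c hc => ?_, fun p' hp' => ?_⟩
  · rw [h5, h1]
    rcases Nat.lt_succ_iff_lt_or_eq.1 (show c < i * N + p + 1 from hc) with hc | rfl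
    · rw [Function.update_of_ne hc.ne, h2 c hc]
    · obtain ⟨hdiv, hmod⟩ := pair_div_mod (u := i) hp
      rw [Function.update_self, hdiv, hmod]
  · rw [h6]
    by_cases hpp : p' = p
    · rw [hpp, Function.update_self, if_pos (Nat.lt_succ_self p)]
    · rw [Function.update_of_ne hpp, h3 p' hp']
      simp only [show p' < p + 1 ↔ p' < p by omega]

end LProg
end Field

/-! ### The whole program -/

theorem inputState_of_lt {F : Type*} [Field F] {q r k : ℕ} (e : F ≃ Fin q) (hk : 3 < k) (i : ℕ) :
    inputState e r k i = 0 :=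
  match k, hk with
  | _ + 4, _ => rfl

theorem tables_inputState {F : Type*} [Field F] {q : ℕ} (e : F ≃ Fin q) (r : ℕ) :
    Tables e (inputState e r) := by
  have h : ∀ x y : F, (e x : ℕ) * q + e y < q * q ∧ ((e x : ℕ) * q + e y) / q = e x ∧
      ((e x : ℕ) * q + e y) % q = e y := fun x y =>
    ⟨mul_add_lt (e x).2 (e y).2, pair_div_mod (e y).2⟩
  constructor <;> intro x y <;> obtain ⟨h1, h2, h3⟩ := h x y <;>
    simp [inputState, h1, h2, h3, elt_val]

/-- Construct a long block system and write its parity-check matrix. The loops are bounded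
by `q²`. -/
def construct (d : ℕ) : LProg :=
  .seq (start ((d - 1) / 2 - 2)) <| .seq (rounds ((d - 1) / 2 - 2)) <| output (d - 2)

/-- The whole program. The bound of the loops is `q` until the number `q²` has been computed. -/
def program (d : ℕ) : Prog :=
  .seq (.set 5 (.const 0) (var 0)) <| .seq prelude.compile <|
    .seq (.set 5 (.const 0) (var 29)) (construct d).compile

open Polynomial in
/-- A polynomial bound in `q` for the running time of the program. -/
noncomputable def programCost (d : ℕ) : Polynomial ℕ :=
  C 8 + prelude.costPoly + (construct d).costPoly.comp (X * X)

/-- The field sizes for which the construction works. -/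
def minFieldSize (d r : ℕ) : ℕ := 2 * (r + 1) * (4 * (r + 1)) ^ ((d - 1) / 2 - 1)

theorem WF_construct (d : ℕ) : (construct d).WF :=
  ⟨WF_start _, WF_rounds _, WF_output _⟩

/-- The memory after the initialization. -/
theorem prelude_inputState {F : Type*} [Field F] {q r : ℕ} (e : F ≃ Fin q) (n : ℕ) :
    ∃ σ, σ = prelude.run (write (inputState e r) 5 0 q) ∧ σ 29 0 = q * q ∧
      ∀ τ, τ = write σ 5 0 (q * q) → Consts q (r + 1) τ ∧ Tables e τ ∧ τ 1 0 = r ∧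
        Holds q (r + 1) n τ 0 ∧ τ 19 0 = 0 ∧ τ 30 0 = 0 := by
  obtain ⟨h6, h7, h8, h29, h41⟩ := prelude_spec (σ := write (inputState e r) 5 0 q)
    (q := q) (r := r)
    (by simp [write_apply, inputState]) (by simp [write_apply, inputState]) (by simp)
    (by simp [write_apply, inputState]) (by simp [write_apply, inputState])
  refine ⟨_, rfl, h29, ?_⟩
  rintro τ rfl
  set σ := prelude.run (write (inputState e r) 5 0 q)
  set τ := write σ 5 0 (q * q) with hτ
  have hτe : ∀ k, k ≠ 5 → τ k = σ k := fun k hk => write_apply_of_ne hk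
  have he : ∀ k, k < 5 ∨ 8 < k → k ≠ 20 → k ≠ 29 → k ≠ 41 → τ k = inputState e r k :=
    fun k h1 h2 h3 h4 => by
      rw [hτe k (by omega), ← write_apply_of_ne (σ := inputState e r) (k := 5) (i := 0) (v := q)
        (show k ≠ 5 by omega)]
      refine run_of_notMem_writes ?_
      simp [prelude, writes, writes_forLt, *]
      omega
  have h0 : ∀ k i, 8 < k → k ≠ 20 → k ≠ 29 → k ≠ 41 → τ k i = 0 := fun k i h1 h2 h3 h4 => by
    rw [he k (by omega) h2 h3 h4, inputState_of_lt e (by omega)]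
  have hadj : ∀ u < q, ∀ v < q, τ 41 (u * q + v) ≠ 0 ↔ u = v ∨ Adj (τ 12) (r + 1) 0 u v := by
    intro u hu v hv
    rw [hτe 41 (by omega), h41]
    constructor
    · rintro ⟨x, hx, h⟩
      obtain ⟨rfl, rfl⟩ := pair_inj hv hx h
      exact .inl rfl
    · rintro (rfl | ⟨b, hb, -⟩)
      · exact ⟨u, hu, rfl⟩
      · omega
  have ht := tables_inputState e r
  refine ⟨⟨by simp [hτ], by rw [hτe 6 (by omega), h6], by rw [hτe 7 (by omega), h7],
      by rw [hτe 8 (by omega)]; exact h8⟩,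
    ht.congr (he 2 (by omega) (by omega) (by omega) (by omega))
      (he 3 (by omega) (by omega) (by omega) (by omega)),
    by rw [he 1 (by omega) (by omega) (by omega) (by omega)]; simp [inputState], ?_,
    h0 19 0 (by omega) (by omega) (by omega) (by omega),
    h0 30 0 (by omega) (by omega) (by omega) (by omega)⟩
  exact
  { blocks := h0 16 0 (by omega) (by omega) (by omega) (by omega)
    places := by rw [h0 17 0 (by omega) (by omega) (by omega) (by omega), zero_mul]
    le := by omega
    good := ⟨fun p hp => by omega, fun b hb => by omega⟩
    degree := fun v _ => by
      rw [h0 13 v (by omega) (by omega) (by omega) (by omega)]; simp [deg]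
    owner := fun p hp => by omega
    power := fun p hp => by omega
    adj := hadj
    layer := fun k _ u hu v hv h => by
      rcases Nat.eq_zero_or_pos k with rfl | hk
      · exact Reach.one.2 ((hadj u hu v hv).1 h)
      · exact absurd (h0 (41 + k) _ (by omega) (by omega) (by omega) (by omega)) h }

/-- The construction is correct and takes polynomial time. -/
theorem exec_program {d r q : ℕ} (hd : 5 ≤ d) (hdr : d - 2 ≤ r) {F : Type*} [Field F] [Fintype F]
    [DecidableEq F] (hq : minFieldSize d r ≤ q) (e : F ≃ Fin q) :
    ∃ (m : ℕ) (a : Fin m → Fin (r + 1) → F), GivesLongOptimalLRC d a ∧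
      ∃ (τ : State) (T : ℕ), Exec (program d) (inputState e r) τ T ∧
        T ≤ (programCost d).eval q ∧ HoldsMatrix e τ (vandermondeTypeMatrix d a) := by
  obtain ⟨n, hn⟩ : ∃ n, n = (d - 1) / 2 - 2 := ⟨_, rfl⟩
  have hn1 : (d - 1) / 2 - 1 = n + 1 := by omega
  have hq' : 2 * (r + 1) * (4 * (r + 1)) ^ (n + 1) ≤ q := by rwa [← hn1]
  have hqr : 2 * (r + 1) ≤ q := (two_mul_lt hq').2.1
  have hqq : q ≤ q * q := Nat.le_mul_self q
  have hcard : Fintype.card F = q := by rw [Fintype.card_congr e, Fintype.card_fin]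
  -- The initialization and the first two blocks.
  obtain ⟨σ₁, hσ₁, h29, h⟩ := prelude_inputState (r := r) e n
  obtain ⟨σ₂, hσ₂⟩ : ∃ σ₂, σ₂ = write σ₁ 5 0 (q * q) := ⟨_, rfl⟩
  obtain ⟨hc₂, ht₂, h1, hH₂, h19, h30⟩ := h σ₂ hσ₂
  obtain ⟨hu₃, hH₃, hdeg₃, h19₃, heq, hne⟩ := start_spec hc₂ ht₂ h1 hH₂ h19 (by omega) hq'
  set σ₃ := (start n).run σ₂ with hσ₃
  have e₃ : ∀ k, k < 9 ∨ 28 < k ∧ k < 41 → σ₃ k = σ₂ k := fun k hk =>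
    run_of_notMem_writes (notMem_writes_start hk)
  have hc₃ : Consts q (r + 1) σ₃ := hc₂.congr fun k _ _ => e₃ k (by omega)
  -- The rounds, up to the limit for the degrees for which the counting argument is best.
  obtain ⟨D₀, hD₀, hD₀q, hstuck⟩ := exists_degree d r q hd hq
  rw [hn1] at hstuck
  obtain ⟨m, hm, hH₄, hlong, hold⟩ := rounds_spec hc₃ (by omega) hH₃ hdeg₃ h19₃
    (fun m => lengthBound q d r ≤ ((m * (r + 1) : ℕ) : ℝ))
    (fun m m' hmm h => h.trans (by exact_mod_cast Nat.mul_le_mul_right _ hmm))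
    (fun m hm => lengthBound_le_of_lt d r q _ hd hqr hm) hD₀ hD₀q (fun m hm => hstuck _ hm)
  set σ₄ := (rounds n).run σ₃ with hσ₄
  have e₄ : ∀ k, k < 12 ∨ 24 < k ∧ k < 31 → k ≠ 25 → σ₄ k = σ₃ k := fun k hk hk' =>
    run_of_notMem_writes (notMem_writes_rounds (by omega) hk')
  have hc₄ : Consts q (r + 1) σ₄ := hc₃.congr fun k _ _ => e₄ k (by omega) (by omega)
  have hrow : m + (d - 2) ≤ q * q := by
    have h1 := hH₄.le
    have h2 : 1 * r ≤ m * r := Nat.mul_le_mul_right r (by omega)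
    rw [mul_add, mul_one] at h1
    omega
  have hout := output_spec (d := d) hc₄
    ((ht₂.congr (e₃ 2 (by omega)) (e₃ 3 (by omega))).congr (e₄ 2 (by omega) (by omega))
      (e₄ 3 (by omega) (by omega)))
    ⟨by rw [e₄ 9 (by omega) (by omega), hu₃.zero], by rw [e₄ 10 (by omega) (by omega), hu₃.one],
      by rw [e₄ 11 (by omega) (by omega), hu₃.neg_one]⟩ hH₄
    (by rw [e₄ 30 (by omega) (by omega), e₃ 30 (by omega), h30]) hrow
  have hLi : ∀ i < r, σ₄ 12 i = σ₃ 12 i := fun i hi => hold i (by omega)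
  have hprod : ∀ z : F, ∏ i ∈ Finset.range r, (z - elt e (σ₄ 12 i)) =
      ∏ i ∈ Finset.range r, (z - elt e (σ₃ 12 i)) := fun z =>
    Finset.prod_congr rfl fun i hi => by rw [hLi i (Finset.mem_range.1 hi)]
  refine ⟨m, _, givesLongOptimalLRC e hd hdr hm (L := σ₄ 12) (hn1 ▸ hH₄.good) ?_ ?_ ?_, ?_⟩
  · rw [hprod, hprod, hold (r + 1) (by omega), hold (r + 2) (by omega), heq]
  · rwa [hprod, hold (r + 1) (by omega)]
  · rwa [hcard]
  obtain ⟨T₁, hT₁, hex₁⟩ := exec_compile WF_prelude (write (inputState e r) 5 0 q)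
  rw [← hσ₁] at hex₁
  obtain ⟨T₂, hT₂, hex₂⟩ := exec_compile (WF_construct d) σ₂
  have hrun : (construct d).run σ₂ = (output (d - 2)).run σ₄ := by
    rw [construct, run_seq, run_seq, ← hn]
  rw [hrun] at hex₂
  refine ⟨_, 4 + (T₁ + (4 + T₂)), ?_, ?_, hout⟩
  · have hset : ∀ (σ : State) (k c : ℕ), σ k 0 = c →
        Exec (.set 5 (.const 0) (var k)) σ (write σ 5 0 c) 4 := by
      rintro σ k c rfl
      exact Exec.set 5 (.const 0) (var k) σ
    exact (hset _ 0 q (by simp [inputState])).seq (hex₁.seq ((hσ₂ ▸ hset _ 29 _ h29).seq hex₂))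
  · rw [hc₂.bound] at hT₂
    simp only [write_apply_self, Function.update_self] at hT₁
    simp only [programCost, Polynomial.eval_add, Polynomial.eval_C, Polynomial.eval_comp,
      Polynomial.eval_mul, Polynomial.eval_X]
    omega

end RAM

theorem mainTheorem4 (d : ℕ) (hd : 5 ≤ d) :
    ∃ q₀ : ℕ → ℕ,
      (∀ r : ℕ, d - 2 ≤ r → ∀ (F : Type*) [Field F] [Fintype F] [DecidableEq F],
        q₀ r ≤ Fintype.card F →
          ∃ (m : ℕ) (a : Fin m → Fin (r + 1) → F), GivesLongOptimalLRC d a) ∧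
      (∃ (P : RAM.Prog) (p : Polynomial ℕ), ∀ r : ℕ, d - 2 ≤ r →
        ∀ (q : ℕ) (F : Type*) [Field F] [Fintype F] [DecidableEq F],
        Fintype.card F = q → q₀ r ≤ q → ∀ e : F ≃ Fin q,
          ∃ (m : ℕ) (a : Fin m → Fin (r + 1) → F), GivesLongOptimalLRC d a ∧
            ∃ (τ : RAM.State) (T : ℕ), RAM.Exec P (RAM.inputState e r) τ T ∧
              T ≤ p.eval q ∧ RAM.HoldsMatrix e τ (vandermondeTypeMatrix d a)) := by
  refine ⟨RAM.minFieldSize d, fun r hr F _ _ _ hF => ?_, RAM.program d, RAM.programCost d,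
    fun r hr q F _ _ _ _ hq e => RAM.exec_program hd hr hq e⟩
  obtain ⟨m, a, h, -⟩ := RAM.exec_program hd hr hF (Fintype.equivFin F)
  exact ⟨m, a, h⟩
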